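/- Let $n\ge 2$ and let $\Omega\subset\mathbb R^n_x\times\mathbb R_t$ be bounded and open. Let $\mathcal S^n_0$ be the space of symmetric trace-free real $n\times n$ matrices, let $$K=\Bigl\{(v,u)\in\mathbb R^n\times\mathcal S^n_0:\ u=v\otimes v-\tfrac1n|v|^2I_n,\ |v|=1\Bigr\},$$ and let $\mathcal U$ be the interior of $K^{co}\times[-1,1]$ in $\mathbb R^n\times\mathcal S^n_0\times\mathbb R$, where $K^{co}$ is the convex hull of $K$. Let $X_0$ be the set of all $(v,u,q)\in C^\infty(\mathbb R^n_x\times\mathbb R_t;\ \mathbb R^n\times\mathcal S^n_0\times\mathbb R)$ with support in $\Omega$ and values in $\mathcal U$ such that $$\partial_t v+\operatorname{div}u+\nabla q=0,\qquad \operatorname{div}v=0,$$ and let $X$ be the closure of $X_0$ in $L^\infty$ with respect to the weak-$*$ topology. Call $(v,p)$ a solution constructed in $\Omega$ if there are $u,q$ with $(v,u,q)\in X$, $|v|=1$ a.e. in $\Omega$, and $p=q-\frac1n|v|^2$ a.e. Then solutions constructed in $\Omega$ exist. Moreover, every solution $(v,p)$ constructed in $\Omega$ is a bounded distributional solution on $\mathbb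 R^n_x\times\mathbb R_t$ of the Euler equations $$\partial_t v+\operatorname{div}(v\otimes v)+\nabla p=0,\qquad \operatorname{div}v=0,$$ with $|v|=1$ a.e. in $\Omega$ and $v=0$, $p=0$ a.e. outside $\Omega$, and it has the following property. There exist sequences $(v_k)$, $(p_k)$, $(f_k)$ in $C^\infty_c(\Omega)$ (extended by $0$) such that, for all $k$, $$\partial_t v_k+\operatorname{div}(v_k\otimes v_k)+\nabla p_k=f_k,\qquad \operatorname{div}v_k=0,$$ and * $f_k\to0$ in $H^{-1}(\mathbb R^n_x\times\mathbb R_t)$, * $\|v_k\|_\infty+\|p_k\|_\infty$ is uniformly bounded in $k$, * $(v_k,p_k)\to(v,p)$ in $L^q(\mathbb R^n_x\times\mathbb R_t)$ for every $1\le q<\infty$. -/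

import Mathlib

open MeasureTheory Filter Topology
open scoped ENNReal ContDiff

noncomputable section

namespace EulerInclusion

/-- Euclidean space `ℝⁿ`. -/
abbrev Vec (n : ℕ) : Type := EuclideanSpace ℝ (Fin n)

/-- Space-time `ℝⁿ_x × ℝ_t`, with Lebesgue measure. -/
abbrev SpaceTime (n : ℕ) : Type := Vec n × ℝ

/-- Spatial partial derivative `∂_{x_i} g`. -/
def dx {n : ℕ} (i : Fin n) (g : SpaceTime n → ℝ) (y : SpaceTime n) : ℝ :=
  fderiv ℝ g y (EuclideanSpace.single i 1, 0)

/-- Time derivative `∂_t g`. -/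
def dt {n : ℕ} (g : SpaceTime n → ℝ) (y : SpaceTime n) : ℝ :=
  fderiv ℝ g y (0, 1)

/-- The class `C_c^∞` of smooth compactly supported functions on space-time. -/
def IsTest {n : ℕ} {F : Type} [NormedAddCommGroup F] [NormedSpace ℝ F]
    (φ : SpaceTime n → F) : Prop :=
  ContDiff ℝ ∞ φ ∧ HasCompactSupport φ

/-- `v` and `p` are bounded and solve `∂ₜ v + div (v ⊗ v) + ∇ p = 0`, `div v = 0` on the whole
space-time in the sense of distributions. -/
def IsBoundedWeakEulerSolution {n : ℕ} (v : SpaceTime n → Vec n) (p : SpaceTime n → ℝ) : Prop :=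
  MemLp v ∞ volume ∧ MemLp p ∞ volume ∧
  (∀ φ : SpaceTime n → Vec n, IsTest φ →
    ∫ y, ((∑ i, v y i * dt (fun w => φ w i) y)
      + (∑ i, ∑ j, v y i * v y j * dx j (fun w => φ w i) y)
      + p y * ∑ i, dx i (fun w => φ w i) y) = 0) ∧
  (∀ ψ : SpaceTime n → ℝ, IsTest ψ → ∫ y, ∑ i, v y i * dx i ψ y = 0)

/-- The pointwise equations `∂ₜ v + div (v ⊗ v) + ∇ p = f`, `div v = 0`, for smooth `v`, `p`. -/
def SolvesForcedEuler {n : ℕ} (v : SpaceTime n → Vec n) (p : SpaceTime n → ℝ)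
    (f : SpaceTime n → Vec n) : Prop :=
  (∀ y i, dt (fun w => v w i) y + (∑ j, dx j (fun w => v w i * v w j) y) + dx i p y = f y i) ∧
  (∀ y, ∑ i, dx i (fun w => v w i) y = 0)

/-- The squared `H¹(ℝⁿ × ℝ; ℝⁿ)` norm of a test function. -/
def h1NormSq {n : ℕ} (φ : SpaceTime n → Vec n) : ℝ :=
  ∫ y, ∑ i, ((φ y i) ^ 2 + (∑ j, (dx j (fun w => φ w i) y) ^ 2) + (dt (fun w => φ w i) y) ^ 2)

/-- The `H⁻¹(ℝⁿ × ℝ; ℝⁿ)` norm of `f`, as the dual norm of `H¹`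
(in which `C_c^∞` is dense). -/
def hNegOneNorm {n : ℕ} (f : SpaceTime n → Vec n) : ℝ≥0∞ :=
  ⨆ (φ : SpaceTime n → Vec n) (_ : IsTest φ ∧ h1NormSq φ ≤ 1),
    ENNReal.ofReal |∫ y, ∑ i, f y i * φ y i|

/-- The space of symmetric trace-free `n × n` matrices. -/
def SymTF (n : ℕ) : Submodule ℝ (Matrix (Fin n) (Fin n) ℝ) where
  carrier := {A | A.transpose = A ∧ A.trace = 0}
  add_mem' := by
    rintro A B ⟨hA, hA'⟩ ⟨hB, hB'⟩
    exact ⟨by rw [Matrix.transpose_add, hA, hB], by rw [Matrix.trace_add, hA', hB', add_zero]⟩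
  zero_mem' := ⟨Matrix.transpose_zero, Matrix.trace_zero _ _⟩
  smul_mem' := by
    rintro c A ⟨hA, hA'⟩
    exact ⟨by rw [Matrix.transpose_smul, hA], by rw [Matrix.trace_smul, hA', smul_zero]⟩

/-- The state space of the triples `(v, u, q)`. -/
abbrev State (n : ℕ) : Type := Vec n × SymTF n × ℝ

/-- The set `K` of pairs `(v, u)` with `|v| = 1` and `u = v ⊗ v - (1/n) |v|² Iₙ`. -/
def K (n : ℕ) : Set (Vec n × SymTF n) :=
  {a | (∀ i j, a.2.1 i j
      = a.1 i * a.1 j - ‖a.1‖ ^ 2 / (n : ℝ) * (1 : Matrix (Fin n) (Fin n) ℝ) i j) ∧ ‖a.1‖ = 1}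

/-- The set `𝒰`, the interior of `K^{co} × [-1, 1]` in the state space. -/
def U (n : ℕ) : Set (State n) :=
  interior {a | (a.1, a.2.1) ∈ convexHull ℝ (K n) ∧ a.2.2 ∈ Set.Icc (-1 : ℝ) 1}

/-- The set `X₀` of smooth `z = (v, u, q)`, supported in `Ω`, with values in `𝒰`, that solve
`∂ₜ v + div u + ∇ q = 0`, `div v = 0`. -/
def X0 {n : ℕ} (Ω : Set (SpaceTime n)) : Set (SpaceTime n → State n) :=
  {z | ContDiff ℝ ∞ (fun y => (z y).1) ∧
    (∀ i j, ContDiff ℝ ∞ (fun y => (z y).2.1.1 i j)) ∧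
    ContDiff ℝ ∞ (fun y => (z y).2.2) ∧
    tsupport z ⊆ Ω ∧
    (∀ y i, dt (fun w => (z w).1 i) y + (∑ j, dx j (fun w => (z w).2.1.1 i j) y)
      + dx i (fun w => (z w).2.2) y = 0) ∧
    (∀ y, ∑ i, dx i (fun w => (z w).1 i) y = 0) ∧
    (∀ y, z y ∈ U n)}

/-- The set `X`, the closure of `X₀` in `L^∞` for the weak-* topology: every basic weak-*
neighbourhood of `z`, given by finitely many `L¹` functions and `ε > 0`, meets `X₀`. -/
def X {n : ℕ} (Ω : Set (SpaceTime n)) : Set (SpaceTime n → State n) :=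
  {z | MemLp (fun y => (z y).1) ∞ volume ∧
    (∀ i j, MemLp (fun y => (z y).2.1.1 i j) ∞ volume) ∧
    MemLp (fun y => (z y).2.2) ∞ volume ∧
    ∀ (m : ℕ) (g : Fin m → SpaceTime n → ℝ) (ε : ℝ), (∀ l, Integrable (g l) volume) → 0 < ε →
      ∃ z₀ ∈ X0 Ω, ∀ l,
        (∀ i, |∫ y, g l y * ((z₀ y).1 i - (z y).1 i)| < ε) ∧
        (∀ i j, |∫ y, g l y * ((z₀ y).2.1.1 i j - (z y).2.1.1 i j)| < ε) ∧
        |∫ y, g l y * ((z₀ y).2.2 - (z y).2.2)| < ε}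

/-- The pairs `(v, p)` that the construction in `Ω` produces: `p = q - (1/n) |v|²`
for some `(v, u, q) ∈ X` with `|v| = 1` a.e. in `Ω`. -/
def IsConstructed {n : ℕ} (Ω : Set (SpaceTime n)) (v : SpaceTime n → Vec n)
    (p : SpaceTime n → ℝ) : Prop :=
  ∃ z ∈ X Ω, (∀ y, (z y).1 = v y) ∧ (∀ᵐ y ∂volume.restrict Ω, ‖v y‖ = 1) ∧
    p =ᵐ[volume] fun y => (z y).2.2 - ‖v y‖ ^ 2 / (n : ℝ)

/-- The approximation property of `(v, p)` by smooth solutions with compact support in `Ω`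
of the Euler equations with forces tending to `0` in `H⁻¹`. -/
def IsLimitOfForcedSmooth {n : ℕ} (Ω : Set (SpaceTime n)) (v : SpaceTime n → Vec n)
    (p : SpaceTime n → ℝ) : Prop :=
  ∃ (vk : ℕ → SpaceTime n → Vec n) (pk : ℕ → SpaceTime n → ℝ) (fk : ℕ → SpaceTime n → Vec n),
    (∀ k, IsTest (vk k) ∧ IsTest (pk k) ∧ IsTest (fk k)) ∧
    (∀ k, tsupport (vk k) ⊆ Ω ∧ tsupport (pk k) ⊆ Ω ∧ tsupport (fk k) ⊆ Ω) ∧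
    (∀ k, SolvesForcedEuler (vk k) (pk k) (fk k)) ∧
    Tendsto (fun k => hNegOneNorm (fk k)) atTop (𝓝 0) ∧
    (∃ C : ℝ, ∀ k y, ‖vk k y‖ ≤ C ∧ |pk k y| ≤ C) ∧
    (∀ r : ℝ≥0∞, 1 ≤ r → r < (⊤ : ℝ≥0∞) →
      Tendsto (fun k => eLpNorm (fun y => vk k y - v y) r volume) atTop (𝓝 0) ∧
      Tendsto (fun k => eLpNorm (fun y => pk k y - p y) r volume) atTop (𝓝 0))

end EulerInclusion

end

noncomputable section

namespace EulerInclusion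

/-- The symmetric trace-free part of a square matrix. -/
def symDev {n : ℕ} (M : Matrix (Fin n) (Fin n) ℝ) : SymTF n :=
  ⟨Matrix.of fun i j => (M i j + M j i) / 2 - M.trace / n * (1 : Matrix (Fin n) (Fin n) ℝ) i j, by
    constructor
    · ext i j
      simp only [Matrix.transpose_apply, Matrix.of_apply, Matrix.one_apply, eq_comm (a := j)]
      ring
    · rcases Nat.eq_zero_or_pos n with rfl | hn
      · simp [Matrix.trace]
      · have : (n : ℝ) ≠ 0 := by positivity
        simp only [Matrix.trace, Matrix.diag_apply, Matrix.of_apply, Finset.sum_sub_distrib,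
          Matrix.one_apply_eq, mul_one, Finset.sum_const, Finset.card_univ, Fintype.card_fin,
          nsmul_eq_mul, add_self_div_two]
        field_simp
        ring⟩

theorem symDev_apply {n : ℕ} (M : Matrix (Fin n) (Fin n) ℝ) (i j : Fin n) :
    (symDev M).1 i j
      = (M i j + M j i) / 2 - M.trace / n * (1 : Matrix (Fin n) (Fin n) ℝ) i j := rfl

/-- The matrix `v ⊗ w`. -/
def outer {n : ℕ} (v w : Vec n) : Matrix (Fin n) (Fin n) ℝ := Matrix.of fun i j => v i * w j

theorem outer_apply {n : ℕ} (v w : Vec n) (i j : Fin n) : outer v w i j = v i * w j := rfl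

theorem sum_mul_eq_inner {n : ℕ} (v w : Vec n) : ∑ i, v i * w i = inner ℝ v w := by
  simp [PiLp.inner_apply, mul_comm]

theorem sum_sq_eq_norm_sq {n : ℕ} (v : Vec n) : ∑ i, v i * v i = ‖v‖ ^ 2 := by
  rw [sum_mul_eq_inner, real_inner_self_eq_norm_sq]

theorem trace_outer {n : ℕ} (v w : Vec n) : (outer v w).trace = inner ℝ v w := by
  rw [← sum_mul_eq_inner]; rfl

theorem symDev_outer_self {n : ℕ} (v : Vec n) (i j : Fin n) :
    (symDev (outer v v)).1 i j
      = v i * v j - ‖v‖ ^ 2 / (n : ℝ) * (1 : Matrix (Fin n) (Fin n) ℝ) i j := by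
  rw [symDev_apply, trace_outer, real_inner_self_eq_norm_sq, outer_apply, outer_apply]; ring

theorem SymTF.symm_apply {n : ℕ} (u : SymTF n) (i j : Fin n) : u.1 i j = u.1 j i :=
  congrFun (congrFun u.2.1 j) i

theorem SymTF.sum_diag {n : ℕ} (u : SymTF n) : ∑ i, u.1 i i = 0 := u.2.2

/-- The matrix `Iₙ / n + u - v ⊗ v`. -/
def cov {n : ℕ} (a : Vec n × SymTF n) : Matrix (Fin n) (Fin n) ℝ :=
  Matrix.of fun i j => (1 : Matrix (Fin n) (Fin n) ℝ) i j / n + a.2.1 i j - a.1 i * a.1 j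

/-- The quadratic form of a matrix. -/
def qform {n : ℕ} (S : Matrix (Fin n) (Fin n) ℝ) (ξ : Fin n → ℝ) : ℝ :=
  ∑ i, ∑ j, ξ i * S i j * ξ j

theorem cov_symm {n : ℕ} (a : Vec n × SymTF n) (i j : Fin n) : cov a i j = cov a j i := by
  simp only [cov, Matrix.of_apply, Matrix.one_apply, eq_comm (a := j), SymTF.symm_apply a.2 i j]
  ring

theorem trace_cov {n : ℕ} (hn : 0 < n) (a : Vec n × SymTF n) :
    ∑ i, cov a i i = 1 - ‖a.1‖ ^ 2 := by
  have : (n : ℝ) ≠ 0 := by positivity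
  simp only [cov, Matrix.of_apply, Finset.sum_sub_distrib, Finset.sum_add_distrib,
    SymTF.sum_diag, sum_sq_eq_norm_sq, Matrix.one_apply_eq, Finset.sum_const, Finset.card_univ,
    Fintype.card_fin, nsmul_eq_mul]
  field_simp
  ring

theorem qform_eq_of_sum {n : ℕ} {ι : Type*} (J : Finset ι) (σ : ι → ℝ) (d : ι → Vec n)
    (S : Matrix (Fin n) (Fin n) ℝ)
    (hS : ∀ i k, S i k = ∑ j ∈ J, σ j * (d j i * d j k)) (ξ : Fin n → ℝ) :
    qform S ξ = ∑ j ∈ J, σ j * (∑ i, ξ i * d j i) ^ 2 := by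
  simp only [qform, hS, sq, Finset.mul_sum, Finset.sum_mul]
  simp_rw [Finset.sum_comm (s := Finset.univ) (t := J)]
  refine Finset.sum_congr rfl fun j _ => Finset.sum_congr rfl fun i _ =>
    Finset.sum_congr rfl fun k _ => by ring

theorem exists_spectral_decomposition {n : ℕ} (S : Matrix (Fin n) (Fin n) ℝ)
    (hs : ∀ i j, S i j = S j i) (hp : ∀ ξ, 0 ≤ qform S ξ) :
    ∃ (σ : Fin n → ℝ) (d : Fin n → Vec n), (∀ j, 0 ≤ σ j) ∧ (∀ j, ‖d j‖ = 1) ∧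
      ∀ i k, S i k = ∑ j, σ j * (d j i * d j k) := by
  have hH : S.IsHermitian := by
    ext i j; simp [hs i j]
  have hP : S.PosSemidef := by
    refine Matrix.PosSemidef.of_dotProduct_mulVec_nonneg hH fun x => ?_
    have := hp x
    simpa [qform, dotProduct, Matrix.mulVec, Finset.mul_sum, mul_assoc] using this
  refine ⟨hH.eigenvalues, fun j => hH.eigenvectorBasis j, hP.eigenvalues_nonneg,
    fun j => hH.eigenvectorBasis.orthonormal.1 j, fun i k => ?_⟩
  have h := congrFun (congrFun hH.spectral_theorem i) k
  rw [h]
  rw [Unitary.conjStarAlgAut_apply, Matrix.mul_apply]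
  refine Finset.sum_congr rfl fun j _ => ?_
  rw [Matrix.mul_diagonal]
  simp [Matrix.IsHermitian.eigenvectorUnitary_apply, Matrix.star_apply]
  ring

theorem trace_eq_of_sum {n : ℕ} {ι : Type*} (J : Finset ι) (σ : ι → ℝ) (d : ι → Vec n)
    (hd : ∀ j ∈ J, ‖d j‖ = 1) (S : Matrix (Fin n) (Fin n) ℝ)
    (hS : ∀ i k, S i k = ∑ j ∈ J, σ j * (d j i * d j k)) : ∑ i, S i i = ∑ j ∈ J, σ j := by
  simp only [hS]
  rw [Finset.sum_comm]
  refine Finset.sum_congr rfl fun j hj => ?_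
  rw [← Finset.mul_sum, sum_sq_eq_norm_sq, hd j hj]; ring

theorem cov_affine {n : ℕ} (a b : Vec n × SymTF n) (s t : ℝ) (hst : s + t = 1) (ξ : Fin n → ℝ) :
    qform (cov (s • a + t • b)) ξ = s * qform (cov a) ξ + t * qform (cov b) ξ
      + s * t * (∑ i, ξ i * (a.1 i - b.1 i)) ^ 2 := by
  rw [sq, Finset.sum_mul_sum]
  simp only [qform, Finset.mul_sum, ← Finset.sum_add_distrib]
  refine Finset.sum_congr rfl fun i _ => Finset.sum_congr rfl fun j _ => ?_
  obtain rfl : t = 1 - s := by linarith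
  simp [cov]
  ring

theorem qform_cov_nonneg_of_mem_convexHull {n : ℕ} {a : Vec n × SymTF n}
    (ha : a ∈ convexHull ℝ (K n)) (ξ : Fin n → ℝ) : 0 ≤ qform (cov a) ξ := by
  have hc : Convex ℝ {a : Vec n × SymTF n | 0 ≤ qform (cov a) ξ} := by
    intro a ha b hb s t hs ht hst
    change (0 : ℝ) ≤ _ at ha hb ⊢
    rw [cov_affine a b s t hst]
    positivity
  refine convexHull_min (fun b hb => ?_) hc ha
  obtain ⟨h1, h2⟩ := hb
  have : cov b = 0 := by
    ext i j
    simp [cov, h1, h2]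
    ring
  simp [qform, this]

theorem eq_symDev_outer_of_cov {n : ℕ} {a : Vec n × SymTF n} (h : ∀ i j, cov a i j = 0)
    (hv : ‖a.1‖ = 1) : a ∈ K n := by
  refine ⟨fun i j => ?_, hv⟩
  have := h i j
  simp only [cov, Matrix.of_apply] at this
  rw [hv, one_pow, div_mul_eq_mul_div, one_mul]; linarith

theorem mem_convexHull_of_sum {n : ℕ} (hn : 0 < n) {ι : Type*} (J : Finset ι) (σ : ι → ℝ)
    (d : ι → Vec n) (hσ : ∀ j, 0 ≤ σ j) (hd : ∀ j, ‖d j‖ = 1) (a : Vec n × SymTF n)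
    (h : ∀ i k, cov a i k = ∑ j ∈ J, σ j * (d j i * d j k)) : a ∈ convexHull ℝ (K n) := by
  classical
  induction J using Finset.induction_on generalizing a with
  | empty =>
    refine subset_convexHull _ _ (eq_symDev_outer_of_cov (by simpa using h) ?_)
    have h1 := trace_cov hn a
    simp only [h, Finset.sum_empty, Finset.sum_const_zero] at h1
    have : ‖a.1‖ ^ 2 = 1 := by linarith
    nlinarith [norm_nonneg a.1]
  | insert j J hj ih =>
    rcases (hσ j).eq_or_lt with h0 | h0
    · refine ih a fun i k => ?_
      rw [h, Finset.sum_insert hj, ← h0]; ring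
    · set l : ℝ := inner ℝ a.1 (d j) with hl
      set r := Real.sqrt (l ^ 2 + σ j) with hr
      have hr2 : r ^ 2 = l ^ 2 + σ j := Real.sq_sqrt (by positivity)
      have hr0 : 0 < r := Real.sqrt_pos.2 (by positivity)
      have hlr : |l| ≤ r := Real.abs_le_sqrt (by linarith)
      rw [abs_le] at hlr
      set e : Vec n × SymTF n :=
        (d j, symDev (outer a.1 (d j) + outer (d j) a.1 - (2 * l) • outer (d j) (d j))) with he
      have hee : ∀ i k, e.2.1 i k
          = a.1 i * d j k + d j i * a.1 k - 2 * l * (d j i * d j k) := by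
        intro i k
        simp only [he, symDev_apply, Matrix.add_apply, Matrix.sub_apply, Matrix.smul_apply,
          outer_apply, Matrix.trace_add, Matrix.trace_sub, Matrix.trace_smul, trace_outer,
          smul_eq_mul, real_inner_self_eq_norm_sq, hd, real_inner_comm a.1 (d j), ← hl]
        ring
      have key : ∀ s : ℝ, s ^ 2 + 2 * s * l = σ j → a + s • e ∈ convexHull ℝ (K n) := by
        intro s hs
        refine ih _ fun i k => ?_
        have h2 := h i k
        rw [Finset.sum_insert hj, ← hs] at h2
        have h3 : ∑ x ∈ J, σ x * (d x i * d x k)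
          = cov a i k - (s ^ 2 + 2 * s * l) * (d j i * d j k) := by linarith
        rw [h3]
        simp only [cov, Matrix.of_apply, Prod.snd_add, Prod.smul_snd, Submodule.coe_add,
          Submodule.coe_smul, Matrix.add_apply, Matrix.smul_apply, hee, Prod.fst_add,
          Prod.smul_fst, PiLp.add_apply, PiLp.smul_apply, smul_eq_mul]
        simp only [he]
        ring
      have h1 := key (-l + r) (by nlinarith)
      have h2 := key (-l - r) (by nlinarith)
      have := (convex_convexHull ℝ (K n)) h1 h2
        (a := (l + r) / (2 * r)) (b := (r - l) / (2 * r))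
        (div_nonneg (by linarith) (by positivity)) (div_nonneg (by linarith) (by positivity))
        (by field_simp; ring)
      convert this using 1
      have hr' : r ≠ 0 := hr0.ne'
      rw [smul_add, smul_add, smul_smul, smul_smul, add_add_add_comm, ← add_smul, ← add_smul]
      have e1 : (l + r) / (2 * r) + (r - l) / (2 * r) = 1 := by field_simp; ring
      have e2 : (l + r) / (2 * r) * (-l + r) + (r - l) / (2 * r) * (-l - r) = 0 := by
        field_simp; ring
      rw [e1, e2]; simp

theorem mem_convexHull_of_qform_nonneg {n : ℕ} (hn : 0 < n) {a : Vec n × SymTF n}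
    (h : ∀ ξ, 0 ≤ qform (cov a) ξ) : a ∈ convexHull ℝ (K n) := by
  obtain ⟨σ, d, hσ, hd, hS⟩ := exists_spectral_decomposition (cov a) (cov_symm a) h
  exact mem_convexHull_of_sum hn Finset.univ σ d hσ hd a hS

theorem norm_le_one_of_mem_convexHull {n : ℕ} {a : Vec n × SymTF n}
    (ha : a ∈ convexHull ℝ (K n)) : ‖a.1‖ ≤ 1 := by
  have hc : Convex ℝ {a : Vec n × SymTF n | ‖a.1‖ ≤ 1} := by
    intro a ha b hb s t hs ht hst
    change ‖_‖ ≤ 1 at ha hb ⊢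
    have := convex_closedBall (0 : Vec n) 1 (mem_closedBall_zero_iff.2 ha)
      (mem_closedBall_zero_iff.2 hb) hs ht hst
    exact mem_closedBall_zero_iff.1 this
  exact convexHull_min (fun b hb => hb.2.le) hc ha

/-- On `K^{co}` the distance of `u` to `v ⊗ v - |v|² Iₙ / n` is controlled by `1 - |v|²`. -/
theorem abs_sub_symDev_le {n : ℕ} (hn : 0 < n) {a : Vec n × SymTF n}
    (ha : a ∈ convexHull ℝ (K n)) (i j : Fin n) :
    |a.2.1 i j - (symDev (outer a.1 a.1)).1 i j| ≤ 2 * (1 - ‖a.1‖ ^ 2) := by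
  obtain ⟨σ, d, hσ, hd, hS⟩ := exists_spectral_decomposition (cov a) (cov_symm a)
    (qform_cov_nonneg_of_mem_convexHull ha)
  have ht := trace_eq_of_sum Finset.univ σ d (fun j _ => hd j) _ hS
  rw [trace_cov hn] at ht
  have h1 : |cov a i j| ≤ 1 - ‖a.1‖ ^ 2 := by
    rw [hS, ht]
    refine (Finset.abs_sum_le_sum_abs _ _).trans (Finset.sum_le_sum fun k _ => ?_)
    rw [abs_mul, abs_of_nonneg (hσ k), abs_mul]
    have hk : ∀ l, |d k l| ≤ 1 := fun l => (hd k) ▸ PiLp.norm_apply_le (d k) l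
    exact mul_le_of_le_one_right (hσ k) (mul_le_one₀ (hk i) (abs_nonneg _) (hk j))
  have h0 : 0 ≤ 1 - ‖a.1‖ ^ 2 := (abs_nonneg _).trans h1
  have e : a.2.1 i j - (symDev (outer a.1 a.1)).1 i j
      = cov a i j - (1 - ‖a.1‖ ^ 2) * ((1 : Matrix (Fin n) (Fin n) ℝ) i j / n) := by
    rw [symDev_outer_self]; simp only [cov, Matrix.of_apply]; ring
  have hn1 : (1 : ℝ) ≤ n := by exact_mod_cast hn
  have h2 : |(1 : Matrix (Fin n) (Fin n) ℝ) i j / n| ≤ 1 := by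
    rw [Matrix.one_apply]
    split_ifs
    · rw [abs_of_nonneg (by positivity)]; exact (div_le_one (by positivity)).2 hn1
    · simp
  rw [e]
  calc _ ≤ |cov a i j| + |(1 - ‖a.1‖ ^ 2) * ((1 : Matrix (Fin n) (Fin n) ℝ) i j / n)| :=
        abs_sub _ _
    _ ≤ (1 - ‖a.1‖ ^ 2) + (1 - ‖a.1‖ ^ 2) * 1 := by
        rw [abs_mul, abs_of_nonneg h0]; gcongr
    _ = _ := by ring

theorem qform_smul {n : ℕ} (S : Matrix (Fin n) (Fin n) ℝ) (c : ℝ) (ξ : Fin n → ℝ) :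
    qform S (c • ξ) = c ^ 2 * qform S ξ := by
  simp only [qform, Finset.mul_sum]
  refine Finset.sum_congr rfl fun i _ => Finset.sum_congr rfl fun j _ => ?_
  simp; ring

theorem continuous_symTF_apply {n : ℕ} (i j : Fin n) :
    Continuous fun u : SymTF n => u.1 i j :=
  (continuous_apply_apply i j).comp continuous_subtype_val

theorem continuous_qform_cov {n : ℕ} :
    Continuous fun x : (Vec n × SymTF n) × (Fin n → ℝ) => qform (cov x.1) x.2 := by
  have h1 : ∀ i, Continuous fun x : (Vec n × SymTF n) × (Fin n → ℝ) => x.1.1 i := fun i => by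
    fun_prop
  have h2 : ∀ i j, Continuous fun x : (Vec n × SymTF n) × (Fin n → ℝ) => x.1.2.1 i j :=
    fun i j => (continuous_symTF_apply i j).comp (continuous_snd.comp continuous_fst)
  have h3 : ∀ i, Continuous fun x : (Vec n × SymTF n) × (Fin n → ℝ) => x.2 i := fun i => by
    fun_prop
  simp only [qform, cov, Matrix.of_apply]
  refine continuous_finsetSum _ fun i _ => continuous_finsetSum _ fun j _ => ?_
  exact ((h3 i).mul ((continuous_const.add (h2 i j)).sub ((h1 i).mul (h1 j)))).mul (h3 j)

theorem isOpen_setOf_qform_pos {n : ℕ} :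
    IsOpen {a : Vec n × SymTF n | ∀ ξ : Fin n → ℝ, ξ ≠ 0 → 0 < qform (cov a) ξ} := by
  have : {a : Vec n × SymTF n | ∀ ξ : Fin n → ℝ, ξ ≠ 0 → 0 < qform (cov a) ξ}
      = {a | ∀ ξ ∈ Metric.sphere (0 : Fin n → ℝ) 1, 0 < qform (cov a) ξ} := by
    ext a
    refine ⟨fun h ξ hξ => h ξ (by rintro rfl; simp at hξ), fun h ξ hξ => ?_⟩
    have h1 : 0 < ‖ξ‖ := norm_pos_iff.2 hξ
    have h2 := h (‖ξ‖⁻¹ • ξ) (by simp [norm_smul, h1.ne'])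
    rw [qform_smul] at h2
    exact pos_of_mul_pos_right h2 (by positivity)
  rw [this, isOpen_iff_mem_nhds]
  intro a ha
  refine (isCompact_sphere (0 : Fin n → ℝ) 1).eventually_forall_of_forall_eventually
    (x₀ := a) (P := fun a ξ => 0 < qform (cov a) ξ) fun ξ hξ => ?_
  exact continuous_qform_cov.continuousAt.eventually (lt_mem_nhds (ha ξ hξ))

theorem exists_pos_forall_add_smul_mem {n : ℕ} {A : Set (State n)} {a : State n}
    (ha : a ∈ interior A) (b : State n) : ∃ ε : ℝ, 0 < ε ∧ a + ε • b ∈ A ∧ a - ε • b ∈ A := by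
  have hc : Continuous fun t : ℝ => a + t • b := by fun_prop
  have h1 : ∀ᶠ t in 𝓝 (0 : ℝ), a + t • b ∈ A :=
    hc.continuousAt.eventually (by simpa using mem_interior_iff_mem_nhds.1 ha)
  obtain ⟨ε, hε, h⟩ := Metric.eventually_nhds_iff.1 h1
  refine ⟨ε / 2, by positivity, h ?_, ?_⟩
  · rw [Real.dist_0_eq_abs, abs_of_pos (by positivity)]; linarith
  · have := @h (-(ε / 2)) (by rw [Real.dist_0_eq_abs, abs_neg, abs_of_pos (by positivity)]; linarith)
    rw [sub_eq_add_neg]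
    convert this using 2
    exact (neg_smul _ _).symm

theorem mem_U_iff {n : ℕ} (hn : 2 ≤ n) (a : State n) :
    a ∈ U n ↔ (∀ ξ : Fin n → ℝ, ξ ≠ 0 → 0 < qform (cov (a.1, a.2.1)) ξ) ∧ |a.2.2| < 1 := by
  constructor
  · intro ha
    have hn0 : (0 : ℝ) < n := by positivity
    refine ⟨fun ξ hξ => ?_, ?_⟩
    · set x : Vec n := WithLp.toLp 2 ξ with hx
      obtain ⟨ε, hε, -, h⟩ := exists_pos_forall_add_smul_mem ha (0, symDev (outer x x), 0)
      have h2 := qform_cov_nonneg_of_mem_convexHull h.1 ξ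
      have hx0 : 0 < ‖x‖ := by
        rw [norm_pos_iff]; intro h0; apply hξ
        ext i; simpa [hx] using congrArg (fun y : Vec n => y i) h0
      have e1 : qform (cov ((a - ε • ((0 : Vec n), symDev (outer x x), (0 : ℝ))).1,
          (a - ε • ((0 : Vec n), symDev (outer x x), (0 : ℝ))).2.1)) ξ
          = qform (cov (a.1, a.2.1)) ξ - ε * ∑ i, ∑ j, ξ i * (symDev (outer x x)).1 i j * ξ j := by
        simp only [qform, Finset.mul_sum, ← Finset.sum_sub_distrib]
        refine Finset.sum_congr rfl fun i _ => Finset.sum_congr rfl fun j _ => ?_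
        simp [cov]; ring
      have e2 : ∑ i, ∑ j, ξ i * (symDev (outer x x)).1 i j * ξ j
          = ‖x‖ ^ 4 * (1 - 1 / n) := by
        have s1 : ∑ i, ξ i * ξ i = ‖x‖ ^ 2 := sum_sq_eq_norm_sq x
        have s2 : ∀ i j, ξ i * (symDev (outer x x)).1 i j * ξ j = (ξ i * ξ i) * (ξ j * ξ j)
            - ‖x‖ ^ 2 / n * (if i = j then ξ i * ξ j else 0) := by
          intro i j
          rw [symDev_outer_self, Matrix.one_apply]
          simp only [hx]
          split_ifs <;> ring
        simp only [s2, Finset.sum_sub_distrib, ← Finset.mul_sum, ← Finset.sum_mul, s1,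
          Finset.sum_ite_eq, Finset.mem_univ, if_true]
        ring
      rw [e1, e2] at h2
      have h3 : (0 : ℝ) < 1 - 1 / n := by
        have : (1 : ℝ) < n := by exact_mod_cast hn
        rw [sub_pos, div_lt_one hn0]; exact this
      have : 0 < ε * (‖x‖ ^ 4 * (1 - 1 / n)) := by positivity
      linarith
    · obtain ⟨ε, hε, h1, h2⟩ := exists_pos_forall_add_smul_mem ha (0, 0, 1)
      have h3 := h1.2.2
      have h4 := h2.2.1
      simp at h3 h4
      rw [abs_lt]; constructor <;> linarith
  · rintro ⟨h1, h2⟩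
    refine mem_interior.2 ⟨{a : State n | (∀ ξ : Fin n → ℝ, ξ ≠ 0 →
      0 < qform (cov (a.1, a.2.1)) ξ) ∧ |a.2.2| < 1}, ?_, ?_, h1, h2⟩
    · rintro b ⟨hb1, hb2⟩
      refine ⟨mem_convexHull_of_qform_nonneg (by omega) fun ξ => ?_, abs_le.1 hb2.le⟩
      by_cases hξ : ξ = 0
      · simp [hξ, qform]
      · exact (hb1 ξ hξ).le
    · refine IsOpen.inter ?_ ?_
      · exact isOpen_setOf_qform_pos.preimage
          (f := fun a : State n => (a.1, a.2.1)) (by fun_prop)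
      · exact isOpen_lt (f := fun a : State n => |a.2.2|) (by fun_prop) continuous_const

theorem zero_mem_U {n : ℕ} (hn : 2 ≤ n) : (0 : State n) ∈ U n := by
  refine (mem_U_iff hn 0).2 ⟨fun ξ hξ => ?_, by simp⟩
  have : qform (cov ((0 : State n).1, (0 : State n).2.1)) ξ = (∑ i, ξ i ^ 2) / n := by
    simp only [qform, Finset.sum_div]
    refine Finset.sum_congr rfl fun i _ => ?_
    rw [Finset.sum_eq_single i (fun j _ hj => by simp [cov, Matrix.one_apply, hj.symm])
      (by simp)]
    simp [cov]
    ring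
  rw [this]
  have hn0 : (0 : ℝ) < n := by positivity
  obtain ⟨i, hi⟩ := Function.ne_iff.1 hξ
  have : 0 < ∑ i, ξ i ^ 2 :=
    Finset.sum_pos' (fun i _ => sq_nonneg _) ⟨i, Finset.mem_univ i, by
      have : ξ i ≠ 0 := hi
      positivity⟩
  positivity

theorem mem_convexHull_of_mem_U {n : ℕ} {a : State n} (ha : a ∈ U n) :
    (a.1, a.2.1) ∈ convexHull ℝ (K n) := (interior_subset ha).1

theorem norm_lt_one_of_mem_U {n : ℕ} (hn : 2 ≤ n) {a : State n} (ha : a ∈ U n) : ‖a.1‖ < 1 := by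
  have h := ((mem_U_iff hn a).1 ha).1
  have ht := trace_cov (by omega) (a.1, a.2.1)
  have : 0 < ∑ i, cov (a.1, a.2.1) i i := by
    refine Finset.sum_pos (fun i _ => ?_) ⟨⟨0, by omega⟩, Finset.mem_univ _⟩
    have := h (Pi.single i 1) (by simp)
    simpa [qform, Pi.single_apply] using this
  rw [ht] at this
  simp only at this
  nlinarith [norm_nonneg a.1]

/-- The direction `(d, m ⊗ d + d ⊗ m, 0)`. -/
def waveDir {n : ℕ} (m d : Vec n) : State n := (d, symDev ((2 : ℝ) • outer m d), 0)

theorem exists_segment_subset_U {n : ℕ} (hn : 2 ≤ n) {a : State n} (ha : a ∈ U n) :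
    ∃ m d : Vec n, ‖d‖ = 1 ∧ inner ℝ m d = 0 ∧
      ∀ s : ℝ, |s| ≤ (1 - ‖a.1‖ ^ 2) / (3 * n) → a + s • waveDir m d ∈ U n := by
  have hn0 : (0 : ℝ) < n := by positivity
  have hU := (mem_U_iff hn a).1 ha
  obtain ⟨σ, d, hσ, hd, hS⟩ := exists_spectral_decomposition (cov (a.1, a.2.1)) (cov_symm _)
    (qform_cov_nonneg_of_mem_convexHull (mem_convexHull_of_mem_U ha))
  have ht := trace_eq_of_sum Finset.univ σ d (fun j _ => hd j) _ hS
  rw [trace_cov (by omega)] at ht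
  simp only at ht
  set δ := 1 - ‖a.1‖ ^ 2 with hδ
  have hv1 := norm_lt_one_of_mem_U hn ha
  have hδ0 : 0 < δ := by rw [hδ]; nlinarith [norm_nonneg a.1]
  have hδ1 : δ ≤ 1 := by rw [hδ]; nlinarith [norm_nonneg a.1]
  obtain ⟨k, hk⟩ : ∃ k, δ / n ≤ σ k := by
    by_contra! hcon
    have : ∑ j, σ j < ∑ _j : Fin n, δ / n :=
      Finset.sum_lt_sum_of_nonempty ⟨⟨0, by omega⟩, Finset.mem_univ _⟩ fun j _ => hcon j
    simp only [Finset.sum_const, Finset.card_univ, Fintype.card_fin, nsmul_eq_mul] at this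
    rw [mul_div_cancel₀ _ hn0.ne'] at this
    linarith
  set l : ℝ := inner ℝ a.1 (d k) with hl
  have hl1 : |l| ≤ 1 := by
    have := abs_real_inner_le_norm a.1 (d k)
    rw [hd] at this; linarith
  have hmd : inner ℝ (a.1 - l • d k) (d k) = 0 := by
    rw [inner_sub_left, inner_smul_left, real_inner_self_eq_norm_sq, hd]; simp [hl]
  refine ⟨a.1 - l • d k, d k, hd k, hmd, fun s hs => ?_⟩
  refine (mem_U_iff hn _).2 ⟨fun ξ hξ => ?_, by simpa [waveDir] using hU.2⟩
  have e1 : qform (cov ((a + s • waveDir (a.1 - l • d k) (d k)).1,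
      (a + s • waveDir (a.1 - l • d k) (d k)).2.1)) ξ
      = qform (cov (a.1, a.2.1)) ξ - (s ^ 2 + 2 * s * l) * (∑ i, ξ i * d k i) ^ 2 := by
    rw [sq (∑ i, _), Finset.sum_mul_sum]
    simp only [qform, Finset.mul_sum, ← Finset.sum_sub_distrib]
    refine Finset.sum_congr rfl fun i _ => Finset.sum_congr rfl fun j _ => ?_
    simp [cov, waveDir, symDev_apply, outer_apply, trace_outer, hmd]
    ring
  rw [e1]
  have h1 := hU.1 ξ hξ
  have h2 : σ k * (∑ i, ξ i * d k i) ^ 2 ≤ qform (cov (a.1, a.2.1)) ξ := by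
    rw [qform_eq_of_sum Finset.univ σ d _ hS]
    exact Finset.single_le_sum (f := fun j => σ j * (∑ i, ξ i * d j i) ^ 2)
      (fun j _ => mul_nonneg (hσ j) (sq_nonneg _)) (Finset.mem_univ k)
  have h3 : s ^ 2 + 2 * s * l < σ k := by
    have hs' : δ / (3 * n) = (δ / n) / 3 := by rw [div_div, mul_comm]
    rw [hs'] at hs
    have hp : 0 < δ / n := by positivity
    have hq : δ / n ≤ 1 := (div_le_one hn0).2 (hδ1.trans (by exact_mod_cast (by omega)))
    have hsl : s * l ≤ |s| := by
      calc s * l ≤ |s * l| := le_abs_self _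
        _ = |s| * |l| := abs_mul _ _
        _ ≤ |s| * 1 := by gcongr
        _ = |s| := mul_one _
    have hs2 : s ^ 2 ≤ |s| / 3 := by
      rw [← sq_abs]; nlinarith [abs_nonneg s]
    linarith
  by_cases h0 : (∑ i, ξ i * d k i) ^ 2 = 0
  · rw [h0]; linarith
  · have : 0 < (∑ i, ξ i * d k i) ^ 2 := lt_of_le_of_ne (sq_nonneg _) (Ne.symm h0)
    nlinarith

/-- The derivative of `φ` in the direction `a`. -/
def pd {n : ℕ} (a : SpaceTime n) (φ : SpaceTime n → ℝ) (y : SpaceTime n) : ℝ := fderiv ℝ φ y a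

theorem dx_eq_pd {n : ℕ} (i : Fin n) (φ : SpaceTime n → ℝ) (y : SpaceTime n) :
    dx i φ y = pd (EuclideanSpace.single i 1, 0) φ y := rfl

theorem dt_eq_pd {n : ℕ} (φ : SpaceTime n → ℝ) (y : SpaceTime n) : dt φ y = pd (0, 1) φ y := rfl

theorem contDiff_pd {n : ℕ} (a : SpaceTime n) {φ : SpaceTime n → ℝ} (hφ : ContDiff ℝ ∞ φ) :
    ContDiff ℝ ∞ (pd a φ) :=
  (hφ.fderiv_right (m := ∞) (by simp)).clm_apply contDiff_const

theorem pd_comm {n : ℕ} (a b : SpaceTime n) {φ : SpaceTime n → ℝ} (hφ : ContDiff ℝ ∞ φ) :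
    pd a (pd b φ) = pd b (pd a φ) := by
  funext y
  have hd : DifferentiableAt ℝ (fderiv ℝ φ) y :=
    ((hφ.fderiv_right (m := ∞) (by simp)).differentiable (by simp)).differentiableAt
  have key : ∀ a b, pd a (pd b φ) y = fderiv ℝ (fderiv ℝ φ) y a b := fun a b => by
    change fderiv ℝ (fun y => fderiv ℝ φ y b) y a = _
    rw [fderiv_clm_apply hd (by fun_prop)]
    simp
  rw [key, key]
  exact (hφ.contDiffAt.isSymmSndFDerivAt (by
    simp only [minSmoothness_of_isRCLikeNormedField]
    exact WithTop.coe_le_coe.2 (le_top : (2 : ℕ∞) ≤ ⊤))).eq a b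

theorem pd_add_dir {n : ℕ} (a b : SpaceTime n) (φ : SpaceTime n → ℝ) (y : SpaceTime n) :
    pd (a + b) φ y = pd a φ y + pd b φ y := map_add _ _ _

theorem sum_mul_dx {n : ℕ} (d : Vec n) (φ : SpaceTime n → ℝ) (y : SpaceTime n) :
    ∑ j, d j * dx j φ y = pd (d, 0) φ y := by
  have : ((d, 0) : SpaceTime n) = ∑ j, d j • ((EuclideanSpace.single j (1 : ℝ), (0 : ℝ))) := by
    refine Prod.ext ?_ (by simp [Prod.snd_sum])
    ext i
    simp [Prod.fst_sum, Finset.sum_apply, Pi.single_apply]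
  rw [pd, this, map_sum]
  simp only [map_smul]
  rfl

theorem dx_add {n : ℕ} (i : Fin n) {f g : SpaceTime n → ℝ} (hf : ContDiff ℝ ∞ f)
    (hg : ContDiff ℝ ∞ g) (y : SpaceTime n) :
    dx i (fun w => f w + g w) y = dx i f y + dx i g y := by
  simp only [dx]
  rw [fderiv_fun_add (hf.differentiable (by simp)).differentiableAt
    (hg.differentiable (by simp)).differentiableAt]
  rfl

theorem dt_add {n : ℕ} {f g : SpaceTime n → ℝ} (hf : ContDiff ℝ ∞ f)
    (hg : ContDiff ℝ ∞ g) (y : SpaceTime n) :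
    dt (fun w => f w + g w) y = dt f y + dt g y := by
  simp only [dt]
  rw [fderiv_fun_add (hf.differentiable (by simp)).differentiableAt
    (hg.differentiable (by simp)).differentiableAt]
  rfl

theorem pd_mul_const {n : ℕ} (a : SpaceTime n) {f : SpaceTime n → ℝ} (hf : ContDiff ℝ ∞ f)
    (c : ℝ) (y : SpaceTime n) : pd a (fun w => f w * c) y = pd a f y * c := by
  simp only [pd]
  rw [fderiv_mul_const (hf.differentiable (by simp)).differentiableAt]
  simp [mul_comm]

/-- Smooth solutions of `∂ₜ v + div u + ∇ q = 0`, `div v = 0`. -/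
structure IsLinearSol {n : ℕ} (z : SpaceTime n → State n) : Prop where
  smooth_v : ContDiff ℝ ∞ (fun y => (z y).1)
  smooth_u : ∀ i j, ContDiff ℝ ∞ (fun y => (z y).2.1.1 i j)
  smooth_q : ContDiff ℝ ∞ (fun y => (z y).2.2)
  momentum : ∀ y i, dt (fun w => (z w).1 i) y + (∑ j, dx j (fun w => (z w).2.1.1 i j) y)
      + dx i (fun w => (z w).2.2) y = 0
  div_free : ∀ y, ∑ i, dx i (fun w => (z w).1 i) y = 0

theorem mem_X0_iff {n : ℕ} {Ω : Set (SpaceTime n)} {z : SpaceTime n → State n} :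
    z ∈ X0 Ω ↔ IsLinearSol z ∧ tsupport z ⊆ Ω ∧ ∀ y, z y ∈ U n :=
  ⟨fun ⟨h1, h2, h3, h4, h5, h6, h7⟩ => ⟨⟨h1, h2, h3, h5, h6⟩, h4, h7⟩,
    fun ⟨⟨h1, h2, h3, h5, h6⟩, h4, h7⟩ => ⟨h1, h2, h3, h4, h5, h6, h7⟩⟩

theorem IsLinearSol.smooth_v_apply {n : ℕ} {z : SpaceTime n → State n} (h : IsLinearSol z)
    (i : Fin n) : ContDiff ℝ ∞ (fun y => (z y).1 i) :=
  (contDiff_euclidean.1 h.smooth_v) i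

theorem IsLinearSol.continuous {n : ℕ} {z : SpaceTime n → State n} (h : IsLinearSol z) :
    Continuous z := by
  have h2 : Continuous fun y => (z y).2.1 :=
    continuous_induced_rng.2 (continuous_matrix fun i j => (h.smooth_u i j).continuous)
  exact h.smooth_v.continuous.prodMk (h2.prodMk h.smooth_q.continuous)

theorem IsLinearSol.add {n : ℕ} {z w : SpaceTime n → State n} (hz : IsLinearSol z)
    (hw : IsLinearSol w) : IsLinearSol (fun y => z y + w y) where
  smooth_v := hz.smooth_v.add hw.smooth_v
  smooth_u := fun i j => (hz.smooth_u i j).add (hw.smooth_u i j)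
  smooth_q := hz.smooth_q.add hw.smooth_q
  momentum := fun y i => by
    have h1 := dt_add (hz.smooth_v_apply i) (hw.smooth_v_apply i) y
    have h2 := fun j => dx_add j (hz.smooth_u i j) (hw.smooth_u i j) y
    have h3 := dx_add i hz.smooth_q hw.smooth_q y
    have h4 : ∑ j, dx j (fun w' => ((z w' + w w').2.1).1 i j) y
      = ∑ j, dx j (fun w => (z w).2.1.1 i j) y + ∑ j, dx j (fun w' => (w w').2.1.1 i j) y := by
      rw [← Finset.sum_add_distrib]
      exact Finset.sum_congr rfl fun j _ => h2 j
    have e1 := hz.momentum y i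
    have e2 := hw.momentum y i
    rw [h4]
    calc _ = _ := congrArg₂ (· + ·) (congrArg₂ (· + ·) h1 rfl) h3
      _ = 0 := by linarith
  div_free := fun y => by
    have h1 := fun j => dx_add j (hz.smooth_v_apply j) (hw.smooth_v_apply j) y
    calc _ = ∑ j, (dx j (fun w => (z w).1 j) y + dx j (fun w' => (w w').1 j) y) :=
          Finset.sum_congr rfl fun j _ => h1 j
      _ = 0 := by rw [Finset.sum_add_distrib, hz.div_free, hw.div_free, add_zero]

/-- The state `(w, u, q)` for which `u + q Iₙ = p ⊗ r + r ⊗ p`. -/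
def dyad {n : ℕ} (w p r : Vec n) : State n :=
  (w, symDev ((2 : ℝ) • outer p r), 2 * inner ℝ p r / n)

theorem dyad_apply {n : ℕ} (w p r : Vec n) (i j : Fin n) :
    (dyad w p r).2.1.1 i j = p i * r j + p j * r i
      - (dyad w p r).2.2 * (1 : Matrix (Fin n) (Fin n) ℝ) i j := by
  simp only [dyad, symDev_apply, Matrix.smul_apply, outer_apply, Matrix.trace_smul, trace_outer,
    smul_eq_mul]
  ring

theorem waveDir_eq_dyad {n : ℕ} {m d : Vec n} (h : inner ℝ m d = 0) : waveDir m d = dyad d m d := by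
  simp [waveDir, dyad, h]

/-- The solution of the linear system with potential `φ`. -/
def potentialSol {n : ℕ} (m d ξ : Vec n) (φ : SpaceTime n → ℝ) (y : SpaceTime n) : State n :=
  pd (ξ, 0) (pd (ξ, 0) φ) y • dyad d m d + pd (ξ, 0) (pd (d, 0) φ) y • dyad (-ξ) (-m) ξ
    + pd (m, 1) (pd (ξ, 0) φ) y • dyad 0 (-ξ) d + pd (m, 1) (pd (d, 0) φ) y • dyad 0 ξ ξ

theorem dx_combo {n : ℕ} (i : Fin n) (f : Fin 4 → SpaceTime n → ℝ)
    (hf : ∀ k, ContDiff ℝ ∞ (f k)) (c : Fin 4 → ℝ) (y : SpaceTime n) :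
    dx i (fun w => f 0 w * c 0 + f 1 w * c 1 + f 2 w * c 2 + f 3 w * c 3) y
      = dx i (f 0) y * c 0 + dx i (f 1) y * c 1 + dx i (f 2) y * c 2 + dx i (f 3) y * c 3 := by
  have hs : ∀ k, ContDiff ℝ ∞ fun w => f k w * c k := fun k => (hf k).mul contDiff_const
  rw [dx_add i (((hs 0).add (hs 1)).add (hs 2)) (hs 3), dx_add i ((hs 0).add (hs 1)) (hs 2),
    dx_add i (hs 0) (hs 1)]
  simp only [dx_eq_pd, pd_mul_const _ (hf _)]

theorem dt_combo {n : ℕ} (f : Fin 4 → SpaceTime n → ℝ)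
    (hf : ∀ k, ContDiff ℝ ∞ (f k)) (c : Fin 4 → ℝ) (y : SpaceTime n) :
    dt (fun w => f 0 w * c 0 + f 1 w * c 1 + f 2 w * c 2 + f 3 w * c 3) y
      = dt (f 0) y * c 0 + dt (f 1) y * c 1 + dt (f 2) y * c 2 + dt (f 3) y * c 3 := by
  have hs : ∀ k, ContDiff ℝ ∞ fun w => f k w * c k := fun k => (hf k).mul contDiff_const
  rw [dt_add (((hs 0).add (hs 1)).add (hs 2)) (hs 3), dt_add ((hs 0).add (hs 1)) (hs 2),
    dt_add (hs 0) (hs 1)]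
  simp only [dt_eq_pd, pd_mul_const _ (hf _)]

theorem isLinearSol_potentialSol {n : ℕ} (m d ξ : Vec n) {φ : SpaceTime n → ℝ}
    (hφ : ContDiff ℝ ∞ φ) : IsLinearSol (potentialSol m d ξ φ) := by
  set f : Fin 4 → SpaceTime n → ℝ := ![pd (ξ, 0) (pd (ξ, 0) φ), pd (ξ, 0) (pd (d, 0) φ),
    pd (m, 1) (pd (ξ, 0) φ), pd (m, 1) (pd (d, 0) φ)] with hf
  have hs : ∀ a b, ContDiff ℝ ∞ (pd a (pd b φ)) := fun a b => contDiff_pd a (contDiff_pd b hφ)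
  have hfs : ∀ k, ContDiff ℝ ∞ (f k) := by
    intro k; fin_cases k <;> exact hs _ _
  set E : Fin 4 → State n := ![dyad d m d, dyad (-ξ) (-m) ξ, dyad 0 (-ξ) d, dyad 0 ξ ξ] with hE
  have hz : ∀ w, potentialSol m d ξ φ w = f 0 w • E 0 + f 1 w • E 1 + f 2 w • E 2 + f 3 w • E 3 :=
    fun w => rfl
  have hv : ∀ i, (fun w => (potentialSol m d ξ φ w).1 i) = fun w =>
      f 0 w * (E 0).1 i + f 1 w * (E 1).1 i + f 2 w * (E 2).1 i + f 3 w * (E 3).1 i := fun i => by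
    funext w; rw [hz]; simp
  have hu : ∀ i j, (fun w => (potentialSol m d ξ φ w).2.1.1 i j) = fun w =>
      f 0 w * (E 0).2.1.1 i j + f 1 w * (E 1).2.1.1 i j + f 2 w * (E 2).2.1.1 i j
        + f 3 w * (E 3).2.1.1 i j := fun i j => by
    funext w; rw [hz]; simp
  have hq : (fun w => (potentialSol m d ξ φ w).2.2) = fun w =>
      f 0 w * (E 0).2.2 + f 1 w * (E 1).2.2 + f 2 w * (E 2).2.2 + f 3 w * (E 3).2.2 := by
    funext w; rw [hz]; simp
  have hs4 : ∀ c : Fin 4 → ℝ, ContDiff ℝ ∞ fun w =>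
      f 0 w * c 0 + f 1 w * c 1 + f 2 w * c 2 + f 3 w * c 3 := fun c =>
    ((((hfs 0).mul contDiff_const).add ((hfs 1).mul contDiff_const)).add
      ((hfs 2).mul contDiff_const)).add ((hfs 3).mul contDiff_const)
  have hmom : ∀ (w p r : Vec n) (g : SpaceTime n → ℝ) (y : SpaceTime n) (i : Fin n),
      dt g y * (dyad w p r).1 i + ∑ j, dx j g y * (dyad w p r).2.1.1 i j
        + dx i g y * (dyad w p r).2.2
      = w i * pd (0, 1) g y + p i * pd (r, 0) g y + r i * pd (p, 0) g y := by
    intro w p r g y i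
    simp only [dyad_apply, mul_sub, mul_add, Finset.sum_sub_distrib, Finset.sum_add_distrib,
      ← sum_mul_dx, Finset.mul_sum, Matrix.one_apply, mul_ite, mul_zero, mul_one,
      Finset.sum_ite_eq, Finset.mem_univ, if_true]
    have e1 : ∑ x, dx x g y * (p i * r x) = ∑ x, p i * (r x * dx x g y) :=
      Finset.sum_congr rfl fun x _ => by ring
    have e2 : ∑ x, dx x g y * (p x * r i) = ∑ x, r i * (p x * dx x g y) :=
      Finset.sum_congr rfl fun x _ => by ring
    rw [e1, e2, dt_eq_pd]
    simp only [dyad]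
    ring
  have hneg : ∀ (a : Vec n) (g : SpaceTime n → ℝ) (y), pd (-a, 0) g y = -pd (a, 0) g y := by
    intro a g y
    rw [pd, show ((-a, 0) : SpaceTime n) = -(a, 0) by simp, map_neg]; rfl
  have hP : ∀ (g : SpaceTime n → ℝ) (y), pd (0, 1) g y + pd (m, 0) g y = pd (m, 1) g y := by
    intro g y
    rw [← pd_add_dir]; simp
  refine ⟨contDiff_euclidean.2 fun i => ?_, fun i j => ?_, ?_, fun y i => ?_, fun y => ?_⟩
  · rw [hv]; exact hs4 fun k => (E k).1 i
  · rw [hu]; exact hs4 fun k => (E k).2.1.1 i j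
  · rw [hq]; exact hs4 fun k => (E k).2.2
  · rw [hv, hq]
    simp only [hu]
    rw [dt_combo f hfs (fun k => (E k).1 i), dx_combo i f hfs (fun k => (E k).2.2)]
    simp only [fun j => dx_combo j f hfs (fun k => (E k).2.1.1 i j) y, Finset.sum_add_distrib]
    have k0 := hmom d m d (f 0) y i
    have k1 := hmom (-ξ) (-m) ξ (f 1) y i
    have k2 := hmom 0 (-ξ) d (f 2) y i
    have k3 := hmom 0 ξ ξ (f 3) y i
    have c1 : pd (d, 0) (f 0) y = pd (ξ, 0) (f 1) y := by
      change pd _ (pd _ (pd _ φ)) y = pd _ (pd _ (pd _ φ)) y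
      rw [pd_comm (d, 0) (ξ, 0) (contDiff_pd _ hφ), pd_comm (d, 0) (ξ, 0) hφ]
    have c2 : pd (m, 1) (f 0) y = pd (ξ, 0) (f 2) y := by
      change pd _ (pd _ (pd _ φ)) y = pd _ (pd _ (pd _ φ)) y
      rw [pd_comm (m, 1) (ξ, 0) (contDiff_pd _ hφ)]
    have c3 : pd (m, 1) (f 1) y = pd (ξ, 0) (f 3) y := by
      change pd _ (pd _ (pd _ φ)) y = pd _ (pd _ (pd _ φ)) y
      rw [pd_comm (m, 1) (ξ, 0) (contDiff_pd _ hφ)]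
    have c4 : pd (d, 0) (f 2) y = pd (ξ, 0) (f 3) y := by
      change pd _ (pd _ (pd _ φ)) y = pd _ (pd _ (pd _ φ)) y
      rw [pd_comm (d, 0) (m, 1) (contDiff_pd _ hφ), pd_comm (d, 0) (ξ, 0) hφ,
        pd_comm (m, 1) (ξ, 0) (contDiff_pd _ hφ)]
    rw [hneg] at k1 k2
    simp only [PiLp.neg_apply, PiLp.zero_apply] at k1 k2 k3
    have p0 := hP (f 0) y
    have p1 := hP (f 1) y
    simp only [hE, Matrix.cons_val]
    have : ξ i * pd (m, 1) (f 1) y = ξ i * pd (0, 1) (f 1) y + ξ i * pd (m, 0) (f 1) y := by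
      rw [← p1]; ring
    have : d i * pd (m, 1) (f 0) y = d i * pd (0, 1) (f 0) y + d i * pd (m, 0) (f 0) y := by
      rw [← p0]; ring
    rw [c1] at k0
    rw [c4] at k2
    rw [c2] at this
    rw [c3] at *
    linarith
  · simp only [hv]
    simp only [fun j => dx_combo j f hfs (fun k => (E k).1 j) y, Finset.sum_add_distrib]
    have c1 : pd (d, 0) (f 0) y = pd (ξ, 0) (f 1) y := by
      change pd _ (pd _ (pd _ φ)) y = pd _ (pd _ (pd _ φ)) y
      rw [pd_comm (d, 0) (ξ, 0) (contDiff_pd _ hφ), pd_comm (d, 0) (ξ, 0) hφ]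
    rw [← sum_mul_dx, ← sum_mul_dx] at c1
    simp only [hE, Matrix.cons_val, dyad, PiLp.neg_apply, PiLp.zero_apply, zero_mul,
      Finset.sum_const_zero, add_zero, neg_mul, Finset.sum_neg_distrib, mul_comm (dx _ _ _)]
    linarith

theorem tsupport_pd_subset {n : ℕ} (a : SpaceTime n) (φ : SpaceTime n → ℝ) :
    tsupport (pd a φ) ⊆ tsupport φ := tsupport_fderiv_apply_subset ℝ a

theorem tsupport_potentialSol_subset {n : ℕ} (m d ξ : Vec n) (φ : SpaceTime n → ℝ) :
    tsupport (potentialSol m d ξ φ) ⊆ tsupport φ := by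
  refine closure_minimal (fun y hy => ?_) (isClosed_tsupport φ)
  by_contra h
  have h0 : ∀ a b, pd a (pd b φ) y = 0 := fun a b =>
    image_eq_zero_of_notMem_tsupport fun h' =>
      h (tsupport_pd_subset b φ (tsupport_pd_subset a _ h'))
  exact hy (by simp [potentialSol, h0])

instance isAddHaarMeasure_volume_spaceTime {n : ℕ} :
    (volume : Measure (SpaceTime n)).IsAddHaarMeasure :=
  inferInstanceAs ((volume : Measure (Vec n)).prod (volume : Measure ℝ)).IsAddHaarMeasure

theorem tendsto_integral_mul_cos {n : ℕ} {L : SpaceTime n →L[ℝ] ℝ} (hL : L ≠ 0)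
    {g : SpaceTime n → ℝ} (hg : Integrable g) :
    Tendsto (fun N : ℕ => ∫ y, g y * Real.cos (N * L y)) atTop (𝓝 0) := by
  have h := tendsto_integral_exp_smul_cocompact (fun y => (g y : ℂ))
    (volume : Measure (SpaceTime n))
  have hc : Tendsto (fun N : ℕ => ((N : ℝ) / (2 * Real.pi)) • L) atTop (cocompact _) := by
    rw [← Metric.cobounded_eq_cocompact, ← tendsto_norm_atTop_iff_cobounded]
    have hL' : 0 < ‖L‖ := norm_pos_iff.2 hL
    simp only [norm_smul]
    refine Tendsto.atTop_mul_const hL' ?_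
    have : ∀ N : ℕ, ‖(N : ℝ) / (2 * Real.pi)‖ = N / (2 * Real.pi) := fun N =>
      Real.norm_of_nonneg (by positivity)
    simp only [this]
    exact tendsto_natCast_atTop_atTop.atTop_div_const (by positivity)
  have h2 := (Complex.continuous_re.tendsto _).comp (h.comp hc)
  refine Tendsto.congr (fun N => ?_) h2
  simp only [Function.comp_apply]
  have hpt : ∀ y, (Real.fourierChar (-(((N : ℝ) / (2 * Real.pi)) • L) y) • (g y : ℂ)).re
      = g y * Real.cos (N * L y) := by
    intro y
    rw [Circle.smul_def, Real.fourierChar_apply, smul_eq_mul, Complex.re_mul_ofReal, mul_comm]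
    congr 1
    rw [Complex.exp_ofReal_mul_I_re]
    rw [← Real.cos_neg]
    congr 1
    simp only [_root_.smul_apply, smul_eq_mul]
    field_simp
  have hint : Integrable fun y =>
      Real.fourierChar (-(((N : ℝ) / (2 * Real.pi)) • L) y) • (g y : ℂ) := by
    refine (hg.ofReal (𝕜 := ℂ)).norm.mono' ?_ (ae_of_all _ fun y => by
      rw [Circle.smul_def, norm_smul, Circle.norm_coe, one_mul]; exact le_rfl)
    simp only [Circle.smul_def]
    refine AEStronglyMeasurable.mul ?_ (hg.ofReal (𝕜 := ℂ)).aestronglyMeasurable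
    refine Continuous.aestronglyMeasurable ?_
    refine continuous_subtype_val.comp (Real.continuous_fourierChar.comp ?_)
    fun_prop
  have := integral_re hint
  simp only [RCLike.re_to_complex, hpt] at this
  rw [this]

/-- The potential `-χ cos(N L) / N²`. -/
def osc {n : ℕ} (χ : SpaceTime n → ℝ) (L : SpaceTime n →L[ℝ] ℝ) (N : ℕ) (y : SpaceTime n) : ℝ :=
  -(χ y * Real.cos (N * L y)) / (N : ℝ) ^ 2

theorem contDiff_osc {n : ℕ} {χ : SpaceTime n → ℝ} (hχ : ContDiff ℝ ∞ χ)
    (L : SpaceTime n →L[ℝ] ℝ) (N : ℕ) : ContDiff ℝ ∞ (osc χ L N) :=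
  (((hχ.mul (Real.contDiff_cos.comp (contDiff_const.mul L.contDiff))).neg).div_const _)

theorem tsupport_osc_subset {n : ℕ} (χ : SpaceTime n → ℝ) (L : SpaceTime n →L[ℝ] ℝ) (N : ℕ) :
    tsupport (osc χ L N) ⊆ tsupport χ :=
  closure_mono fun y hy h => hy (by simp only [osc, h]; simp)

theorem pd_mul_cos {n : ℕ} {f : SpaceTime n → ℝ} (hf : ContDiff ℝ ∞ f)
    (L : SpaceTime n →L[ℝ] ℝ) (N : ℝ) (a y : SpaceTime n) :
    pd a (fun y => f y * Real.cos (N * L y)) y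
      = pd a f y * Real.cos (N * L y) - f y * (N * L a) * Real.sin (N * L y) := by
  have h1 : HasFDerivAt f (fderiv ℝ f y) y :=
    (hf.differentiable (by simp)).differentiableAt.hasFDerivAt
  have h2 := h1.mul (((L.hasFDerivAt (x := y)).const_mul N).cos)
  rw [pd, HasFDerivAt.fderiv (f := fun y => f y * Real.cos (N * L y)) h2]
  simp [pd]
  ring

theorem pd_mul_sin {n : ℕ} {f : SpaceTime n → ℝ} (hf : ContDiff ℝ ∞ f)
    (L : SpaceTime n →L[ℝ] ℝ) (N : ℝ) (a y : SpaceTime n) :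
    pd a (fun y => f y * Real.sin (N * L y)) y
      = pd a f y * Real.sin (N * L y) + f y * (N * L a) * Real.cos (N * L y) := by
  have h1 : HasFDerivAt f (fderiv ℝ f y) y :=
    (hf.differentiable (by simp)).differentiableAt.hasFDerivAt
  have h2 := h1.mul (((L.hasFDerivAt (x := y)).const_mul N).sin)
  rw [pd, HasFDerivAt.fderiv (f := fun y => f y * Real.sin (N * L y)) h2]
  simp [pd]
  ring

theorem pd_pd_osc {n : ℕ} {χ : SpaceTime n → ℝ} (hχ : ContDiff ℝ ∞ χ)
    (L : SpaceTime n →L[ℝ] ℝ) {N : ℕ} (hN : N ≠ 0) (a b y : SpaceTime n) :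
    pd a (pd b (osc χ L N)) y = χ y * (L a * L b) * Real.cos (N * L y)
      + (pd b χ y * L a + pd a χ y * L b) * Real.sin (N * L y) / N
      - pd a (pd b χ) y * Real.cos (N * L y) / (N : ℝ) ^ 2 := by
  have hN' : (N : ℝ) ≠ 0 := Nat.cast_ne_zero.2 hN
  have e0 : osc χ L N = fun y => (χ y * Real.cos (N * L y)) * (-((N : ℝ) ^ 2)⁻¹) := by
    funext y; simp only [osc]; ring
  have hcos : ContDiff ℝ ∞ fun y => Real.cos (N * L y) :=
    Real.contDiff_cos.comp (contDiff_const.mul L.contDiff)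
  have hsin : ContDiff ℝ ∞ fun y => Real.sin (N * L y) :=
    Real.contDiff_sin.comp (contDiff_const.mul L.contDiff)
  have e1 : pd b (osc χ L N) = fun y => (pd b χ y * Real.cos (N * L y)) * (-((N : ℝ) ^ 2)⁻¹)
      + (χ y * Real.sin (N * L y)) * (L b / N) := by
    funext y
    rw [e0, pd_mul_const b (hχ.mul hcos), pd_mul_cos hχ]
    field_simp
    ring
  have hb := contDiff_pd b hχ
  have s1 : ContDiff ℝ ∞ fun y => (pd b χ y * Real.cos (N * L y)) * (-((N : ℝ) ^ 2)⁻¹) :=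
    (hb.mul hcos).mul contDiff_const
  have s2 : ContDiff ℝ ∞ fun y => (χ y * Real.sin (N * L y)) * (L b / N) :=
    (hχ.mul hsin).mul contDiff_const
  rw [e1]
  have : pd a (fun y => (pd b χ y * Real.cos (N * L y)) * (-((N : ℝ) ^ 2)⁻¹)
      + (χ y * Real.sin (N * L y)) * (L b / N)) y
      = pd a (fun y => (pd b χ y * Real.cos (N * L y)) * (-((N : ℝ) ^ 2)⁻¹)) y
      + pd a (fun y => (χ y * Real.sin (N * L y)) * (L b / N)) y := by
    have h := fderiv_fun_add (x := y) (s1.differentiable (by simp)).differentiableAt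
      (s2.differentiable (by simp)).differentiableAt
    exact congrArg (fun l : SpaceTime n →L[ℝ] ℝ => l a) h
  rw [this, pd_mul_const a (hb.mul hcos), pd_mul_const a (hχ.mul hsin), pd_mul_cos hb,
    pd_mul_sin hχ]
  field_simp
  ring

theorem hasCompactSupport_pd {n : ℕ} {φ : SpaceTime n → ℝ} (h : HasCompactSupport φ)
    (a : SpaceTime n) : HasCompactSupport (pd a φ) := h.fderiv_apply ℝ a

theorem exists_bound_pd_pd_osc {n : ℕ} {χ : SpaceTime n → ℝ} (hχ : ContDiff ℝ ∞ χ)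
    (hs : HasCompactSupport χ) (L : SpaceTime n →L[ℝ] ℝ) (a b : SpaceTime n) :
    ∃ C, 0 ≤ C ∧ ∀ (N : ℕ), N ≠ 0 → ∀ y,
      |pd a (pd b (osc χ L N)) y - χ y * (L a * L b) * Real.cos (N * L y)| ≤ C / N := by
  obtain ⟨C1, h1⟩ := (hasCompactSupport_pd hs a).exists_bound_of_continuous
    (contDiff_pd a hχ).continuous
  obtain ⟨C2, h2⟩ := (hasCompactSupport_pd hs b).exists_bound_of_continuous
    (contDiff_pd b hχ).continuous
  obtain ⟨C3, h3⟩ := (hasCompactSupport_pd (hasCompactSupport_pd hs b) a).exists_bound_of_continuous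
    (contDiff_pd a (contDiff_pd b hχ)).continuous
  have p1 := (norm_nonneg _).trans (h1 0)
  have p2 := (norm_nonneg _).trans (h2 0)
  have p3 := (norm_nonneg _).trans (h3 0)
  simp only [Real.norm_eq_abs] at h1 h2 h3
  refine ⟨C2 * |L a| + C1 * |L b| + C3, by positivity, fun N hN y => ?_⟩
  have hN1 : (1 : ℝ) ≤ N := by exact_mod_cast Nat.one_le_iff_ne_zero.2 hN
  have hN0 : (0 : ℝ) < N := by linarith
  rw [pd_pd_osc hχ L hN]
  have e : ∀ p q r s t : ℝ, p + q * s / N - r * t / (N : ℝ) ^ 2 - p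
      = (q * s - r * t / N) / N := fun p q r s t => by field_simp; ring
  rw [e, abs_div, abs_of_pos hN0]
  gcongr
  have hs1 := Real.abs_sin_le_one (N * L y)
  have hc1 := Real.abs_cos_le_one (N * L y)
  calc _ ≤ |(pd b χ y * L a + pd a χ y * L b) * Real.sin (N * L y)|
        + |pd a (pd b χ) y * Real.cos (N * L y) / N| := abs_sub _ _
    _ ≤ (|pd b χ y| * |L a| + |pd a χ y| * |L b|) * 1 + |pd a (pd b χ) y| * 1 := by
        gcongr
        · rw [abs_mul]
          gcongr
          exact (abs_add_le _ _).trans (by rw [abs_mul, abs_mul])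
        · rw [abs_div, abs_mul, abs_of_pos hN0]
          exact (div_le_self (by positivity) hN1).trans (by gcongr)
    _ ≤ (C2 * |L a| + C1 * |L b|) * 1 + C3 * 1 := by
        gcongr
        · exact h2 y
        · exact h1 y
        · exact h3 y
    _ = _ := by ring

theorem integrable_mul_of_continuous_hasCompactSupport {n : ℕ} {g f : SpaceTime n → ℝ}
    (hg : Integrable g) (hf : Continuous f) (hs : HasCompactSupport f) :
    Integrable fun y => g y * f y := by
  obtain ⟨C, hC⟩ := hs.exists_bound_of_continuous hf
  exact hg.mul_bdd (c := C) hf.aestronglyMeasurable (ae_of_all _ hC)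

theorem continuous_pd_pd_osc {n : ℕ} {χ : SpaceTime n → ℝ} (hχ : ContDiff ℝ ∞ χ)
    (L : SpaceTime n →L[ℝ] ℝ) (N : ℕ) (a b : SpaceTime n) :
    Continuous (pd a (pd b (osc χ L N))) :=
  (contDiff_pd a (contDiff_pd b (contDiff_osc hχ L N))).continuous

theorem hasCompactSupport_pd_pd_osc {n : ℕ} {χ : SpaceTime n → ℝ} (hs : HasCompactSupport χ)
    (L : SpaceTime n →L[ℝ] ℝ) (N : ℕ) (a b : SpaceTime n) :
    HasCompactSupport (pd a (pd b (osc χ L N))) :=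
  hasCompactSupport_pd (hasCompactSupport_pd
    (hs.of_isClosed_subset (isClosed_tsupport _) (tsupport_osc_subset χ L N)) b) a

theorem tendsto_integral_mul_pd_pd_osc {n : ℕ} {χ : SpaceTime n → ℝ} (hχ : ContDiff ℝ ∞ χ)
    (hs : HasCompactSupport χ) {L : SpaceTime n →L[ℝ] ℝ} (hL : L ≠ 0) (a b : SpaceTime n)
    {g : SpaceTime n → ℝ} (hg : Integrable g) :
    Tendsto (fun N : ℕ => ∫ y, g y * pd a (pd b (osc χ L N)) y) atTop (𝓝 0) := by
  obtain ⟨C, hC0, hC⟩ := exists_bound_pd_pd_osc hχ hs L a b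
  have h1 : Tendsto (fun N : ℕ => ∫ y, (g y * χ y * (L a * L b)) * Real.cos (N * L y))
      atTop (𝓝 0) := tendsto_integral_mul_cos hL
        ((integrable_mul_of_continuous_hasCompactSupport hg hχ.continuous hs).mul_const _)
  have h2 : Tendsto (fun N : ℕ => ∫ y, g y * (pd a (pd b (osc χ L N)) y
      - χ y * (L a * L b) * Real.cos (N * L y))) atTop (𝓝 0) := by
    refine squeeze_zero_norm' (a := fun N : ℕ => (∫ y, ‖g y‖) * C * (1 / (N : ℝ))) ?_ ?_
    · filter_upwards [eventually_ne_atTop 0] with N hN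
      rw [show (∫ y, ‖g y‖) * C * (1 / (N : ℝ)) = ∫ y, ‖g y‖ * (C / N) by
        rw [integral_mul_const]; ring]
      refine norm_integral_le_of_norm_le (hg.norm.mul_const _) (ae_of_all _ fun y => ?_)
      rw [norm_mul]
      gcongr
      exact hC N hN y
    · simpa using tendsto_one_div_atTop_nhds_zero_nat.const_mul ((∫ y, ‖g y‖) * C)
  have h3 := h1.add h2
  rw [add_zero] at h3
  refine h3.congr fun N => ?_
  have i1 : Integrable fun y => (g y * χ y * (L a * L b)) * Real.cos (N * L y) :=
    ((integrable_mul_of_continuous_hasCompactSupport hg hχ.continuous hs).mul_const _).mul_bdd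
      (c := 1) (by fun_prop) (ae_of_all _ fun y => Real.abs_cos_le_one _)
  have i2 : Integrable fun y => g y * pd a (pd b (osc χ L N)) y :=
    integrable_mul_of_continuous_hasCompactSupport hg (continuous_pd_pd_osc hχ L N a b)
      (hasCompactSupport_pd_pd_osc hs L N a b)
  have i3 : (fun y => g y * (pd a (pd b (osc χ L N)) y - χ y * (L a * L b) * Real.cos (N * L y)))
      = fun y => g y * pd a (pd b (osc χ L N)) y
        - (g y * χ y * (L a * L b)) * Real.cos (N * L y) := by
    funext y; ring
  rw [i3, integral_sub i2 i1]
  ring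

theorem eventually_integral_sq_pd_pd_osc {n : ℕ} {χ : SpaceTime n → ℝ} (hχ : ContDiff ℝ ∞ χ)
    (hs : HasCompactSupport χ) {L : SpaceTime n →L[ℝ] ℝ} (a : SpaceTime n) (ha : L a = 1)
    {ε : ℝ} (hε : 0 < ε) :
    ∀ᶠ N : ℕ in atTop, (1 / 2) * (∫ y, χ y ^ 2) - ε ≤ ∫ y, pd a (pd a (osc χ L N)) y ^ 2 := by
  obtain ⟨C, hC0, hC⟩ := exists_bound_pd_pd_osc hχ hs L a a
  have hL : (2 : ℝ) • L ≠ 0 := fun h => by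
    have := congrArg (fun l : SpaceTime n →L[ℝ] ℝ => l a) h
    simp [ha] at this
  have hi : Integrable χ := hχ.continuous.integrable_of_hasCompactSupport hs
  have hi2 : Integrable fun y => χ y ^ 2 := by
    simpa [sq] using integrable_mul_of_continuous_hasCompactSupport hi hχ.continuous hs
  have h1 := tendsto_integral_mul_cos hL hi2
  have h2 : Tendsto (fun N : ℕ => 2 * C * (∫ y, |χ y|) * (1 / (N : ℝ))) atTop (𝓝 0) := by
    simpa using tendsto_one_div_atTop_nhds_zero_nat.const_mul (2 * C * ∫ y, |χ y|)
  have h3 := ((h1.const_mul (1 / 2)).sub h2)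
  simp only [mul_zero, sub_zero] at h3
  filter_upwards [h3.eventually (lt_mem_nhds (show -ε < 0 by linarith)),
    eventually_ne_atTop 0] with N hN hN0
  have i1 : Integrable fun y => χ y ^ 2 * Real.cos (N * ((2 : ℝ) • L) y) :=
    hi2.mul_bdd (c := 1) (by fun_prop) (ae_of_all _ fun y => Real.abs_cos_le_one _)
  have i2 : Integrable fun y => pd a (pd a (osc χ L N)) y ^ 2 := by
    have hc := continuous_pd_pd_osc hχ L N a a
    have hcs := hasCompactSupport_pd_pd_osc hs L N a a
    simpa [sq] using integrable_mul_of_continuous_hasCompactSupport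
      (hc.integrable_of_hasCompactSupport hcs) hc hcs
  have key : ∫ y, ((1 / 2) * χ y ^ 2 + (1 / 2) * (χ y ^ 2 * Real.cos (N * ((2 : ℝ) • L) y))
      - 2 * (C / N) * |χ y|) ≤ ∫ y, pd a (pd a (osc χ L N)) y ^ 2 := by
    refine integral_mono (((hi2.const_mul _).add (i1.const_mul _)).sub (hi.abs.const_mul _)) i2
      fun y => ?_
    simp only
    have hb := hC N hN0 y
    rw [ha] at hb
    set A := pd a (pd a (osc χ L N)) y
    set c := Real.cos (N * L y) with hc
    have hcc : Real.cos (N * ((2 : ℝ) • L) y) = 2 * c ^ 2 - 1 := by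
      rw [hc, ← Real.cos_two_mul]; congr 1
      simp only [_root_.smul_apply, smul_eq_mul]; ring
    rw [hcc]
    have hc1 : |c| ≤ 1 := Real.abs_cos_le_one _
    have hprod : |χ y * c * (A - χ y * c)| ≤ |χ y| * (C / N) := by
      rw [abs_mul, abs_mul]
      have : |χ y| * |c| ≤ |χ y| * 1 := by gcongr
      rw [mul_one] at this
      gcongr
      simpa using hb
    have := (abs_le.1 hprod).1
    nlinarith [sq_nonneg (A - χ y * c)]
  have i3 : Integrable fun y => (1 / 2) * χ y ^ 2
      + (1 / 2) * (χ y ^ 2 * Real.cos (N * ((2 : ℝ) • L) y)) :=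
    (hi2.const_mul _).add (i1.const_mul _)
  rw [integral_sub i3 (hi.abs.const_mul _), integral_add (hi2.const_mul _) (i1.const_mul _), integral_const_mul, integral_const_mul,
    integral_const_mul] at key
  have e : 2 * (C / (N : ℝ)) * (∫ y, |χ y|) = 2 * C * (∫ y, |χ y|) * (1 / (N : ℝ)) := by ring
  rw [e] at key
  linarith

theorem exists_unit_orthogonal {n : ℕ} (hn : 2 ≤ n) (d : Vec n) :
    ∃ ξ : Vec n, ‖ξ‖ = 1 ∧ inner ℝ ξ d = 0 := by
  have h : (ℝ ∙ d)ᗮ ≠ ⊥ := by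
    intro h
    rw [Submodule.orthogonal_eq_bot_iff] at h
    have h1 := finrank_span_le_card (R := ℝ) ({d} : Set (Vec n))
    have h2 : Module.finrank ℝ (ℝ ∙ d) = n := by
      rw [h]; simp
    simp at h1
    omega
  obtain ⟨x, hx, hx0⟩ := Submodule.exists_mem_ne_zero_of_ne_bot h
  refine ⟨‖x‖⁻¹ • x, ?_, ?_⟩
  · rw [norm_smul, norm_inv, norm_norm, inv_mul_cancel₀ (norm_ne_zero_iff.2 hx0)]
  · rw [inner_smul_left, real_inner_comm, Submodule.mem_orthogonal_singleton_iff_inner_right.1 hx,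
      mul_zero]

/-- Index set of the scalar components of a state. -/
abbrev Idx (n : ℕ) : Type := Fin n ⊕ (Fin n × Fin n) ⊕ Unit

/-- The scalar components of a state. -/
def comp {n : ℕ} : Idx n → State n → ℝ
  | .inl i, a => a.1 i
  | .inr (.inl ij), a => a.2.1.1 ij.1 ij.2
  | .inr (.inr _), a => a.2.2

theorem comp_add {n : ℕ} (k : Idx n) (a b : State n) : comp k (a + b) = comp k a + comp k b := by
  rcases k with i | ij | _ <;> simp [comp]

theorem comp_sub {n : ℕ} (k : Idx n) (a b : State n) : comp k (a - b) = comp k a - comp k b := by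
  rcases k with i | ij | _ <;> simp [comp]

theorem comp_smul {n : ℕ} (k : Idx n) (c : ℝ) (a : State n) : comp k (c • a) = c * comp k a := by
  rcases k with i | ij | _ <;> simp [comp]

theorem comp_zero {n : ℕ} (k : Idx n) : comp k (0 : State n) = 0 := by
  rcases k with i | ij | _ <;> simp [comp]

theorem IsLinearSol.smooth_comp {n : ℕ} {z : SpaceTime n → State n} (h : IsLinearSol z)
    (k : Idx n) : ContDiff ℝ ∞ fun y => comp k (z y) := by
  rcases k with i | ij | _
  exacts [h.smooth_v_apply i, h.smooth_u ij.1 ij.2, h.smooth_q]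

/-- `w` is `ε`-small against the functions in `G`. -/
def WeakSmall {n : ℕ} (G : Finset (SpaceTime n → ℝ)) (ε : ℝ) (w : SpaceTime n → State n) : Prop :=
  ∀ g ∈ G, ∀ k, |∫ y, g y * comp k (w y)| < ε

/-- The constant in the gain of energy. -/
def gain (n : ℕ) : ℝ := 1 / (2 ^ (n + 3) * (3 * n) ^ 2)

/-- `z` can be perturbed in the ball of centre `c` and radius `r`. -/
def IsGoodBall {n : ℕ} (z : SpaceTime n → State n) (c : SpaceTime n) (r : ℝ) : Prop :=
  ∀ (G : Finset (SpaceTime n → ℝ)) (ε : ℝ), (∀ g ∈ G, Integrable g) → 0 < ε →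
    ∃ w, IsLinearSol w ∧ tsupport w ⊆ Metric.closedBall c r ∧
      (∀ y ∈ Metric.closedBall c r, z y + w y ∈ U n) ∧ WeakSmall G ε w ∧
      gain n * (∫ y in Metric.closedBall c r, (1 - ‖(z y).1‖ ^ 2) ^ 2) - ε ≤ ∫ y, ‖(w y).1‖ ^ 2

theorem isOpen_U (n : ℕ) : IsOpen (U n) := isOpen_interior

theorem exists_uniform_perturbation {n : ℕ} {z : SpaceTime n → State n} (hz : Continuous z)
    (y₀ : SpaceTime n) (E : Fin 4 → State n) (s₀ : ℝ)
    (h : ∀ s : ℝ, |s| ≤ s₀ → z y₀ + s • E 0 ∈ U n) :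
    ∃ r > 0, ∃ ε > 0, ∀ y, dist y y₀ < r → ∀ e : Fin 4 → ℝ, (∀ k, |e k| < ε) →
      ∀ s : ℝ, |s| ≤ s₀ →
        z y + ((s + e 0) • E 0 + e 1 • E 1 + e 2 • E 2 + e 3 • E 3) ∈ U n := by
  have key : ∀ᶠ p : SpaceTime n × (Fin 4 → ℝ) in 𝓝 (y₀, 0), ∀ s ∈ Set.Icc (-s₀) s₀,
      z p.1 + ((s + p.2 0) • E 0 + p.2 1 • E 1 + p.2 2 • E 2 + p.2 3 • E 3) ∈ U n := by
    refine isCompact_Icc.eventually_forall_of_forall_eventually (x₀ := (y₀, (0 : Fin 4 → ℝ)))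
      (P := fun p s => z p.1 + ((s + p.2 0) • E 0 + p.2 1 • E 1 + p.2 2 • E 2 + p.2 3 • E 3) ∈ U n)
      fun s hs => ?_
    have hc : Continuous fun q : (SpaceTime n × (Fin 4 → ℝ)) × ℝ => z q.1.1 +
        ((q.2 + q.1.2 0) • E 0 + q.1.2 1 • E 1 + q.1.2 2 • E 2 + q.1.2 3 • E 3) := by
      fun_prop
    refine hc.continuousAt.eventually ((isOpen_U n).mem_nhds ?_)
    have := h s (abs_le.2 hs)
    simpa using this
  obtain ⟨δ, hδ, hb⟩ := Metric.eventually_nhds_iff.1 key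
  refine ⟨δ, hδ, δ, hδ, fun y hy e he s hs => ?_⟩
  refine hb (y := (y, e)) ?_ s (abs_le.1 hs)
  rw [Prod.dist_eq]
  refine max_lt hy ?_
  rw [dist_zero_right, pi_norm_lt_iff hδ]
  exact he

theorem volume_closedBall_half {n : ℕ} (c : SpaceTime n) {r : ℝ} (hr : 0 < r) :
    volume.real (Metric.closedBall c r) = 2 ^ (n + 1) * volume.real (Metric.closedBall c (r / 2)) := by
  have h1 := Measure.addHaar_real_closedBall (volume : Measure (SpaceTime n)) c hr.le
  have h2 := Measure.addHaar_real_closedBall (volume : Measure (SpaceTime n)) c (half_pos hr).le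
  rw [h1, h2]
  have : Module.finrank ℝ (SpaceTime n) = n + 1 := by simp
  rw [this, div_pow]
  field_simp

theorem exists_isGoodBall {n : ℕ} (hn : 2 ≤ n) {z : SpaceTime n → State n} (hz : IsLinearSol z)
    (hU : ∀ y, z y ∈ U n) (y₀ : SpaceTime n) :
    ∃ r₀ > 0, ∀ r, 0 < r → r < r₀ → IsGoodBall z y₀ r := by
  obtain ⟨m, d, hd, hmd, hseg⟩ := exists_segment_subset_U hn (hU y₀)
  obtain ⟨ξ, hξ, hξd⟩ := exists_unit_orthogonal hn d
  have hn0 : (0 : ℝ) < n := by positivity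
  set δ := 1 - ‖(z y₀).1‖ ^ 2 with hδ
  have hδ0 : 0 < δ := by
    have := norm_lt_one_of_mem_U hn (hU y₀)
    rw [hδ]; nlinarith [norm_nonneg (z y₀).1]
  set s₀ := δ / (3 * n) with hs₀
  have hs0 : 0 < s₀ := by positivity
  set E : Fin 4 → State n := ![dyad d m d, dyad (-ξ) (-m) ξ, dyad 0 (-ξ) d, dyad 0 ξ ξ] with hE
  obtain ⟨r₁, hr₁, ε₁, hε₁, hpert⟩ := exists_uniform_perturbation hz.continuous y₀ E s₀
    (by simpa [hE, ← waveDir_eq_dyad hmd] using hseg)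
  have hvc : Continuous fun y => 1 - ‖(z y).1‖ ^ 2 := by
    have := hz.smooth_v.continuous; fun_prop
  obtain ⟨r₂, hr₂, hv⟩ := Metric.eventually_nhds_iff.1
    ((hvc.pow 2).continuousAt.eventually (gt_mem_nhds (show (1 - ‖(z y₀).1‖ ^ 2) ^ 2 < 2 * δ ^ 2 by
      rw [← hδ]; nlinarith)))
  refine ⟨min r₁ r₂, lt_min hr₁ hr₂, fun r hr hrlt G ε hG hε => ?_⟩
  have hb1 : ∀ y ∈ Metric.closedBall y₀ r, dist y y₀ < r₁ := fun y hy =>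
    (Metric.mem_closedBall.1 hy).trans_lt (hrlt.trans_le (min_le_left _ _))
  have hb2 : ∀ y ∈ Metric.closedBall y₀ r, dist y y₀ < r₂ := fun y hy =>
    (Metric.mem_closedBall.1 hy).trans_lt (hrlt.trans_le (min_le_right _ _))
  let β : ContDiffBump y₀ := ⟨r / 2, r, half_pos hr, half_lt_self hr⟩
  set χ : SpaceTime n → ℝ := fun y => s₀ * β y with hχdef
  have hχ : ContDiff ℝ ∞ χ := contDiff_const.mul β.contDiff
  have hχsub : tsupport χ ⊆ Metric.closedBall y₀ r := by
    have h1 : tsupport χ ⊆ tsupport β := closure_mono fun y hy h => hy (by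
      simp only [hχdef, h, mul_zero])
    rw [β.tsupport_eq] at h1
    exact h1
  have hχs : HasCompactSupport χ :=
    (isCompact_closedBall y₀ r).of_isClosed_subset (isClosed_tsupport _) hχsub
  have hχle : ∀ y, |χ y| ≤ s₀ := fun y => by
    rw [hχdef, abs_of_nonneg (mul_nonneg hs0.le β.nonneg)]
    exact mul_le_of_le_one_right hs0.le β.le_one
  set L : SpaceTime n →L[ℝ] ℝ := (innerSL ℝ ξ).comp (ContinuousLinearMap.fst ℝ (Vec n) ℝ)
    - (inner ℝ ξ m) • ContinuousLinearMap.snd ℝ (Vec n) ℝ with hLdef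
  have hLap : ∀ x t, L (x, t) = inner ℝ ξ x - inner ℝ ξ m * t := fun x t => by simp [hLdef]
  have hLζ : L (ξ, 0) = 1 := by rw [hLap, real_inner_self_eq_norm_sq, hξ]; simp
  have hLQ : L (d, 0) = 0 := by rw [hLap, hξd]; simp
  have hLP : L (m, 1) = 0 := by rw [hLap]; simp
  have hL : L ≠ 0 := fun h => by rw [h] at hLζ; simp at hLζ
  set f : ℕ → Fin 4 → SpaceTime n → ℝ := fun N => ![pd (ξ, 0) (pd (ξ, 0) (osc χ L N)),
    pd (ξ, 0) (pd (d, 0) (osc χ L N)), pd (m, 1) (pd (ξ, 0) (osc χ L N)),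
    pd (m, 1) (pd (d, 0) (osc χ L N))] with hf
  have hw : ∀ N y, potentialSol m d ξ (osc χ L N) y
      = f N 0 y • E 0 + f N 1 y • E 1 + f N 2 y • E 2 + f N 3 y • E 3 := fun N y => rfl
  have hsup : ∀ N, tsupport (potentialSol m d ξ (osc χ L N)) ⊆ Metric.closedBall y₀ r := fun N =>
    (tsupport_potentialSol_subset m d ξ _).trans ((tsupport_osc_subset χ L N).trans hχsub)
  have hfint : ∀ N k, ∀ g, Integrable g → Integrable fun y => g y * f N k y := by
    intro N k g hg
    fin_cases k <;> exact integrable_mul_of_continuous_hasCompactSupport hg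
      (continuous_pd_pd_osc hχ L N _ _) (hasCompactSupport_pd_pd_osc hχs L N _ _)
  have hft : ∀ k, ∀ g, Integrable g → Tendsto (fun N => ∫ y, g y * f N k y) atTop (𝓝 0) := by
    intro k g hg
    fin_cases k <;> exact tendsto_integral_mul_pd_pd_osc hχ hχs hL _ _ hg
  have hweak : ∀ (c : Fin 4 → ℝ), ∀ g, Integrable g → ∀ᶠ N in atTop,
      |∫ y, g y * (f N 0 y * c 0 + f N 1 y * c 1 + f N 2 y * c 2 + f N 3 y * c 3)| < ε := by
    intro c g hg
    have h1 : Tendsto (fun N => ∑ k, (∫ y, g y * f N k y) * c k) atTop (𝓝 0) := by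
      have := tendsto_finsetSum (Finset.univ : Finset (Fin 4))
        fun k _ => (hft k g hg).mul_const (c k)
      simpa using this
    have h2 := h1.abs
    rw [abs_zero] at h2
    filter_upwards [h2.eventually (gt_mem_nhds hε)] with N hN
    have e : ∫ y, g y * (f N 0 y * c 0 + f N 1 y * c 1 + f N 2 y * c 2 + f N 3 y * c 3)
        = ∑ k, (∫ y, g y * f N k y) * c k := by
      simp only [← integral_mul_const]
      rw [← integral_finsetSum _ fun k _ => (hfint N k g hg).mul_const _]
      congr 1; funext y
      rw [Fin.sum_univ_four]; ring
    rwa [e]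
  have hWS : ∀ᶠ N in atTop, WeakSmall G ε (potentialSol m d ξ (osc χ L N)) := by
    refine (Finset.eventually_all G).2 fun g hg => ?_
    have hg' := hG g hg
    refine eventually_all.2 fun k => (hweak (fun l => comp k (E l)) g hg').mono fun N hN => ?_
    simpa only [hw, comp_add, comp_smul] using hN
  have hsmall : ∀ a b, ∀ᶠ N : ℕ in atTop, ∀ y,
      |pd a (pd b (osc χ L N)) y - χ y * (L a * L b) * Real.cos (N * L y)| < ε₁ := by
    intro a b
    obtain ⟨C, hC0, hC⟩ := exists_bound_pd_pd_osc hχ hχs L a b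
    have h1 : Tendsto (fun N : ℕ => C * (1 / (N : ℝ))) atTop (𝓝 0) := by
      simpa using tendsto_one_div_atTop_nhds_zero_nat.const_mul C
    filter_upwards [h1.eventually (gt_mem_nhds hε₁), eventually_ne_atTop 0] with N hN hN0 y
    refine (hC N hN0 y).trans_lt ?_
    rwa [div_eq_mul_one_div]
  have hgain := eventually_integral_sq_pd_pd_osc hχ hχs (L := L) (ξ, 0) hLζ hε
  obtain ⟨N, hN1, hN2, hA, hB, hC, hD⟩ := (hWS.and (hgain.and ((hsmall (ξ, 0) (ξ, 0)).and
    ((hsmall (ξ, 0) (d, 0)).and ((hsmall (m, 1) (ξ, 0)).and (hsmall (m, 1) (d, 0))))))).exists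
  rw [hLζ] at hA hB hC
  rw [hLQ] at hB hD
  rw [hLP] at hC hD
  simp only [mul_zero, zero_mul, sub_zero, mul_one] at hA hB hC hD
  refine ⟨potentialSol m d ξ (osc χ L N), isLinearSol_potentialSol m d ξ (contDiff_osc hχ L N),
    hsup N, fun y hy => ?_, hN1, ?_⟩
  · have hp := hpert y (hb1 y hy)
      ![f N 0 y - χ y * Real.cos (N * L y), f N 1 y, f N 2 y, f N 3 y] (by
        intro k
        fin_cases k
        · exact hA y
        · exact hB y
        · exact hC y
        · exact hD y) (χ y * Real.cos (N * L y)) (by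
        rw [abs_mul]
        calc |χ y| * |Real.cos (N * L y)| ≤ s₀ * 1 := by
              gcongr
              · exact hχle y
              · exact Real.abs_cos_le_one _
          _ = s₀ := mul_one _)
    rw [hw]
    simpa using hp
  · have e1 : ∀ y, ‖(potentialSol m d ξ (osc χ L N) y).1‖ ^ 2 = f N 0 y ^ 2 + f N 1 y ^ 2 := by
      intro y
      have : (potentialSol m d ξ (osc χ L N) y).1 = f N 0 y • d - f N 1 y • ξ := by
        rw [hw]
        simp [hE, dyad, sub_eq_add_neg]
      rw [this, ← real_inner_self_eq_norm_sq, inner_sub_left, inner_sub_right, inner_sub_right]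
      simp only [inner_smul_left, inner_smul_right, real_inner_self_eq_norm_sq, hd, hξ, hξd,
        real_inner_comm ξ d, RCLike.conj_to_real]
      ring
    have hsq : ∀ k, Integrable fun y => f N k y ^ 2 := by
      intro k
      have hc : Continuous (f N k) := by
        fin_cases k <;> exact continuous_pd_pd_osc hχ L N _ _
      have hcs : HasCompactSupport (f N k) := by
        fin_cases k <;> exact hasCompactSupport_pd_pd_osc hχs L N _ _
      simpa [sq] using hfint N k _ (hc.integrable_of_hasCompactSupport hcs)
    have e2 : ∫ y, f N 0 y ^ 2 ≤ ∫ y, ‖(potentialSol m d ξ (osc χ L N) y).1‖ ^ 2 := by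
      simp only [e1]
      refine integral_mono (hsq 0) ((hsq 0).add (hsq 1)) fun y => ?_
      simp only
      nlinarith [sq_nonneg (f N 1 y)]
    have e3 : s₀ ^ 2 * volume.real (Metric.closedBall y₀ (r / 2)) ≤ ∫ y, χ y ^ 2 := by
      have hi : Integrable fun y => χ y ^ 2 := by
        simpa [sq] using integrable_mul_of_continuous_hasCompactSupport
          (hχ.continuous.integrable_of_hasCompactSupport hχs) hχ.continuous hχs
      calc s₀ ^ 2 * volume.real (Metric.closedBall y₀ (r / 2))
          = ∫ y in Metric.closedBall y₀ (r / 2), s₀ ^ 2 := by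
            rw [setIntegral_const, smul_eq_mul, mul_comm]
        _ = ∫ y in Metric.closedBall y₀ (r / 2), χ y ^ 2 := by
            refine setIntegral_congr_fun Metric.isClosed_closedBall.measurableSet fun y hy => ?_
            simp only [hχdef, β.one_of_mem_closedBall hy, mul_one]
        _ ≤ ∫ y, χ y ^ 2 := setIntegral_le_integral hi (ae_of_all _ fun y => sq_nonneg _)
    have e4 : ∫ y in Metric.closedBall y₀ r, (1 - ‖(z y).1‖ ^ 2) ^ 2
        ≤ 2 * δ ^ 2 * volume.real (Metric.closedBall y₀ r) := by
      calc _ ≤ ∫ y in Metric.closedBall y₀ r, 2 * δ ^ 2 := by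
            refine setIntegral_mono_on ((hvc.pow 2).continuousOn.integrableOn_compact
              (isCompact_closedBall _ _))
              (integrableOn_const (isCompact_closedBall _ _).measure_lt_top.ne) Metric.isClosed_closedBall.measurableSet
              fun y hy => (hv (hb2 y hy)).le
        _ = _ := by rw [setIntegral_const, smul_eq_mul, mul_comm]
    have e5 : gain n * (2 * δ ^ 2 * volume.real (Metric.closedBall y₀ r))
        = (1 / 2) * (s₀ ^ 2 * volume.real (Metric.closedBall y₀ (r / 2))) := by
      rw [volume_closedBall_half y₀ hr, gain, hs₀]
      field_simp
      ring
    have hg0 : 0 ≤ gain n := by unfold gain; positivity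
    have e6 := mul_le_mul_of_nonneg_left e4 hg0
    have hN3 : (1 / 2) * (∫ y, χ y ^ 2) - ε ≤ ∫ y, f N 0 y ^ 2 := hN2
    linarith

theorem hasCompactSupport_of_tsupport_subset {n : ℕ} {F : Type*} [Zero F]
    {Ω : Set (SpaceTime n)} (hΩb : Bornology.IsBounded Ω) {f : SpaceTime n → F}
    (h : tsupport f ⊆ Ω) : HasCompactSupport f :=
  Metric.isCompact_of_isClosed_isBounded (isClosed_tsupport _) (hΩb.subset h)

/-- A smooth solution with compact support. -/
structure IsCompactSol {n : ℕ} (z : SpaceTime n → State n) : Prop extends IsLinearSol z where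
  compact : HasCompactSupport z

theorem isCompactSol_of_mem_X0 {n : ℕ} {Ω : Set (SpaceTime n)} (hΩb : Bornology.IsBounded Ω)
    {z : SpaceTime n → State n} (hz : z ∈ X0 Ω) : IsCompactSol z :=
  ⟨(mem_X0_iff.1 hz).1, hasCompactSupport_of_tsupport_subset hΩb (mem_X0_iff.1 hz).2.1⟩

theorem IsCompactSol.hasCompactSupport_comp {n : ℕ} {z : SpaceTime n → State n}
    (h : IsCompactSol z) (k : Idx n) : HasCompactSupport fun y => comp k (z y) :=
  h.compact.comp_left (g := comp k) (comp_zero k)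

theorem IsCompactSol.hasCompactSupport_fst {n : ℕ} {z : SpaceTime n → State n}
    (h : IsCompactSol z) : HasCompactSupport fun y => (z y).1 :=
  h.compact.comp_left (g := Prod.fst) rfl

theorem IsCompactSol.integrable_mul_comp {n : ℕ} {z : SpaceTime n → State n}
    (h : IsCompactSol z) (k : Idx n) {g : SpaceTime n → ℝ} (hg : Integrable g) :
    Integrable fun y => g y * comp k (z y) :=
  integrable_mul_of_continuous_hasCompactSupport hg (h.smooth_comp k).continuous
    (h.hasCompactSupport_comp k)

theorem IsCompactSol.integrable_comp {n : ℕ} {z : SpaceTime n → State n}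
    (h : IsCompactSol z) (k : Idx n) : Integrable fun y => comp k (z y) :=
  (h.smooth_comp k).continuous.integrable_of_hasCompactSupport (h.hasCompactSupport_comp k)

theorem IsCompactSol.integrable_norm_sq {n : ℕ} {z : SpaceTime n → State n}
    (h : IsCompactSol z) : Integrable fun y => ‖(z y).1‖ ^ 2 := by
  have := h.smooth_v.continuous
  refine Continuous.integrable_of_hasCompactSupport (by fun_prop) ?_
  exact h.hasCompactSupport_fst.comp_left (g := fun v => ‖v‖ ^ 2) (by simp)

theorem IsCompactSol.add {n : ℕ} {z w : SpaceTime n → State n} (hz : IsCompactSol z)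
    (hw : IsCompactSol w) : IsCompactSol fun y => z y + w y :=
  ⟨hz.toIsLinearSol.add hw.toIsLinearSol, hz.compact.add hw.compact⟩

theorem IsCompactSol.integral_norm_add_sq {n : ℕ} {z w : SpaceTime n → State n}
    (hz : IsCompactSol z) (hw : IsCompactSol w) :
    ∫ y, ‖(z y + w y).1‖ ^ 2 = (∫ y, ‖(z y).1‖ ^ 2)
      + 2 * (∑ i, ∫ y, (z y).1 i * (w y).1 i) + ∫ y, ‖(w y).1‖ ^ 2 := by
  have hi : ∀ i ∈ Finset.univ, Integrable fun y => (z y).1 i * (w y).1 i := fun i _ =>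
    hw.integrable_mul_comp (.inl i) (hz.integrable_comp (.inl i))
  have hi2 : Integrable fun y => 2 * ∑ i, (z y).1 i * (w y).1 i :=
    (integrable_finsetSum _ hi).const_mul 2
  have hi3 : Integrable fun y => ‖(z y).1‖ ^ 2 + 2 * ∑ i, (z y).1 i * (w y).1 i :=
    hz.integrable_norm_sq.add hi2
  rw [← integral_finsetSum _ hi, ← integral_const_mul, ← integral_add hz.integrable_norm_sq hi2,
    ← integral_add hi3 hw.integrable_norm_sq]
  congr 1
  funext y
  rw [sum_mul_eq_inner, Prod.fst_add, norm_add_sq_real]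

theorem WeakSmall.add {n : ℕ} {G : Finset (SpaceTime n → ℝ)} {ε₁ ε₂ : ℝ} {z w : SpaceTime n → State n}
    (hzi : ∀ g ∈ G, ∀ k, Integrable fun y => g y * comp k (z y))
    (hwi : ∀ g ∈ G, ∀ k, Integrable fun y => g y * comp k (w y))
    (hz : WeakSmall G ε₁ z) (hw : WeakSmall G ε₂ w) :
    WeakSmall G (ε₁ + ε₂) fun y => z y + w y := by
  intro g hg k
  simp only [comp_add, mul_add]
  rw [integral_add (hzi g hg k) (hwi g hg k)]
  exact (abs_add_le _ _).trans_lt (add_lt_add (hz g hg k) (hw g hg k))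

theorem WeakSmall.mono {n : ℕ} {G G' : Finset (SpaceTime n → ℝ)} (hGG : G ⊆ G') {ε ε' : ℝ}
    (hε : ε' ≤ ε) {w : SpaceTime n → State n} (h : WeakSmall G' ε' w) : WeakSmall G ε w :=
  fun g hg k => (h g (hGG hg) k).trans_le hε

theorem exists_perturbation_finset {n : ℕ} {Ω : Set (SpaceTime n)}
    (hΩb : Bornology.IsBounded Ω) {z : SpaceTime n → State n} (hz : z ∈ X0 Ω)
    (F : Finset (SpaceTime n)) (r : SpaceTime n → ℝ)
    (hd : (F : Set (SpaceTime n)).PairwiseDisjoint fun c => Metric.closedBall c (r c))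
    (hgood : ∀ c ∈ F, IsGoodBall z c (r c)) (hsub : ∀ c ∈ F, Metric.closedBall c (r c) ⊆ Ω)
    (G : Finset (SpaceTime n → ℝ)) (hG : ∀ g ∈ G, Integrable g) (ε : ℝ) (hε : 0 < ε) :
    ∃ z' ∈ X0 Ω, (∀ y, (∀ c ∈ F, y ∉ Metric.closedBall c (r c)) → z' y = z y) ∧
      WeakSmall G ε (fun y => z' y - z y) ∧
      (∫ y, ‖(z y).1‖ ^ 2)
        + gain n * (∑ c ∈ F, ∫ y in Metric.closedBall c (r c), (1 - ‖(z y).1‖ ^ 2) ^ 2) - ε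
        ≤ ∫ y, ‖(z' y).1‖ ^ 2 := by
  classical
  induction F using Finset.induction_on generalizing ε with
  | empty =>
    refine ⟨z, hz, fun _ _ => rfl, fun g hg k => ?_, by simpa using hε.le⟩
    simpa [comp_zero] using hε
  | insert c F hc ih =>
    obtain ⟨z₁, hz₁, heq, hw₁, hen₁⟩ := ih
      (hd.subset (by simp)) (fun c' hc' => hgood c' (Finset.mem_insert_of_mem hc'))
      (fun c' hc' => hsub c' (Finset.mem_insert_of_mem hc')) (ε / 2) (half_pos hε)
    have hball : ∀ y ∈ Metric.closedBall c (r c), z₁ y = z y := by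
      intro y hy
      refine heq y fun c' hc' hy' => ?_
      have hne : c ≠ c' := by rintro rfl; exact hc hc'
      exact Set.disjoint_left.1 (hd (by simp) (by simp [hc']) hne) hy hy'
    have hS := isCompactSol_of_mem_X0 hΩb hz
    have hS₁ := isCompactSol_of_mem_X0 hΩb hz₁
    set ε' := ε / (2 * (2 * n + 1)) with hε'
    have hε'0 : 0 < ε' := by positivity
    obtain ⟨w, hw, hws, hwU, hwsm, hwen⟩ := hgood c (Finset.mem_insert_self _ _)
      (G ∪ Finset.univ.image fun i => fun y => (z₁ y).1 i) ε' (by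
        intro g hg
        rcases Finset.mem_union.1 hg with hg | hg
        · exact hG g hg
        · obtain ⟨i, -, rfl⟩ := Finset.mem_image.1 hg
          exact hS₁.integrable_comp (.inl i)) hε'0
    have hwc : IsCompactSol w := ⟨hw, (isCompact_closedBall _ _).of_isClosed_subset
      (isClosed_tsupport _) hws⟩
    have hw0 : ∀ y, y ∉ Metric.closedBall c (r c) → w y = 0 := fun y hy =>
      image_eq_zero_of_notMem_tsupport fun h => hy (hws h)
    have hε'le : ε' ≤ ε / 2 := by
      rw [hε', ← div_div]
      exact div_le_self (by positivity) (by
        have : (0 : ℝ) ≤ n := by positivity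
        linarith)
    refine ⟨fun y => z₁ y + w y, mem_X0_iff.2 ⟨hS₁.toIsLinearSol.add hw, ?_, fun y => ?_⟩, ?_, ?_, ?_⟩
    · refine (tsupport_add _ _).trans (Set.union_subset (mem_X0_iff.1 hz₁).2.1 ?_)
      exact hws.trans (hsub c (Finset.mem_insert_self _ _))
    · by_cases hy : y ∈ Metric.closedBall c (r c)
      · simp only [hball y hy]; exact hwU y hy
      · simp only [hw0 y hy, add_zero]; exact (mem_X0_iff.1 hz₁).2.2 y
    · intro y hy
      simp only [hw0 y (hy c (Finset.mem_insert_self _ _)), add_zero]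
      exact heq y fun c' hc' => hy c' (Finset.mem_insert_of_mem hc')
    · have e : (fun y => z₁ y + w y - z y) = fun y => (z₁ y - z y) + w y := by
        funext y; abel
      rw [e, ← add_halves ε]
      refine WeakSmall.add (fun g hg k => ?_)
        (fun g hg k => hwc.integrable_mul_comp k (hG g hg)) hw₁
        (hwsm.mono Finset.subset_union_left hε'le)
      simp only [comp_sub, mul_sub]
      exact (hS₁.integrable_mul_comp k (hG g hg)).sub (hS.integrable_mul_comp k (hG g hg))
    · rw [hS₁.integral_norm_add_sq hwc, Finset.sum_insert hc]
      have h1 : -(n * ε') ≤ ∑ i, ∫ y, (z₁ y).1 i * (w y).1 i := by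
        have : ∑ _i : Fin n, (-ε') ≤ ∑ i, ∫ y, (z₁ y).1 i * (w y).1 i :=
          Finset.sum_le_sum fun i _ => (abs_lt.1 (hwsm _ (Finset.mem_union_right _
            (Finset.mem_image_of_mem _ (Finset.mem_univ i))) (.inl i))).1.le
        simpa using this
      have h2 : (2 * n + 1) * ε' = ε / 2 := by
        rw [hε']; field_simp
      linarith

theorem IsLinearSol.continuous_deficit {n : ℕ} {z : SpaceTime n → State n} (hz : IsLinearSol z) :
    Continuous fun y => (1 - ‖(z y).1‖ ^ 2) ^ 2 := by
  have := hz.smooth_v.continuous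
  fun_prop

theorem integrableOn_deficit {n : ℕ} {Ω : Set (SpaceTime n)}
    (hΩb : Bornology.IsBounded Ω) {z : SpaceTime n → State n} (hz : IsLinearSol z) :
    IntegrableOn (fun y => (1 - ‖(z y).1‖ ^ 2) ^ 2) Ω :=
  (hz.continuous_deficit.continuousOn.integrableOn_compact hΩb.isCompact_closure).mono_set
    subset_closure

theorem exists_perturbation {n : ℕ} (hn : 2 ≤ n) {Ω : Set (SpaceTime n)} (hΩ : IsOpen Ω)
    (hΩb : Bornology.IsBounded Ω) {z : SpaceTime n → State n} (hz : z ∈ X0 Ω)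
    (G : Finset (SpaceTime n → ℝ)) (hG : ∀ g ∈ G, Integrable g) {ε : ℝ} (hε : 0 < ε) :
    ∃ z' ∈ X0 Ω, WeakSmall G ε (fun y => z' y - z y) ∧
      (∫ y, ‖(z y).1‖ ^ 2) + gain n * (∫ y in Ω, (1 - ‖(z y).1‖ ^ 2) ^ 2) - ε
        ≤ ∫ y, ‖(z' y).1‖ ^ 2 := by
  obtain ⟨hzS, hzs, hzU⟩ := mem_X0_iff.1 hz
  set h : SpaceTime n → ℝ := fun y => (1 - ‖(z y).1‖ ^ 2) ^ 2 with hh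
  obtain ⟨t, r, htc, hts, htr, htcov, htd⟩ := Besicovitch.exists_disjoint_closedBall_covering_ae
    (volume : Measure (SpaceTime n))
    (fun y => {r | IsGoodBall z y r ∧ Metric.closedBall y r ⊆ Ω}) Ω (by
      intro y hy δ hδ
      obtain ⟨r₀, hr₀, hgood⟩ := exists_isGoodBall hn hzS hzU y
      obtain ⟨r₁, hr₁, hball⟩ := Metric.nhds_basis_closedBall.mem_iff.1 (hΩ.mem_nhds hy)
      have hm : 0 < min (min r₀ r₁) δ := lt_min (lt_min hr₀ hr₁) hδ
      refine ⟨min (min r₀ r₁) δ / 2, ⟨hgood _ (half_pos hm) ?_, ?_⟩, half_pos hm, ?_⟩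
      · exact (half_lt_self hm).trans_le ((min_le_left _ _).trans (min_le_left _ _))
      · exact (Metric.closedBall_subset_closedBall ((half_lt_self hm).le.trans
          ((min_le_left _ _).trans (min_le_right _ _)))).trans hball
      · exact (half_lt_self hm).trans_le (min_le_right _ _)) (fun _ => 1) (fun _ _ => one_pos)
  have : Countable t := htc.to_subtype
  have hUsub : (⋃ c : t, Metric.closedBall (c : SpaceTime n) (r c)) ⊆ Ω :=
    Set.iUnion_subset fun c => (htr c c.2).1.2
  have hUeq : (⋃ c : t, Metric.closedBall (c : SpaceTime n) (r c)) =ᵐ[volume] Ω := by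
    refine (LE.le.eventuallyLE hUsub).antisymm (ae_le_set.2 ?_)
    convert htcov using 3
    simp [Set.iUnion_subtype]
  have hint : IntegrableOn h (⋃ c : t, Metric.closedBall (c : SpaceTime n) (r c)) :=
    (integrableOn_deficit hΩb hzS).mono_set hUsub
  have hsum := hasSum_integral_iUnion (μ := volume) (f := h)
    (s := fun c : t => Metric.closedBall (c : SpaceTime n) (r c))
    (fun c => Metric.isClosed_closedBall.measurableSet)
    (fun a b hab => htd a.2 b.2 fun h => hab (Subtype.ext h)) hint
  rw [setIntegral_congr_set hUeq] at hsum
  have hg0 : 0 < gain n := by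
    have : (0 : ℝ) < n := by positivity
    unfold gain; positivity
  have hev := hsum.eventually (lt_mem_nhds (show (∫ y in Ω, h y) - ε / (2 * gain n)
    < ∫ y in Ω, h y by
      have : 0 < ε / (2 * gain n) := by positivity
      linarith))
  obtain ⟨F, hF⟩ := hev.exists
  obtain ⟨z', hz', -, hws, hen⟩ := exists_perturbation_finset hΩb hz
    (F.map (Function.Embedding.subtype _)) r
    (htd.subset (by intro c hc; simp at hc; exact hc.1))
    (by intro c hc; simp at hc; exact (htr c hc.1).1.1)
    (by intro c hc; simp at hc; exact (htr c hc.1).1.2) G hG (ε / 2) (half_pos hε)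
  refine ⟨z', hz', hws.mono subset_rfl (by linarith), ?_⟩
  rw [Finset.sum_map] at hen
  have h1 := mul_lt_mul_of_pos_left hF hg0
  have h2 : gain n * ((∫ y in Ω, h y) - ε / (2 * gain n)) = gain n * (∫ y in Ω, h y) - ε / 2 := by
    field_simp
  rw [h2] at h1
  simp only [Function.Embedding.coe_subtype] at hen
  linarith

theorem zero_mem_X0 {n : ℕ} (hn : 2 ≤ n) (Ω : Set (SpaceTime n)) :
    (fun _ => 0 : SpaceTime n → State n) ∈ X0 Ω := by
  refine mem_X0_iff.2 ⟨⟨contDiff_const, fun i j => contDiff_const, contDiff_const, ?_, ?_⟩, ?_,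
    fun _ => zero_mem_U hn⟩
  · intro y i; simp [dt, dx]
  · intro y; simp [dx]
  · have : tsupport (fun _ => 0 : SpaceTime n → State n) = ∅ := tsupport_eq_empty_iff.2 rfl
    rw [this]; exact Set.empty_subset _

theorem exists_sequence {n : ℕ} (hn : 2 ≤ n) {Ω : Set (SpaceTime n)} (hΩ : IsOpen Ω)
    (hΩb : Bornology.IsBounded Ω) :
    ∃ z : ℕ → SpaceTime n → State n, (∀ k, z k ∈ X0 Ω) ∧
      (∀ k, (∫ y, ‖(z k y).1‖ ^ 2) + gain n * (∫ y in Ω, (1 - ‖(z k y).1‖ ^ 2) ^ 2) - (1 / 2) ^ k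
        ≤ ∫ y, ‖(z (k + 1) y).1‖ ^ 2) ∧
      ∀ j k, j ≤ k → ∀ i,
        |∫ y, (z j y).1 i * ((z (k + 1) y).1 i - (z k y).1 i)| < (1 / 2) ^ k := by
  classical
  let T := {p : (SpaceTime n → State n) × Finset (SpaceTime n → ℝ) //
    p.1 ∈ X0 Ω ∧ ∀ g ∈ p.2, Integrable g}
  have step : ∀ (k : ℕ) (p : T), ∃ p' : T,
      p'.1.2 = p.1.2 ∪ Finset.univ.image (fun i => fun y => (p.1.1 y).1 i) ∧
      WeakSmall p'.1.2 ((1 / 2) ^ k) (fun y => p'.1.1 y - p.1.1 y) ∧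
      (∫ y, ‖(p.1.1 y).1‖ ^ 2) + gain n * (∫ y in Ω, (1 - ‖(p.1.1 y).1‖ ^ 2) ^ 2) - (1 / 2) ^ k
        ≤ ∫ y, ‖(p'.1.1 y).1‖ ^ 2 := by
    rintro k ⟨⟨z, G⟩, hz, hG⟩
    have hG' : ∀ g ∈ G ∪ Finset.univ.image (fun i => fun y => (z y).1 i), Integrable g := by
      intro g hg
      rcases Finset.mem_union.1 hg with hg | hg
      · exact hG g hg
      · obtain ⟨i, -, rfl⟩ := Finset.mem_image.1 hg
        exact (isCompactSol_of_mem_X0 hΩb hz).integrable_comp (.inl i)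
    obtain ⟨z', hz', hws, hen⟩ := exists_perturbation hn hΩ hΩb hz _ hG'
      (show (0 : ℝ) < (1 / 2) ^ k by positivity)
    exact ⟨⟨(z', _), hz', hG'⟩, rfl, hws, hen⟩
  choose nxt hn1 hn2 hn3 using step
  let s : ℕ → T := fun k => Nat.rec ⟨(fun _ => 0, ∅), zero_mem_X0 hn Ω, by simp⟩ nxt k
  have hs : ∀ k, s (k + 1) = nxt k (s k) := fun k => rfl
  have hmono : Monotone fun k => (s k).1.2 := by
    refine monotone_nat_of_le_succ fun k => ?_
    rw [hs, hn1]
    exact Finset.subset_union_left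
  refine ⟨fun k => (s k).1.1, fun k => (s k).2.1, fun k => ?_, fun j k hjk i => ?_⟩
  · have := hn3 k (s k)
    rwa [← hs] at this
  · have h1 := hn2 k (s k)
    rw [← hs] at h1
    have h2 : (fun y => ((s j).1.1 y).1 i) ∈ (s (k + 1)).1.2 := by
      refine hmono (show j + 1 ≤ k + 1 by omega) ?_
      simp only [hs j, hn1]
      exact Finset.mem_union_right _ (Finset.mem_image_of_mem _ (Finset.mem_univ i))
    have := h1 _ h2 (.inl i)
    simpa [comp] using this

open scoped SchwartzMap FourierTransform LineDeriv

theorem fourier_lineDeriv_single {n : ℕ} (f : 𝓢(Vec n, ℂ)) (i : Fin n) (x : Vec n) :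
    𝓕 (∂_{EuclideanSpace.single i (1 : ℝ)} f) x
      = (2 * Real.pi * Complex.I) * ((x i : ℝ) : ℂ) * 𝓕 f x := by
  have ht : (fun y : Vec n => inner ℝ y (EuclideanSpace.single i (1 : ℝ))).HasTemperateGrowth :=
    ((innerSL ℝ).flip _).hasTemperateGrowth
  rw [SchwartzMap.fourier_lineDerivOp_eq, _root_.smul_apply,
    SchwartzMap.smulLeftCLM_apply_apply ht, EuclideanSpace.inner_single_right]
  simp [mul_assoc]

theorem fourier_lineDeriv_lineDeriv {n : ℕ} (f : 𝓢(Vec n, ℂ)) (i j : Fin n) (x : Vec n) :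
    𝓕 (∂_{EuclideanSpace.single i (1 : ℝ)} (∂_{EuclideanSpace.single j (1 : ℝ)} f)) x
      = (2 * Real.pi * Complex.I) ^ 2 * ((x i * x j : ℝ) : ℂ) * 𝓕 f x := by
  rw [fourier_lineDeriv_single, fourier_lineDeriv_single]
  push_cast
  ring

theorem integral_norm_sq_le_of_laplacian_eq {n : ℕ} (hn : 0 < n) (Q : 𝓢(Vec n, ℂ))
    (V : Fin n → Fin n → 𝓢(Vec n, ℂ))
    (h : ∑ i : Fin n, ∂_{EuclideanSpace.single i (1 : ℝ)} (∂_{EuclideanSpace.single i (1 : ℝ)} Q)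
      + ∑ i : Fin n, ∑ j : Fin n, ∂_{EuclideanSpace.single i (1 : ℝ)} (∂_{EuclideanSpace.single j (1 : ℝ)} (V i j))
        = 0) :
    ∫ x, ‖Q x‖ ^ 2 ≤ (n : ℝ) ^ 2 * ∑ i, ∑ j, ∫ x, ‖V i j x‖ ^ 2 := by
  have hF := congrArg (SchwartzMap.fourierTransformCLM ℂ (V := Vec n) (E := ℂ)) h
  have hpt : ∀ x : Vec n, ((‖x‖ ^ 2 : ℝ) : ℂ) * 𝓕 Q x
      + ∑ i, ∑ j, ((x i * x j : ℝ) : ℂ) * 𝓕 (V i j) x = 0 := by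
    intro x
    have h1 := congrArg (fun g : 𝓢(Vec n, ℂ) => g x) hF
    simp only [map_add, map_sum, map_zero, _root_.add_apply, _root_.sum_apply,
      SchwartzMap.fourierTransformCLM_apply, fourier_lineDeriv_lineDeriv,
      _root_.zero_apply] at h1
    have hc : (2 * (Real.pi : ℂ) * Complex.I) ^ 2 ≠ 0 := by
      simp [Real.pi_ne_zero]
    have h2 : (2 * (Real.pi : ℂ) * Complex.I) ^ 2 * (((‖x‖ ^ 2 : ℝ) : ℂ) * 𝓕 Q x
      + ∑ i, ∑ j, ((x i * x j : ℝ) : ℂ) * 𝓕 (V i j) x) = 0 := by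
      rw [← h1, mul_add, ← sum_sq_eq_norm_sq, Complex.ofReal_sum]
      simp only [Finset.mul_sum, Finset.sum_mul, mul_assoc]
    exact (mul_eq_zero.1 h2).resolve_left hc
  have hbound : ∀ x : Vec n, x ≠ 0 →
      ‖𝓕 Q x‖ ^ 2 ≤ (n : ℝ) ^ 2 * ∑ i, ∑ j, ‖𝓕 (V i j) x‖ ^ 2 := by
    intro x hx
    have hx0 : 0 < ‖x‖ ^ 2 := by positivity
    have h1 : ((‖x‖ ^ 2 : ℝ) : ℂ) * 𝓕 Q x = -∑ i, ∑ j, ((x i * x j : ℝ) : ℂ) * 𝓕 (V i j) x :=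
      eq_neg_of_add_eq_zero_left (hpt x)
    have hxi : ∀ i, |x i| ≤ ‖x‖ := fun i => PiLp.norm_apply_le x i
    have h2 : ‖x‖ ^ 2 * ‖𝓕 Q x‖ ≤ ‖x‖ ^ 2 * ∑ i, ∑ j, ‖𝓕 (V i j) x‖ := by
      calc ‖x‖ ^ 2 * ‖𝓕 Q x‖ = ‖((‖x‖ ^ 2 : ℝ) : ℂ) * 𝓕 Q x‖ := by
            rw [norm_mul, Complex.norm_real, Real.norm_of_nonneg hx0.le]
        _ ≤ ∑ i, ∑ j, ‖((x i * x j : ℝ) : ℂ) * 𝓕 (V i j) x‖ := by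
            rw [h1, norm_neg]
            exact (norm_sum_le _ _).trans (Finset.sum_le_sum fun i _ => norm_sum_le _ _)
        _ ≤ ∑ i, ∑ j, ‖x‖ ^ 2 * ‖𝓕 (V i j) x‖ := by
            refine Finset.sum_le_sum fun i _ => Finset.sum_le_sum fun j _ => ?_
            rw [norm_mul, Complex.norm_real, Real.norm_eq_abs, abs_mul, sq]
            gcongr
            · exact hxi i
            · exact hxi j
        _ = _ := by simp only [Finset.mul_sum]
    have h3 := le_of_mul_le_mul_left h2 hx0
    calc ‖𝓕 Q x‖ ^ 2 ≤ (∑ i, ∑ j, ‖𝓕 (V i j) x‖) ^ 2 := by gcongr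
      _ = (∑ p : Fin n × Fin n, ‖𝓕 (V p.1 p.2) x‖) ^ 2 := by rw [Fintype.sum_prod_type]
      _ ≤ (Finset.univ : Finset (Fin n × Fin n)).card
          * ∑ p : Fin n × Fin n, ‖𝓕 (V p.1 p.2) x‖ ^ 2 := sq_sum_le_card_mul_sum_sq
      _ = _ := by
          rw [Fintype.sum_prod_type]
          simp [sq]
  have hint : ∀ f : 𝓢(Vec n, ℂ), Integrable fun x => ‖𝓕 f x‖ ^ 2 := fun f =>
    (memLp_two_iff_integrable_sq_norm (𝓕 f).continuous.aestronglyMeasurable).1 ((𝓕 f).memLp 2)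
  have : Nonempty (Fin n) := ⟨⟨0, hn⟩⟩
  rw [← SchwartzMap.integral_norm_sq_fourier Q]
  simp only [← fun i j => SchwartzMap.integral_norm_sq_fourier (V i j)]
  simp only [← integral_finsetSum _ fun j (_ : j ∈ Finset.univ) => hint (V _ j)]
  rw [← integral_finsetSum _ fun i _ => integrable_finsetSum _ fun j _ => hint (V i j),
    ← integral_const_mul]
  refine integral_mono_ae (hint Q) ((integrable_finsetSum _ fun i _ =>
    integrable_finsetSum _ fun j _ => hint (V i j)).const_mul _) ?_
  have : ∀ᵐ x : Vec n, x ≠ 0 := by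
    simp [ae_iff]
  filter_upwards [this] with x hx using hbound x hx

theorem hasFDerivAt_slice {n : ℕ} {f : SpaceTime n → ℝ} (hf : ContDiff ℝ ∞ f) (t : ℝ)
    (x : Vec n) : HasFDerivAt (fun x => ((f (x, t) : ℝ) : ℂ))
      (Complex.ofRealCLM.comp ((fderiv ℝ f (x, t)).comp (ContinuousLinearMap.inl ℝ (Vec n) ℝ))) x := by
  have h1 : HasFDerivAt f (fderiv ℝ f (x, t)) (x, t) :=
    (hf.differentiable (by simp)).differentiableAt.hasFDerivAt
  exact Complex.ofRealCLM.hasFDerivAt.comp x (h1.comp x (hasFDerivAt_prodMk_left x t))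

theorem hasCompactSupport_slice {n : ℕ} {f : SpaceTime n → ℝ} (hs : HasCompactSupport f) (t : ℝ) :
    HasCompactSupport fun x : Vec n => ((f (x, t) : ℝ) : ℂ) := by
  refine HasCompactSupport.intro (hs.isCompact.image continuous_fst) fun x hx => ?_
  have : f (x, t) = 0 := image_eq_zero_of_notMem_tsupport fun h => hx ⟨(x, t), h, rfl⟩
  simp [this]

theorem contDiff_slice {n : ℕ} {f : SpaceTime n → ℝ} (hf : ContDiff ℝ ∞ f) (t : ℝ) :
    ContDiff ℝ ∞ fun x : Vec n => ((f (x, t) : ℝ) : ℂ) :=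
  Complex.ofRealCLM.contDiff.comp (hf.comp (contDiff_id.prodMk contDiff_const))

/-- The restriction of a test function to a time slice, as a Schwartz function. -/
def slice {n : ℕ} {f : SpaceTime n → ℝ} (hf : ContDiff ℝ ∞ f) (hs : HasCompactSupport f) (t : ℝ) :
    𝓢(Vec n, ℂ) :=
  (hasCompactSupport_slice hs t).toSchwartzMap (contDiff_slice hf t)

theorem slice_apply {n : ℕ} {f : SpaceTime n → ℝ} (hf : ContDiff ℝ ∞ f) (hs : HasCompactSupport f)
    (t : ℝ) (x : Vec n) : slice hf hs t x = ((f (x, t) : ℝ) : ℂ) := rfl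

theorem lineDeriv_slice {n : ℕ} {f : SpaceTime n → ℝ} (hf : ContDiff ℝ ∞ f)
    (hs : HasCompactSupport f) (t : ℝ) (i : Fin n) :
    ∂_{EuclideanSpace.single i (1 : ℝ)} (slice hf hs t)
      = slice (contDiff_pd (EuclideanSpace.single i 1, 0) hf)
          (hasCompactSupport_pd hs (EuclideanSpace.single i 1, 0)) t := by
  ext x
  rw [SchwartzMap.lineDerivOp_apply_eq_fderiv, slice_apply]
  have := (hasFDerivAt_slice hf t x).fderiv
  change fderiv ℝ (fun x => ((f (x, t) : ℝ) : ℂ)) x _ = _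
  rw [this]
  simp [pd]

theorem IsLinearSol.laplacian_eq {n : ℕ} {z : SpaceTime n → State n} (hz : IsLinearSol z)
    (y : SpaceTime n) :
    ∑ i, dx i (dx i fun w => (z w).2.2) y
      + ∑ i, ∑ j, dx i (dx j fun w => (z w).2.1.1 i j) y = 0 := by
  have hsm : ∀ {g : SpaceTime n → ℝ}, ContDiff ℝ ∞ g → ∀ a, ContDiff ℝ ∞ (pd a g) :=
    fun hg a => contDiff_pd a hg
  have key : ∀ i, dx i (dt fun w => (z w).1 i) y + (∑ j, dx i (dx j fun w => (z w).2.1.1 i j) y)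
      + dx i (dx i fun w => (z w).2.2) y = 0 := by
    intro i
    have h0 : (fun y => dt (fun w => (z w).1 i) y + (∑ j, dx j (fun w => (z w).2.1.1 i j) y)
      + dx i (fun w => (z w).2.2) y) = fun _ => 0 := funext fun y => hz.momentum y i
    have h1 := congrArg (fun g => dx i g y) h0
    simp only at h1
    have s1 : ContDiff ℝ ∞ (dt fun w => (z w).1 i) := hsm (hz.smooth_v_apply i) _
    have s2 : ∀ j, ContDiff ℝ ∞ (dx j fun w => (z w).2.1.1 i j) := fun j => hsm (hz.smooth_u i j) _
    have s3 : ContDiff ℝ ∞ (dx i fun w => (z w).2.2) := hsm hz.smooth_q _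
    have s4 : ContDiff ℝ ∞ fun y => ∑ j, dx j (fun w => (z w).2.1.1 i j) y :=
      ContDiff.sum fun j _ => s2 j
    rw [dx_add i (s1.add s4) s3, dx_add i s1 s4] at h1
    have h2 : dx i (fun y => ∑ j, dx j (fun w => (z w).2.1.1 i j) y) y
        = ∑ j, dx i (dx j fun w => (z w).2.1.1 i j) y := by
      rw [dx, fderiv_fun_sum fun j _ => ((s2 j).differentiable (by simp)).differentiableAt]
      simp [dx]
    rw [h2] at h1
    rw [h1]
    simp [dx]
  have hdiv : ∑ i, dx i (dt fun w => (z w).1 i) y = 0 := by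
    have h0 : (fun y => ∑ i, dx i (fun w => (z w).1 i) y) = fun _ => 0 := funext hz.div_free
    have h1 := congrArg (fun g => dt g y) h0
    simp only at h1
    have s2 : ∀ j, ContDiff ℝ ∞ (dx j fun w => (z w).1 j) := fun j => hsm (hz.smooth_v_apply j) _
    have h2 : dt (fun y => ∑ i, dx i (fun w => (z w).1 i) y) y
        = ∑ i, dt (dx i fun w => (z w).1 i) y := by
      rw [dt, fderiv_fun_sum fun j _ => ((s2 j).differentiable (by simp)).differentiableAt]
      simp [dt]
    rw [h2] at h1
    calc _ = ∑ i, dt (dx i fun w => (z w).1 i) y := Finset.sum_congr rfl fun i _ =>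
          congrFun (pd_comm (EuclideanSpace.single i 1, 0) (0, 1) (hz.smooth_v_apply i)) y
      _ = 0 := by rw [h1]; simp [dt]
  have hs := Finset.sum_congr rfl fun i (_ : i ∈ Finset.univ) => key i
  simp only [Finset.sum_add_distrib, Finset.sum_const_zero] at hs
  linarith

/-- The pressure of a compactly supported solution is controlled by the stress in `L²`. -/
theorem IsCompactSol.integral_pressure_sq_le {n : ℕ} (hn : 0 < n) {z : SpaceTime n → State n}
    (hz : IsCompactSol z) :
    ∫ y, (z y).2.2 ^ 2 ≤ (n : ℝ) ^ 2 * ∑ i, ∑ j, ∫ y, (z y).2.1.1 i j ^ 2 := by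
  have hint : ∀ k, Integrable fun y => comp k (z y) ^ 2 := fun k => by
    simpa [sq] using hz.integrable_mul_comp k (hz.integrable_comp k)
  have hslice : ∀ t : ℝ, ∫ x : Vec n, (z (x, t)).2.2 ^ 2
      ≤ (n : ℝ) ^ 2 * ∑ i, ∑ j, ∫ x : Vec n, (z (x, t)).2.1.1 i j ^ 2 := by
    intro t
    have hq : HasCompactSupport fun y => (z y).2.2 := hz.hasCompactSupport_comp (.inr (.inr ()))
    have hu : ∀ i j, HasCompactSupport fun y => (z y).2.1.1 i j := fun i j =>
      hz.hasCompactSupport_comp (.inr (.inl (i, j)))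
    have h := integral_norm_sq_le_of_laplacian_eq hn
      (slice (f := fun y => (z y).2.2) hz.smooth_q hq t)
      (fun i j => slice (f := fun y => (z y).2.1.1 i j) (hz.smooth_u i j) (hu i j) t) (by
        ext x
        simp only [lineDeriv_slice, _root_.add_apply, _root_.sum_apply, slice_apply,
          _root_.zero_apply]
        exact_mod_cast hz.laplacian_eq (x, t))
    simpa [slice_apply] using h
  have hprod : ∀ k, ∫ y, comp k (z y) ^ 2 = ∫ t : ℝ, ∫ x : Vec n, comp k (z (x, t)) ^ 2 := fun k => by
    have := hint k
    rw [Measure.volume_eq_prod] at this ⊢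
    exact integral_prod_symm _ this
  have hright : ∀ k, Integrable fun t : ℝ => ∫ x : Vec n, comp k (z (x, t)) ^ 2 := fun k => by
    have := hint k
    rw [Measure.volume_eq_prod] at this
    exact this.integral_prod_right
  have e1 := hprod (.inr (.inr ()))
  have e2 := fun i j => hprod (.inr (.inl (i, j)))
  simp only [comp] at e1 e2
  rw [e1]
  simp only [e2]
  have i2 : ∀ i j, Integrable fun t : ℝ => ∫ x : Vec n, (z (x, t)).2.1.1 i j ^ 2 :=
    fun i j => hright (.inr (.inl (i, j)))
  simp only [← integral_finsetSum _ fun j (_ : j ∈ Finset.univ) => i2 _ j]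
  rw [← integral_finsetSum _ fun i _ => integrable_finsetSum _ fun j _ => i2 i j,
    ← integral_const_mul]
  exact integral_mono (hright (.inr (.inr ()))) ((integrable_finsetSum _ fun i _ =>
    integrable_finsetSum _ fun j _ => i2 i j).const_mul _) hslice

section L2

variable {α : Type*} [MeasurableSpace α] {μ : Measure α} {F : Type*} [NormedAddCommGroup F]

theorem eLpNorm_two_sq {f : α → F} (hf : MemLp f 2 μ) :
    eLpNorm f 2 μ ^ 2 = ENNReal.ofReal (∫ x, ‖f x‖ ^ 2 ∂μ) := by
  have hi := (memLp_two_iff_integrable_sq_norm hf.1).1 hf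
  rw [ofReal_integral_eq_lintegral_ofReal hi (ae_of_all _ fun x => by positivity),
    eLpNorm_eq_lintegral_rpow_enorm_toReal (by simp) (by simp), ← ENNReal.rpow_natCast,
    ← ENNReal.rpow_mul]
  simp only [ENNReal.toReal_ofNat, Nat.cast_ofNat, one_div, isUnit_iff_ne_zero, ne_eq,
    OfNat.ofNat_ne_zero, not_false_eq_true, IsUnit.inv_mul_cancel, ENNReal.rpow_one,
    ENNReal.rpow_ofNat]
  refine lintegral_congr fun x => ?_
  rw [ENNReal.ofReal_pow (norm_nonneg _), ofReal_norm]

theorem eLpNorm_two_eq {f : α → F} (hf : MemLp f 2 μ) :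
    eLpNorm f 2 μ = ENNReal.ofReal (Real.sqrt (∫ x, ‖f x‖ ^ 2 ∂μ)) := by
  have h := eLpNorm_two_sq hf
  rw [← Real.sq_sqrt (integral_nonneg fun x => sq_nonneg ‖f x‖),
    ENNReal.ofReal_pow (Real.sqrt_nonneg _)] at h
  exact (ENNReal.pow_right_strictMono two_ne_zero).injective h

theorem tendsto_eLpNorm_two {ι : Type*} {l : Filter ι} {f : ι → α → F}
    (hf : ∀ k, MemLp (f k) 2 μ) (h : Tendsto (fun k => ∫ x, ‖f k x‖ ^ 2 ∂μ) l (𝓝 0)) :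
    Tendsto (fun k => eLpNorm (f k) 2 μ) l (𝓝 0) := by
  simp only [fun k => eLpNorm_two_eq (hf k)]
  have h1 := (Real.continuous_sqrt.tendsto 0).comp h
  have h2 := (ENNReal.continuous_ofReal.tendsto _).comp h1
  simpa [Function.comp_def] using h2

theorem exists_L2_limit [CompleteSpace F] {f : ℕ → α → F} (hf : ∀ k, MemLp (f k) 2 μ)
    (h : Tendsto (fun p : ℕ × ℕ => ∫ x, ‖f p.1 x - f p.2 x‖ ^ 2 ∂μ) atTop (𝓝 0)) :
    ∃ g, MemLp g 2 μ ∧ Tendsto (fun k => ∫ x, ‖f k x - g x‖ ^ 2 ∂μ) atTop (𝓝 0) := by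
  have h1 := tendsto_eLpNorm_two (fun p : ℕ × ℕ => (hf p.1).sub (hf p.2)) h
  have hc : CauchySeq fun k => (hf k).toLp (f k) := by
    rw [cauchySeq_iff_tendsto_dist_atTop_0]
    have : ∀ p : ℕ × ℕ, dist ((hf p.1).toLp (f p.1)) ((hf p.2).toLp (f p.2))
        = (eLpNorm (f p.1 - f p.2) 2 μ).toReal := fun p => by
      rw [dist_eq_norm, ← MemLp.toLp_sub, Lp.norm_toLp]
    simp only [this]
    simpa [Function.comp_def] using (ENNReal.tendsto_toReal ENNReal.zero_ne_top).comp h1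
  obtain ⟨g, hg⟩ := cauchySeq_tendsto_of_complete hc
  refine ⟨g, Lp.memLp g, ?_⟩
  have h2 := (Lp.tendsto_Lp_iff_tendsto_eLpNorm' _ _).1 hg
  have h3 : ∀ k, eLpNorm (⇑((hf k).toLp (f k)) - ⇑g) 2 μ = eLpNorm (f k - ⇑g) 2 μ := fun k =>
    eLpNorm_congr_ae ((hf k).coeFn_toLp.sub (EventuallyEq.refl _ _))
  simp only [h3] at h2
  have h4 : Tendsto (fun k => eLpNorm (f k - ⇑g) 2 μ ^ 2) atTop (𝓝 0) := by
    simpa using ENNReal.Tendsto.pow (n := 2) h2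
  simp only [fun k => eLpNorm_two_sq ((hf k).sub (Lp.memLp g))] at h4
  have h5 := (ENNReal.tendsto_toReal ENNReal.zero_ne_top).comp h4
  refine Tendsto.congr (fun k => ?_) (by simpa using h5)
  simp only [Function.comp_apply]
  exact ENNReal.toReal_ofReal (integral_nonneg fun x => by positivity)

theorem exists_subseq_tendsto_ae {f : ℕ → α → F} {g : α → F}
    (hf : ∀ k, MemLp (fun x => f k x - g x) 2 μ) (hfm : ∀ k, AEStronglyMeasurable (f k) μ)
    (hgm : AEStronglyMeasurable g μ)
    (h : Tendsto (fun k => ∫ x, ‖f k x - g x‖ ^ 2 ∂μ) atTop (𝓝 0)) :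
    ∃ ns : ℕ → ℕ, StrictMono ns ∧ ∀ᵐ x ∂μ, Tendsto (fun k => f (ns k) x) atTop (𝓝 (g x)) :=
  (tendstoInMeasure_of_tendsto_eLpNorm (p := 2) (by simp) hfm hgm
    (tendsto_eLpNorm_two hf h)).exists_seq_tendsto_ae

theorem abs_integral_mul_le {f g : α → ℝ} (hf : MemLp f 2 μ) (hg : MemLp g 2 μ) :
    |∫ x, f x * g x ∂μ| ≤ Real.sqrt (∫ x, f x ^ 2 ∂μ) * Real.sqrt (∫ x, g x ^ 2 ∂μ) := by
  have h := integral_mul_norm_le_Lp_mul_Lq (μ := μ) (f := f) (g := g) Real.HolderConjugate.two_two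
    (by simpa using hf) (by simpa using hg)
  have h1 : |∫ x, f x * g x ∂μ| ≤ ∫ x, ‖f x‖ * ‖g x‖ ∂μ := by
    simpa [norm_mul] using norm_integral_le_integral_norm (μ := μ) fun x => f x * g x
  refine h1.trans (h.trans_eq ?_)
  simp [Real.sqrt_eq_rpow]

theorem integrable_mul_of_memLp_two {f g : α → ℝ} (hf : MemLp f 2 μ) (hg : MemLp g 2 μ) :
    Integrable (fun x => f x * g x) μ := hf.integrable_mul hg

theorem tendsto_integral_mul_of_L2 {f : ℕ → α → ℝ} {g h : α → ℝ}
    (hf : ∀ k, MemLp (f k) 2 μ) (hg : MemLp g 2 μ) (hh : MemLp h 2 μ)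
    (ht : Tendsto (fun k => ∫ x, (f k x - g x) ^ 2 ∂μ) atTop (𝓝 0)) :
    Tendsto (fun k => ∫ x, f k x * h x ∂μ) atTop (𝓝 (∫ x, g x * h x ∂μ)) := by
  rw [← tendsto_sub_nhds_zero_iff]
  have h1 : Tendsto (fun k => Real.sqrt (∫ x, (f k x - g x) ^ 2 ∂μ)
      * Real.sqrt (∫ x, h x ^ 2 ∂μ)) atTop (𝓝 0) := by
    simpa using ((Real.continuous_sqrt.tendsto 0).comp ht).mul_const (Real.sqrt (∫ x, h x ^ 2 ∂μ))
  refine squeeze_zero_norm (fun k => ?_) h1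
  rw [← integral_sub (integrable_mul_of_memLp_two (hf k) hh) (integrable_mul_of_memLp_two hg hh), Real.norm_eq_abs]
  simp only [← sub_mul]
  exact abs_integral_mul_le ((hf k).sub hg) hh

theorem ae_eq_of_L2_limit_of_test {f : ℕ → α → ℝ} {g h : α → ℝ} (hf : ∀ k, MemLp (f k) 2 μ)
    (hg : MemLp g 2 μ) (hh : MemLp h 2 μ)
    (ht : Tendsto (fun k => ∫ x, (f k x - g x) ^ 2 ∂μ) atTop (𝓝 0))
    (hw : Tendsto (fun k => ∫ x, (h x - g x) * (f k x - h x) ∂μ) atTop (𝓝 0)) : h =ᵐ[μ] g := by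
  have hd : MemLp (fun x => h x - g x) 2 μ := hh.sub hg
  have h1 := tendsto_integral_mul_of_L2 hf hg hd ht
  have h2 : ∀ k, ∫ x, (h x - g x) * (f k x - h x) ∂μ
      = (∫ x, f k x * (h x - g x) ∂μ) - ∫ x, h x * (h x - g x) ∂μ := fun k => by
    rw [← integral_sub (integrable_mul_of_memLp_two (hf k) hd) (integrable_mul_of_memLp_two hh hd)]
    congr 1; funext x; ring
  simp only [h2] at hw
  have h3 := tendsto_nhds_unique hw (h1.sub_const _)
  rw [← integral_sub (integrable_mul_of_memLp_two hg hd) (integrable_mul_of_memLp_two hh hd)] at h3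
  have h4 : ∫ x, (h x - g x) ^ 2 ∂μ = 0 := by
    rw [← neg_eq_zero, ← integral_neg, h3]
    congr 1; funext x; ring
  rw [integral_eq_zero_iff_of_nonneg (fun x => sq_nonneg _) hd.integrable_sq] at h4
  filter_upwards [h4] with x hx
  have : h x - g x = 0 := by simpa using hx
  linarith

end L2

theorem memLp_of_bounded_of_support {n : ℕ} {F : Type*} [NormedAddCommGroup F]
    {Ω : Set (SpaceTime n)} (hΩ : IsOpen Ω) (hΩb : Bornology.IsBounded Ω) {f : SpaceTime n → F}
    (hf : AEStronglyMeasurable f) {C : ℝ} (hC : ∀ᵐ y, ‖f y‖ ≤ C) (h0 : ∀ᵐ y, y ∉ Ω → f y = 0)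
    (p : ℝ≥0∞) : MemLp f p := by
  have he : f =ᵐ[volume] Ω.indicator f := by
    filter_upwards [h0] with y hy
    by_cases h : y ∈ Ω
    · simp [h]
    · simp [h, hy h]
  rw [memLp_congr_ae he, memLp_indicator_iff_restrict hΩ.measurableSet]
  have : IsFiniteMeasure (volume.restrict Ω) := ⟨by
    rw [Measure.restrict_apply_univ]; exact hΩb.measure_lt_top⟩
  exact MemLp.of_bound hf.restrict C (ae_restrict_of_ae hC)

/-- `v` is a unit field in `Ω` and vanishes outside. -/
structure IsUnitField {n : ℕ} (Ω : Set (SpaceTime n)) (v : SpaceTime n → Vec n) : Prop where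
  meas : AEStronglyMeasurable v
  unit : ∀ᵐ y, y ∈ Ω → ‖v y‖ = 1
  zero : ∀ᵐ y, y ∉ Ω → v y = 0

theorem IsUnitField.norm_le {n : ℕ} {Ω : Set (SpaceTime n)} {v : SpaceTime n → Vec n}
    (h : IsUnitField Ω v) : ∀ᵐ y, ‖v y‖ ≤ 1 := by
  filter_upwards [h.unit, h.zero] with y h1 h2
  by_cases hy : y ∈ Ω
  · exact (h1 hy).le
  · simp [h2 hy]

theorem IsUnitField.memLp {n : ℕ} {Ω : Set (SpaceTime n)} (hΩ : IsOpen Ω)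
    (hΩb : Bornology.IsBounded Ω) {v : SpaceTime n → Vec n} (h : IsUnitField Ω v) (p : ℝ≥0∞) :
    MemLp v p := memLp_of_bounded_of_support hΩ hΩb h.meas h.norm_le h.zero p

theorem eq_zero_of_mem_X0 {n : ℕ} {Ω : Set (SpaceTime n)} {z : SpaceTime n → State n}
    (hz : z ∈ X0 Ω) {y : SpaceTime n} (hy : y ∉ Ω) : z y = 0 :=
  image_eq_zero_of_notMem_tsupport fun h => hy ((mem_X0_iff.1 hz).2.1 h)

theorem norm_le_one_of_mem_X0 {n : ℕ} {Ω : Set (SpaceTime n)} {z : SpaceTime n → State n}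
    (hz : z ∈ X0 Ω) (y : SpaceTime n) : ‖(z y).1‖ ≤ 1 :=
  norm_le_one_of_mem_convexHull (a := ((z y).1, (z y).2.1)) (mem_convexHull_of_mem_U ((mem_X0_iff.1 hz).2.2 y))

theorem abs_pressure_le_of_mem_X0 {n : ℕ} {Ω : Set (SpaceTime n)} {z : SpaceTime n → State n}
    (hz : z ∈ X0 Ω) (y : SpaceTime n) : |(z y).2.2| ≤ 1 :=
  abs_le.2 (interior_subset ((mem_X0_iff.1 hz).2.2 y)).2

theorem abs_norm_sq_sub_le {n : ℕ} {v w : Vec n} (hv : ‖v‖ ≤ 1) (hw : ‖w‖ ≤ 1) :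
    |‖v‖ ^ 2 - ‖w‖ ^ 2| ≤ 2 * ‖v - w‖ := by
  rw [sq_sub_sq, abs_mul, abs_of_nonneg (by positivity)]
  exact mul_le_mul (by linarith) (abs_norm_sub_norm_le v w) (abs_nonneg _) (by norm_num)

theorem abs_symDev_outer_sub_le {n : ℕ} (hn : 0 < n) {v w : Vec n} (hv : ‖v‖ ≤ 1) (hw : ‖w‖ ≤ 1)
    (i j : Fin n) :
    |(symDev (outer v v)).1 i j - (symDev (outer w w)).1 i j| ≤ 4 * ‖v - w‖ := by
  have hc : ∀ (x : Vec n) i, |x i| ≤ ‖x‖ := fun x i => PiLp.norm_apply_le x i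
  have h1 : |v i * v j - w i * w j| ≤ 2 * ‖v - w‖ := by
    have : v i * v j - w i * w j = v i * (v - w) j + (v - w) i * w j := by
      simp only [PiLp.sub_apply]; ring
    rw [this]
    calc _ ≤ |v i * (v - w) j| + |(v - w) i * w j| := abs_add_le _ _
      _ ≤ 1 * ‖v - w‖ + ‖v - w‖ * 1 := by
          rw [abs_mul, abs_mul]
          gcongr
          · exact (hc v i).trans hv
          · exact hc _ j
          · exact hc _ i
          · exact (hc w j).trans hw
      _ = _ := by ring
  have h2 := abs_norm_sq_sub_le hv hw
  have hn1 : (1 : ℝ) ≤ n := by exact_mod_cast hn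
  have h3 : |(1 : Matrix (Fin n) (Fin n) ℝ) i j / n| ≤ 1 := by
    rw [Matrix.one_apply]
    split_ifs
    · rw [abs_of_nonneg (by positivity)]; exact (div_le_one (by positivity)).2 hn1
    · simp
  have e : (symDev (outer v v)).1 i j - (symDev (outer w w)).1 i j
      = (v i * v j - w i * w j)
        - (‖v‖ ^ 2 - ‖w‖ ^ 2) * ((1 : Matrix (Fin n) (Fin n) ℝ) i j / n) := by
    rw [symDev_outer_self, symDev_outer_self]; ring
  rw [e]
  calc _ ≤ |v i * v j - w i * w j|
        + |(‖v‖ ^ 2 - ‖w‖ ^ 2) * ((1 : Matrix (Fin n) (Fin n) ℝ) i j / n)| := abs_sub _ _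
    _ ≤ 2 * ‖v - w‖ + 2 * ‖v - w‖ * 1 := by
        rw [abs_mul (‖v‖ ^ 2 - ‖w‖ ^ 2)]; gcongr
    _ = _ := by ring

theorem abs_stress_sub_symDev_le {n : ℕ} (hn : 0 < n) {Ω : Set (SpaceTime n)}
    {v : SpaceTime n → Vec n} (hv : IsUnitField Ω v) {z : SpaceTime n → State n} (hz : z ∈ X0 Ω) :
    ∀ᵐ y, ∀ i j, |(z y).2.1.1 i j - (symDev (outer (z y).1 (z y).1)).1 i j|
      ≤ 4 * ‖(z y).1 - v y‖ := by
  filter_upwards [hv.unit, hv.zero] with y h1 h2 i j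
  have hz1 := norm_le_one_of_mem_X0 hz y
  by_cases hy : y ∈ Ω
  · have h3 := abs_sub_symDev_le hn (mem_convexHull_of_mem_U ((mem_X0_iff.1 hz).2.2 y)) i j
    have h4 := (abs_le.1 (abs_norm_sq_sub_le hz1 (h1 hy).le)).1
    rw [h1 hy] at h4
    simp only at h3
    linarith
  · rw [h2 hy, eq_zero_of_mem_X0 hz hy]
    simp [symDev_outer_self]

theorem abs_stress_sub_le {n : ℕ} (hn : 0 < n) {Ω : Set (SpaceTime n)} {v : SpaceTime n → Vec n}
    (hv : IsUnitField Ω v) {z : SpaceTime n → State n} (hz : z ∈ X0 Ω) :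
    ∀ᵐ y, ∀ i j, |(z y).2.1.1 i j - (symDev (outer (v y) (v y))).1 i j|
      ≤ 8 * ‖(z y).1 - v y‖ := by
  filter_upwards [abs_stress_sub_symDev_le hn hv hz, hv.norm_le] with y h1 h2 i j
  have h3 := abs_symDev_outer_sub_le hn (norm_le_one_of_mem_X0 hz y) h2 i j
  have := abs_sub_le ((z y).2.1.1 i j) ((symDev (outer (z y).1 (z y).1)).1 i j)
    ((symDev (outer (v y) (v y))).1 i j)
  linarith [h1 i j]

theorem IsCompactSol.memLp_comp {n : ℕ} {z : SpaceTime n → State n} (h : IsCompactSol z)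
    (k : Idx n) (p : ℝ≥0∞) : MemLp (fun y => comp k (z y)) p :=
  (h.smooth_comp k).continuous.memLp_of_hasCompactSupport (h.hasCompactSupport_comp k)

theorem IsCompactSol.memLp_v {n : ℕ} {z : SpaceTime n → State n} (h : IsCompactSol z)
    (p : ℝ≥0∞) : MemLp (fun y => (z y).1) p :=
  h.smooth_v.continuous.memLp_of_hasCompactSupport h.hasCompactSupport_fst

theorem IsLinearSol.neg {n : ℕ} {z : SpaceTime n → State n} (h : IsLinearSol z) :
    IsLinearSol fun y => -z y where
  smooth_v := h.smooth_v.neg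
  smooth_u := fun i j => (h.smooth_u i j).neg
  smooth_q := h.smooth_q.neg
  momentum := fun y i => by
    have e1 : dt (fun w => (-z w).1 i) y = -dt (fun w => (z w).1 i) y := by
      simp [dt, fderiv_fun_neg]
    have e2 : ∀ j, dx j (fun w => (-z w).2.1.1 i j) y = -dx j (fun w => (z w).2.1.1 i j) y :=
      fun j => by simp [dx, fderiv_fun_neg]
    have e3 : dx i (fun w => (-z w).2.2) y = -dx i (fun w => (z w).2.2) y := by
      simp [dx, fderiv_fun_neg]
    rw [e1, e3]
    simp only [e2, Finset.sum_neg_distrib]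
    linarith [h.momentum y i]
  div_free := fun y => by
    have e1 : ∀ i, dx i (fun w => (-z w).1 i) y = -dx i (fun w => (z w).1 i) y := fun i => by
      simp [dx, fderiv_fun_neg]
    simp only [e1, Finset.sum_neg_distrib, h.div_free, neg_zero]

theorem IsCompactSol.sub {n : ℕ} {z w : SpaceTime n → State n} (hz : IsCompactSol z)
    (hw : IsCompactSol w) : IsCompactSol fun y => z y - w y := by
  have h : IsCompactSol fun y => z y + -w y :=
    hz.add ⟨hw.toIsLinearSol.neg, hw.compact.comp_left (g := fun a => -a) neg_zero⟩
  simpa only [sub_eq_add_neg] using h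

/-- The squared `L²` distance. -/
def distSq {n : ℕ} (v w : SpaceTime n → Vec n) : ℝ := ∫ y, ‖v y - w y‖ ^ 2

theorem integrable_norm_sub_sq {n : ℕ} {Ω : Set (SpaceTime n)} (hΩ : IsOpen Ω)
    (hΩb : Bornology.IsBounded Ω) {v : SpaceTime n → Vec n} (hv : IsUnitField Ω v)
    {z : SpaceTime n → State n} (hz : z ∈ X0 Ω) :
    Integrable fun y => ‖(z y).1 - v y‖ ^ 2 := by
  have h : MemLp (fun y => (z y).1 - v y) 2 :=
    ((isCompactSol_of_mem_X0 hΩb hz).memLp_v 2).sub (hv.memLp hΩ hΩb 2)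
  exact (memLp_two_iff_integrable_sq_norm h.1).1 h

theorem integral_stress_sub_sq_le {n : ℕ} (hn : 0 < n) {Ω : Set (SpaceTime n)} (hΩ : IsOpen Ω)
    (hΩb : Bornology.IsBounded Ω) {v : SpaceTime n → Vec n} (hv : IsUnitField Ω v)
    {z : SpaceTime n → State n} (hz : z ∈ X0 Ω) (i j : Fin n) :
    ∫ y, ((z y).2.1.1 i j - (symDev (outer (v y) (v y))).1 i j) ^ 2
      ≤ 64 * distSq (fun y => (z y).1) v := by
  rw [distSq, ← integral_const_mul]
  refine integral_mono_of_nonneg (ae_of_all _ fun y => sq_nonneg _)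
    ((integrable_norm_sub_sq hΩ hΩb hv hz).const_mul _) ?_
  filter_upwards [abs_stress_sub_le hn hv hz] with y hy
  rw [← sq_abs]
  calc _ ≤ (8 * ‖(z y).1 - v y‖) ^ 2 := by gcongr; exact hy i j
    _ = _ := by ring

theorem integral_pressure_sub_sq_le {n : ℕ} (hn : 0 < n) {Ω : Set (SpaceTime n)} (hΩ : IsOpen Ω)
    (hΩb : Bornology.IsBounded Ω) {v : SpaceTime n → Vec n} (hv : IsUnitField Ω v)
    {z w : SpaceTime n → State n} (hz : z ∈ X0 Ω) (hw : w ∈ X0 Ω) :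
    ∫ y, ((z y).2.2 - (w y).2.2) ^ 2
      ≤ 128 * (n : ℝ) ^ 4 * (distSq (fun y => (z y).1) v + distSq (fun y => (w y).1) v) := by
  have h := ((isCompactSol_of_mem_X0 hΩb hz).sub (isCompactSol_of_mem_X0 hΩb hw)).integral_pressure_sq_le hn
  have i1 := integrable_norm_sub_sq hΩ hΩb hv hz
  have i2 := integrable_norm_sub_sq hΩ hΩb hv hw
  have hu : ∀ i j, ∫ y, (z y - w y).2.1.1 i j ^ 2
      ≤ 128 * (distSq (fun y => (z y).1) v + distSq (fun y => (w y).1) v) := by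
    intro i j
    rw [distSq, distSq, ← integral_add i1 i2, ← integral_const_mul]
    refine integral_mono_of_nonneg (ae_of_all _ fun y => sq_nonneg _)
      ((i1.add i2).const_mul _) ?_
    filter_upwards [abs_stress_sub_le hn hv hz, abs_stress_sub_le hn hv hw] with y h1 h2
    have h3 := sq_le_sq' (abs_le.1 (h1 i j)).1 (abs_le.1 (h1 i j)).2
    have h4 := sq_le_sq' (abs_le.1 (h2 i j)).1 (abs_le.1 (h2 i j)).2
    have e : (z y - w y).2.1.1 i j = (z y).2.1.1 i j - (w y).2.1.1 i j := rfl
    rw [e]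
    nlinarith [sq_nonneg ((z y).2.1.1 i j - (symDev (outer (v y) (v y))).1 i j
      + ((w y).2.1.1 i j - (symDev (outer (v y) (v y))).1 i j))]
  refine h.trans ?_
  calc _ ≤ (n : ℝ) ^ 2 * ∑ _i : Fin n, ∑ _j : Fin n,
        128 * (distSq (fun y => (z y).1) v + distSq (fun y => (w y).1) v) := by
        gcongr with i _ j _; exact hu i j
    _ = _ := by simp; ring

theorem setIntegral_norm_sq_eq {n : ℕ} {Ω : Set (SpaceTime n)} (hΩ : IsOpen Ω)
    {v : SpaceTime n → Vec n} (hv : IsUnitField Ω v) : ∫ y, ‖v y‖ ^ 2 = volume.real Ω := by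
  have : (fun y => ‖v y‖ ^ 2) =ᵐ[volume] Ω.indicator 1 := by
    filter_upwards [hv.unit, hv.zero] with y h1 h2
    by_cases hy : y ∈ Ω
    · simp [hy, h1 hy]
    · simp [hy, h2 hy]
  rw [integral_congr_ae this, integral_indicator_one hΩ.measurableSet]

theorem integral_norm_sq_le_volume {n : ℕ} {Ω : Set (SpaceTime n)} (hΩ : IsOpen Ω)
    (hΩb : Bornology.IsBounded Ω) {z : SpaceTime n → State n} (hz : z ∈ X0 Ω) :
    ∫ y, ‖(z y).1‖ ^ 2 ≤ volume.real Ω := by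
  rw [← integral_indicator_one hΩ.measurableSet]
  refine integral_mono (isCompactSol_of_mem_X0 hΩb hz).integrable_norm_sq
    ((integrable_indicator_iff hΩ.measurableSet).2
      (integrableOn_const hΩb.measure_lt_top.ne)) fun y => ?_
  by_cases hy : y ∈ Ω
  · simpa [hy] using norm_le_one_of_mem_X0 hz y
  · simp [hy, eq_zero_of_mem_X0 hz hy]

theorem exists_sequence_L2_cauchy {n : ℕ} (hn : 2 ≤ n) {Ω : Set (SpaceTime n)} (hΩ : IsOpen Ω)
    (hΩb : Bornology.IsBounded Ω) :
    ∃ z : ℕ → SpaceTime n → State n, (∀ k, z k ∈ X0 Ω) ∧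
      Tendsto (fun k => ∫ y in Ω, (1 - ‖(z k y).1‖ ^ 2) ^ 2) atTop (𝓝 0) ∧
      Tendsto (fun p : ℕ × ℕ => ∫ y, ‖(z p.1 y).1 - (z p.2 y).1‖ ^ 2) atTop (𝓝 0) := by
  obtain ⟨z, hz, hen, hort⟩ := exists_sequence hn hΩ hΩb
  have hS := fun k => isCompactSol_of_mem_X0 hΩb (hz k)
  have hg0 : 0 < gain n := by
    have : (0 : ℝ) < n := by positivity
    unfold gain; positivity
  set E : ℕ → ℝ := fun k => ∫ y, ‖(z k y).1‖ ^ 2 with hE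
  set D : ℕ → ℝ := fun k => ∫ y in Ω, (1 - ‖(z k y).1‖ ^ 2) ^ 2 with hD
  have hD0 : ∀ k, 0 ≤ D k := fun k => integral_nonneg fun y => sq_nonneg _
  have hhalf : Tendsto (fun k : ℕ => ((1 : ℝ) / 2) ^ k) atTop (𝓝 0) :=
    tendsto_pow_atTop_nhds_zero_of_lt_one (by norm_num) (by norm_num)
  have hmono : Monotone fun k => E k - 2 * (1 / 2) ^ k := by
    refine monotone_nat_of_le_succ fun k => ?_
    have h1 := hen k
    have h2 := mul_nonneg hg0.le (hD0 k)
    rw [pow_succ]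
    change E k + gain n * D k - (1 / 2) ^ k ≤ E (k + 1) at h1
    linarith
  obtain ⟨l, hl⟩ : ∃ l, Tendsto E atTop (𝓝 l) := by
    have h1 := tendsto_atTop_ciSup hmono ⟨volume.real Ω, by
      rintro _ ⟨k, rfl⟩
      have h2 := integral_norm_sq_le_volume hΩ hΩb (hz k)
      have h3 : (0 : ℝ) ≤ (1 / 2) ^ k := by positivity
      change E k ≤ _ at h2
      simp only
      linarith⟩
    refine ⟨_, (h1.add (hhalf.const_mul 2)).congr fun k => ?_⟩
    ring
  refine ⟨z, hz, ?_, ?_⟩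
  · have h1 : Tendsto (fun k => (E (k + 1) - E k + (1 / 2) ^ k) / gain n) atTop (𝓝 0) := by
      simpa using (((hl.comp (tendsto_add_atTop_nat 1)).sub hl).add hhalf).div_const (gain n)
    refine squeeze_zero hD0 (fun k => ?_) h1
    rw [le_div_iff₀ hg0]
    have h1 := hen k
    change E k + gain n * D k - (1 / 2) ^ k ≤ E (k + 1) at h1
    linarith
  · have hcross : ∀ j m, j ≤ m → ∀ i, |∫ y, (z j y).1 i * ((z m y).1 i - (z j y).1 i)|
        ≤ 2 * (1 / 2) ^ j - 2 * (1 / 2) ^ m := by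
      intro j m hjm i
      have hint : ∀ a b, Integrable fun y => (z j y).1 i * ((z a y).1 i - (z b y).1 i) :=
        fun a b => ((hS a).sub (hS b)).integrable_mul_comp (.inl i)
          ((hS j).integrable_comp (.inl i))
      induction m, hjm using Nat.le_induction with
      | base => simp
      | succ m hjm ih =>
        have e : (fun y => (z j y).1 i * ((z (m + 1) y).1 i - (z j y).1 i)) = fun y =>
            (z j y).1 i * ((z (m + 1) y).1 i - (z m y).1 i)
              + (z j y).1 i * ((z m y).1 i - (z j y).1 i) := by
          funext y; ring
        rw [e, integral_add (hint _ _) (hint _ _)]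
        have h1 := hort j m hjm i
        have h2 := abs_add_le (∫ y, (z j y).1 i * ((z (m + 1) y).1 i - (z m y).1 i))
          (∫ y, (z j y).1 i * ((z m y).1 i - (z j y).1 i))
        rw [pow_succ]
        linarith
    have hle : ∀ j m, j ≤ m → ∫ y, ‖(z m y).1 - (z j y).1‖ ^ 2
        ≤ |E m - E j| + 4 * n * (1 / 2) ^ j := by
      intro j m hjm
      have h1 := (hS j).integral_norm_add_sq ((hS m).sub (hS j))
      simp only [add_sub_cancel] at h1
      have h2 : -(∑ _i : Fin n, 2 * ((1 : ℝ) / 2) ^ j)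
          ≤ ∑ i, ∫ y, (z j y).1 i * (z m y - z j y).1 i := by
        rw [← Finset.sum_neg_distrib]
        refine Finset.sum_le_sum fun i _ => ?_
        have h3 := (abs_le.1 (hcross j m hjm i)).1
        have h4 : (0 : ℝ) ≤ (1 / 2) ^ m := by positivity
        change _ ≤ ∫ y, (z j y).1 i * ((z m y).1 i - (z j y).1 i)
        linarith
      simp only [Finset.sum_const, Finset.card_univ, Fintype.card_fin, nsmul_eq_mul] at h2
      have h5 := le_abs_self (E m - E j)
      change E m = E j + _ + ∫ y, ‖(z m y).1 - (z j y).1‖ ^ 2 at h1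
      linarith
    have hle' : ∀ p : ℕ × ℕ, ∫ y, ‖(z p.1 y).1 - (z p.2 y).1‖ ^ 2
        ≤ |E p.1 - E p.2| + 4 * n * ((1 / 2) ^ p.1 + (1 / 2) ^ p.2) := by
      rintro ⟨a, b⟩
      have ha : (0 : ℝ) ≤ 4 * n * (1 / 2) ^ a := by positivity
      have hb : (0 : ℝ) ≤ 4 * n * (1 / 2) ^ b := by positivity
      rcases le_total a b with h | h
      · have h1 := hle a b h
        simp only [norm_sub_rev (z a _).1, abs_sub_comm (E a)]
        linarith
      · have h1 := hle b a h
        simp only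
        linarith
    have h1 : Tendsto (fun p : ℕ × ℕ => E p.1) atTop (𝓝 l) := by
      rw [← prod_atTop_atTop_eq]; exact hl.comp tendsto_fst
    have h2 : Tendsto (fun p : ℕ × ℕ => E p.2) atTop (𝓝 l) := by
      rw [← prod_atTop_atTop_eq]; exact hl.comp tendsto_snd
    have h3 : Tendsto (fun p : ℕ × ℕ => ((1 : ℝ) / 2) ^ p.1) atTop (𝓝 0) := by
      rw [← prod_atTop_atTop_eq]; exact hhalf.comp tendsto_fst
    have h4 : Tendsto (fun p : ℕ × ℕ => ((1 : ℝ) / 2) ^ p.2) atTop (𝓝 0) := by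
      rw [← prod_atTop_atTop_eq]; exact hhalf.comp tendsto_snd
    refine squeeze_zero (fun p => integral_nonneg fun y => sq_nonneg _) hle' ?_
    simpa using (h1.sub h2).abs.add ((h3.add h4).const_mul (4 * (n : ℝ)))

theorem exists_unitField_limit {n : ℕ} (hn : 2 ≤ n) {Ω : Set (SpaceTime n)} (hΩ : IsOpen Ω)
    (hΩb : Bornology.IsBounded Ω) :
    ∃ (z : ℕ → SpaceTime n → State n) (v : SpaceTime n → Vec n), (∀ k, z k ∈ X0 Ω) ∧
      IsUnitField Ω v ∧ Tendsto (fun k => distSq (fun y => (z k y).1) v) atTop (𝓝 0) := by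
  obtain ⟨z, hz, hD, hC⟩ := exists_sequence_L2_cauchy hn hΩ hΩb
  have hm := fun k => (isCompactSol_of_mem_X0 hΩb (hz k)).memLp_v 2
  obtain ⟨v, hv, hlim⟩ := exists_L2_limit hm hC
  obtain ⟨ns, hns, hae⟩ := exists_subseq_tendsto_ae (fun k => (hm k).sub hv) (fun k => (hm k).1)
    hv.1 hlim
  refine ⟨z, v, hz, ⟨hv.1, ?_, ?_⟩, hlim⟩
  · have : IsFiniteMeasure (volume.restrict Ω) := ⟨by
      rw [Measure.restrict_apply_univ]; exact hΩb.measure_lt_top⟩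
    have hv1 : ∀ᵐ y, ‖v y‖ ≤ 1 := by
      filter_upwards [hae] with y hy
      exact le_of_tendsto' hy.norm fun k => norm_le_one_of_mem_X0 (hz _) y
    have hsq : ∀ x : ℝ, 0 ≤ x → x ≤ 1 → (1 - x ^ 2) ^ 2 ≤ 1 := fun x h0 h1 => by
      have : x ^ 2 ≤ 1 := by nlinarith
      nlinarith [sq_nonneg x]
    have h1 : Tendsto (fun k => ∫ y in Ω, (1 - ‖(z (ns k) y).1‖ ^ 2) ^ 2) atTop
        (𝓝 (∫ y in Ω, (1 - ‖v y‖ ^ 2) ^ 2)) := by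
      refine tendsto_integral_of_dominated_convergence (fun _ => 1)
        (fun k => (mem_X0_iff.1 (hz (ns k))).1.continuous_deficit.aestronglyMeasurable)
        (integrable_const _) (fun k => ae_of_all _ fun y => ?_) ?_
      · rw [Real.norm_of_nonneg (sq_nonneg _)]
        exact hsq _ (norm_nonneg _) (norm_le_one_of_mem_X0 (hz _) y)
      · filter_upwards [ae_restrict_of_ae hae] with y hy
        exact ((hy.norm.pow 2).const_sub 1).pow 2
    have h2 := tendsto_nhds_unique h1 (hD.comp hns.tendsto_atTop)
    have hmeas : AEStronglyMeasurable (fun y => (1 - ‖v y‖ ^ 2) ^ 2) (volume.restrict Ω) :=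
      ((aestronglyMeasurable_const.sub (hv.1.norm.pow 2)).pow 2).restrict
    rw [integral_eq_zero_iff_of_nonneg (fun y => sq_nonneg _)
      ((integrable_const (1 : ℝ)).mono' hmeas (by
        filter_upwards [ae_restrict_of_ae hv1] with y hy
        rw [Real.norm_of_nonneg (sq_nonneg _)]
        exact hsq _ (norm_nonneg _) hy))] at h2
    have h3 := (ae_restrict_iff' hΩ.measurableSet).1 h2
    filter_upwards [h3] with y hy hyΩ
    have h4 : (1 - ‖v y‖ ^ 2) ^ 2 = 0 := hy hyΩ
    have h5 : 1 - ‖v y‖ ^ 2 = 0 := by simpa using h4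
    nlinarith [norm_nonneg (v y)]
  · filter_upwards [hae] with y hy hyΩ
    have : ∀ k, (z (ns k) y).1 = 0 := fun k => by rw [eq_zero_of_mem_X0 (hz _) hyΩ]; rfl
    simp only [this] at hy
    exact (tendsto_nhds_unique hy tendsto_const_nhds)

theorem exists_pressure_limit {n : ℕ} (hn : 0 < n) {Ω : Set (SpaceTime n)} (hΩ : IsOpen Ω)
    (hΩb : Bornology.IsBounded Ω) {v : SpaceTime n → Vec n} (hv : IsUnitField Ω v)
    {z : ℕ → SpaceTime n → State n} (hz : ∀ k, z k ∈ X0 Ω)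
    (h : Tendsto (fun k => distSq (fun y => (z k y).1) v) atTop (𝓝 0)) :
    ∃ q : SpaceTime n → ℝ, MemLp q 2 ∧ (∀ᵐ y, |q y| ≤ 1) ∧ (∀ᵐ y, y ∉ Ω → q y = 0) ∧
      Tendsto (fun k => ∫ y, ((z k y).2.2 - q y) ^ 2) atTop (𝓝 0) := by
  have hm : ∀ k, MemLp (fun y => (z k y).2.2) 2 := fun k =>
    (isCompactSol_of_mem_X0 hΩb (hz k)).memLp_comp (.inr (.inr ())) 2
  have h1 : Tendsto (fun p : ℕ × ℕ => distSq (fun y => (z p.1 y).1) v) atTop (𝓝 0) := by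
    rw [← prod_atTop_atTop_eq]; exact h.comp tendsto_fst
  have h2 : Tendsto (fun p : ℕ × ℕ => distSq (fun y => (z p.2 y).1) v) atTop (𝓝 0) := by
    rw [← prod_atTop_atTop_eq]; exact h.comp tendsto_snd
  obtain ⟨q, hq, hlim⟩ := exists_L2_limit hm (by
    simp only [Real.norm_eq_abs, sq_abs]
    refine squeeze_zero (fun p => integral_nonneg fun y => sq_nonneg _)
      (fun p => integral_pressure_sub_sq_le hn hΩ hΩb hv (hz p.1) (hz p.2)) ?_
    simpa using (h1.add h2).const_mul (128 * (n : ℝ) ^ 4))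
  obtain ⟨ns, hns, hae⟩ := exists_subseq_tendsto_ae (fun k => (hm k).sub hq) (fun k => (hm k).1)
    hq.1 hlim
  simp only [Real.norm_eq_abs, sq_abs] at hlim
  refine ⟨q, hq, ?_, ?_, hlim⟩
  · filter_upwards [hae] with y hy
    exact le_of_tendsto' hy.abs fun k => abs_pressure_le_of_mem_X0 (hz _) y
  · filter_upwards [hae] with y hy hyΩ
    have : ∀ k, (z (ns k) y).2.2 = 0 := fun k => by rw [eq_zero_of_mem_X0 (hz _) hyΩ]; rfl
    simp only [this] at hy
    exact (tendsto_nhds_unique hy tendsto_const_nhds)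

theorem IsUnitField.aestronglyMeasurable_symDev {n : ℕ} {Ω : Set (SpaceTime n)}
    {v : SpaceTime n → Vec n} (hv : IsUnitField Ω v) (i j : Fin n) :
    AEStronglyMeasurable fun y => (symDev (outer (v y) (v y))).1 i j := by
  simp only [symDev_outer_self]
  have h : Continuous fun w : Vec n =>
      w i * w j - ‖w‖ ^ 2 / (n : ℝ) * (1 : Matrix (Fin n) (Fin n) ℝ) i j := by fun_prop
  exact h.comp_aestronglyMeasurable hv.meas

theorem IsUnitField.abs_symDev_le {n : ℕ} (hn : 0 < n) {Ω : Set (SpaceTime n)}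
    {v : SpaceTime n → Vec n} (hv : IsUnitField Ω v) (i j : Fin n) :
    ∀ᵐ y, ‖(symDev (outer (v y) (v y))).1 i j‖ ≤ 4 := by
  filter_upwards [hv.norm_le] with y hy
  have h1 := abs_symDev_outer_sub_le hn hy (show ‖(0 : Vec n)‖ ≤ 1 by simp) i j
  have h2 : (symDev (outer (0 : Vec n) 0)).1 i j = 0 := by simp [symDev_outer_self]
  rw [h2, sub_zero, sub_zero] at h1
  rw [Real.norm_eq_abs]
  linarith

theorem IsUnitField.memLp_symDev {n : ℕ} (hn : 0 < n) {Ω : Set (SpaceTime n)} (hΩ : IsOpen Ω)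
    (hΩb : Bornology.IsBounded Ω) {v : SpaceTime n → Vec n} (hv : IsUnitField Ω v) (i j : Fin n)
    (p : ℝ≥0∞) : MemLp (fun y => (symDev (outer (v y) (v y))).1 i j) p := by
  refine memLp_of_bounded_of_support hΩ hΩb (hv.aestronglyMeasurable_symDev i j)
    (hv.abs_symDev_le hn i j) ?_ p
  filter_upwards [hv.zero] with y hy hyΩ
  rw [hy hyΩ]; simp [symDev_outer_self]

theorem exists_isConstructed {n : ℕ} (hn : 2 ≤ n) {Ω : Set (SpaceTime n)} (hΩ : IsOpen Ω)
    (hΩb : Bornology.IsBounded Ω) :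
    ∃ (v : SpaceTime n → Vec n) (p : SpaceTime n → ℝ), IsConstructed Ω v p := by
  have hn0 : 0 < n := by omega
  obtain ⟨z, v, hz, hv, hlim⟩ := exists_unitField_limit hn hΩ hΩb
  obtain ⟨q, hq, hq1, hq0, hqlim⟩ := exists_pressure_limit hn0 hΩ hΩb hv hz hlim
  have hS := fun k => isCompactSol_of_mem_X0 hΩb (hz k)
  obtain ⟨ns, hns, hvae⟩ := exists_subseq_tendsto_ae
    (fun k => ((hS k).memLp_v 2).sub (hv.memLp hΩ hΩb 2))
    (fun k => ((hS k).memLp_v 2).1) hv.meas hlim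
  have hmq : ∀ k, MemLp (fun y => (z k y).2.2) 2 := fun k => (hS k).memLp_comp (.inr (.inr ())) 2
  obtain ⟨ms, hms, hqae⟩ := exists_subseq_tendsto_ae (f := fun k y => (z (ns k) y).2.2)
    (fun k => (hmq _).sub hq) (fun k => (hmq _).1) hq.1
    (by simpa only [Real.norm_eq_abs, sq_abs, Function.comp_def] using hqlim.comp hns.tendsto_atTop)
  set w : ℕ → SpaceTime n → State n := fun k => z (ns (ms k)) with hw
  have hwX : ∀ k, w k ∈ X0 Ω := fun k => hz _
  set zl : SpaceTime n → State n := fun y => (v y, symDev (outer (v y) (v y)), q y) with hzl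
  have hwv : ∀ᵐ y, Tendsto (fun k => (w k y).1) atTop (𝓝 (v y)) := by
    filter_upwards [hvae] with y hy using hy.comp hms.tendsto_atTop
  have hpt : ∀ᵐ y, ∀ c, Tendsto (fun k => comp c (w k y) - comp c (zl y)) atTop (𝓝 0) := by
    filter_upwards [hwv, hqae, ae_all_iff.2 fun k => abs_stress_sub_le hn0 hv (hwX k)]
      with y h1 h2 h3 c
    have hn1 : Tendsto (fun k => ‖(w k y).1 - v y‖) atTop (𝓝 0) :=
      tendsto_iff_norm_sub_tendsto_zero.1 h1
    rcases c with i | ij | _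
    · refine squeeze_zero_norm (fun k => ?_) hn1
      exact PiLp.norm_apply_le ((w k y).1 - v y) i
    · refine squeeze_zero_norm (fun k => h3 k ij.1 ij.2) ?_
      simpa using hn1.const_mul 8
    · exact tendsto_sub_nhds_zero_iff.2 h2
  have hbd : ∀ k, ∀ᵐ y, ∀ c, ‖comp c (w k y) - comp c (zl y)‖ ≤ 16 := by
    intro k
    filter_upwards [hv.norm_le, hq1, abs_stress_sub_le hn0 hv (hwX k)] with y h1 h2 h3 c
    have h4 : ‖(w k y).1 - v y‖ ≤ 2 := by
      have := norm_sub_le (w k y).1 (v y)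
      have := norm_le_one_of_mem_X0 (hwX k) y
      linarith
    rcases c with i | ij | _
    · have : ‖((w k y).1 - v y) i‖ ≤ ‖(w k y).1 - v y‖ := PiLp.norm_apply_le _ i
      exact this.trans (by linarith)
    · exact (h3 ij.1 ij.2).trans (by linarith)
    · have h5 := abs_pressure_le_of_mem_X0 (hwX k) y
      exact (abs_sub _ _).trans (by
        change |(w k y).2.2| + |q y| ≤ 16
        linarith)
  have hmu := fun i j => hv.memLp_symDev hn0 hΩ hΩb i j ∞
  have hmqq : MemLp q ∞ := memLp_of_bounded_of_support hΩ hΩb hq.1 hq1 hq0 ∞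
  have hmeas : ∀ c, AEStronglyMeasurable fun y => comp c (zl y) := by
    rintro (i | ij | _)
    · have : Continuous fun w : Vec n => w i := by fun_prop
      exact this.comp_aestronglyMeasurable hv.meas
    · exact (hmu ij.1 ij.2).1
    · exact hq.1
  refine ⟨v, fun y => q y - ‖v y‖ ^ 2 / n, zl, ⟨hv.memLp hΩ hΩb ∞, hmu, hmqq, ?_⟩,
    fun y => rfl, (ae_restrict_iff' hΩ.measurableSet).2 hv.unit, EventuallyEq.rfl⟩
  intro m g ε hg hε
  have htest : ∀ l c, ∀ᶠ k in atTop, |∫ y, g l y * (comp c (w k y) - comp c (zl y))| < ε := by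
    intro l c
    have h1 : Tendsto (fun k => ∫ y, g l y * (comp c (w k y) - comp c (zl y))) atTop
        (𝓝 (∫ y, g l y * 0)) := by
      refine tendsto_integral_of_dominated_convergence (fun y => ‖g l y‖ * 16)
        (fun k => (hg l).1.mul (((isCompactSol_of_mem_X0 hΩb
          (hwX k)).integrable_comp c).1.sub (hmeas c)))
        ((hg l).norm.mul_const _) (fun k => ?_) ?_
      · filter_upwards [hbd k] with y hy
        rw [norm_mul]
        gcongr
        exact hy c
      · filter_upwards [hpt] with y hy using (hy c).const_mul _
    have h2 := h1.abs
    simp only [mul_zero, integral_zero, abs_zero] at h2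
    exact h2.eventually (gt_mem_nhds hε)
  obtain ⟨k, hk⟩ := (eventually_all.2 fun l => eventually_all.2 fun c => htest l c).exists
  exact ⟨w k, hwX k, fun l => ⟨fun i => hk l (.inl i), fun i j => hk l (.inr (.inl (i, j))),
    hk l (.inr (.inr ()))⟩⟩

theorem memLp_comp_of_mem_X {n : ℕ} {Ω : Set (SpaceTime n)} {z : SpaceTime n → State n}
    (hz : z ∈ X Ω) (c : Idx n) : MemLp (fun y => comp c (z y)) ∞ := by
  rcases c with i | ij | _
  · have h := hz.1
    refine h.of_le ?_ (ae_of_all _ fun y => PiLp.norm_apply_le (z y).1 i)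
    have : Continuous fun w : Vec n => w i := by fun_prop
    exact this.comp_aestronglyMeasurable h.1
  · exact hz.2.1 ij.1 ij.2
  · exact hz.2.2.1

theorem exists_mem_X0_near {n : ℕ} {Ω : Set (SpaceTime n)} {z : SpaceTime n → State n}
    (hz : z ∈ X Ω) {ι : Type} [Finite ι] (g : ι → SpaceTime n → ℝ)
    (hg : ∀ l, Integrable (g l)) {ε : ℝ} (hε : 0 < ε) :
    ∃ z₀ ∈ X0 Ω, ∀ l c, |∫ y, g l y * (comp c (z₀ y) - comp c (z y))| < ε := by
  obtain ⟨m, ⟨e⟩⟩ := Finite.exists_equiv_fin ι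
  obtain ⟨z₀, hz₀, h⟩ := hz.2.2.2 m (fun k => g (e.symm k)) ε (fun k => hg _) hε
  refine ⟨z₀, hz₀, fun l c => ?_⟩
  have := h (e l)
  simp only [e.symm_apply_apply] at this
  rcases c with i | ij | _
  exacts [this.1 i, this.2.1 ij.1 ij.2, this.2.2]

theorem comp_eq_zero_of_mem_X {n : ℕ} {Ω : Set (SpaceTime n)} (hΩ : IsOpen Ω)
    {z : SpaceTime n → State n} (hz : z ∈ X Ω) (c : Idx n) :
    ∀ᵐ y, y ∉ Ω → comp c (z y) = 0 := by
  have hm := memLp_comp_of_mem_X hz c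
  have key : ∀ R : ℕ, ∀ᵐ y, y ∈ Ωᶜ ∩ Metric.ball (0 : SpaceTime n) R → comp c (z y) = 0 := by
    intro R
    set A := Ωᶜ ∩ Metric.ball (0 : SpaceTime n) R with hA
    have hAm : MeasurableSet A := hΩ.measurableSet.compl.inter Metric.isOpen_ball.measurableSet
    have hfin : volume A ≠ ⊤ :=
      (Metric.isBounded_ball.subset Set.inter_subset_right).measure_lt_top.ne
    have : IsFiniteMeasure (volume.restrict A) := ⟨by
      rw [Measure.restrict_apply_univ]; exact hfin.lt_top⟩
    have hmA : MemLp (fun y => comp c (z y)) ∞ (volume.restrict A) := hm.restrict A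
    have hg : Integrable (A.indicator fun y => comp c (z y)) :=
      (integrable_indicator_iff hAm).2 (hmA.integrable le_top)
    have hsq : Integrable (fun y => comp c (z y) ^ 2) (volume.restrict A) :=
      (hmA.mono_exponent (p := 2) le_top).integrable_sq
    have h0 : ∫ y in A, comp c (z y) ^ 2 = 0 := by
      refine le_antisymm (le_of_forall_pos_lt_add fun ε hε => ?_)
        (integral_nonneg fun y => sq_nonneg _)
      obtain ⟨z₀, hz₀, h⟩ := exists_mem_X0_near hz
        (fun _ : Unit => A.indicator fun y => comp c (z y)) (fun _ => hg) hε
      have e : ∫ y, A.indicator (fun y => comp c (z y)) y * (comp c (z₀ y) - comp c (z y))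
          = -∫ y in A, comp c (z y) ^ 2 := by
        rw [← integral_neg, ← integral_indicator hAm]
        congr 1; funext y
        by_cases hy : y ∈ A
        · simp only [Set.indicator_of_mem hy, eq_zero_of_mem_X0 hz₀ hy.1, comp_zero]
          ring
        · simp [Set.indicator_of_notMem hy]
      have h1 := h () c
      simp only [e, abs_neg] at h1
      have := le_abs_self (∫ y in A, comp c (z y) ^ 2)
      linarith
    rw [integral_eq_zero_iff_of_nonneg (fun y => sq_nonneg _) hsq] at h0
    filter_upwards [(ae_restrict_iff' hAm).1 h0] with y hy hyA
    simpa using hy hyA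
  filter_upwards [ae_all_iff.2 key] with y hy hyΩ
  obtain ⟨R, hR⟩ := exists_nat_gt ‖y‖
  exact hy R ⟨hyΩ, by simpa using hR⟩

theorem isUnitField_of_mem_X {n : ℕ} {Ω : Set (SpaceTime n)} (hΩ : IsOpen Ω)
    {z : SpaceTime n → State n} (hz : z ∈ X Ω)
    (hu : ∀ᵐ y ∂volume.restrict Ω, ‖(z y).1‖ = 1) : IsUnitField Ω fun y => (z y).1 where
  meas := hz.1.1
  unit := (ae_restrict_iff' hΩ.measurableSet).1 hu
  zero := by
    filter_upwards [ae_all_iff.2 fun i : Fin n => comp_eq_zero_of_mem_X hΩ hz (.inl i)]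
      with y hy hyΩ
    ext i
    exact hy i hyΩ

theorem IsUnitField.memLp_apply {n : ℕ} {Ω : Set (SpaceTime n)} (hΩ : IsOpen Ω)
    (hΩb : Bornology.IsBounded Ω) {v : SpaceTime n → Vec n} (hv : IsUnitField Ω v) (i : Fin n)
    (p : ℝ≥0∞) : MemLp (fun y => v y i) p := by
  refine (hv.memLp hΩ hΩb p).of_le ?_ (ae_of_all _ fun y => PiLp.norm_apply_le (v y) i)
  have : Continuous fun w : Vec n => w i := by fun_prop
  exact this.comp_aestronglyMeasurable hv.meas

theorem distSq_le {n : ℕ} {Ω : Set (SpaceTime n)} (hΩ : IsOpen Ω)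
    (hΩb : Bornology.IsBounded Ω) {v : SpaceTime n → Vec n} (hv : IsUnitField Ω v)
    {z : SpaceTime n → State n} (hz : z ∈ X0 Ω) {ε : ℝ}
    (h : ∀ i, |∫ y, v y i * ((z y).1 i - v y i)| ≤ ε) :
    distSq (fun y => (z y).1) v ≤ 2 * n * ε := by
  have hS := isCompactSol_of_mem_X0 hΩb hz
  have hv2 := hv.memLp hΩ hΩb 2
  have i1 := hS.integrable_norm_sq
  have i2 : Integrable fun y => ‖v y‖ ^ 2 := (memLp_two_iff_integrable_sq_norm hv2.1).1 hv2
  have hi : ∀ i ∈ Finset.univ, Integrable fun y => v y i * ((z y).1 i - v y i) := fun i _ =>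
    integrable_mul_of_memLp_two (hv.memLp_apply hΩ hΩb i 2)
      ((hS.memLp_comp (.inl i) 2).sub (hv.memLp_apply hΩ hΩb i 2))
  have i3 : Integrable fun y => 2 * ∑ i, v y i * ((z y).1 i - v y i) :=
    (integrable_finsetSum _ hi).const_mul 2
  have i4 : Integrable fun y => ‖(z y).1‖ ^ 2 - ‖v y‖ ^ 2 := i1.sub i2
  have e : distSq (fun y => (z y).1) v = (∫ y, ‖(z y).1‖ ^ 2) - (∫ y, ‖v y‖ ^ 2)
      - 2 * ∑ i, ∫ y, v y i * ((z y).1 i - v y i) := by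
    rw [← integral_finsetSum _ hi, ← integral_const_mul, ← integral_sub i1 i2,
      ← integral_sub i4 i3, distSq]
    congr 1; funext y
    have : ∑ i, v y i * ((z y).1 i - v y i) = inner ℝ (v y) ((z y).1 - v y) := by
      rw [← sum_mul_eq_inner]; rfl
    rw [this, inner_sub_right, real_inner_self_eq_norm_sq, norm_sub_sq_real, real_inner_comm]
    ring
  have h1 := integral_norm_sq_le_volume hΩ hΩb hz
  rw [← setIntegral_norm_sq_eq hΩ hv] at h1
  have h2 : -(n * ε) ≤ ∑ i, ∫ y, v y i * ((z y).1 i - v y i) := by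
    have : ∑ _i : Fin n, (-ε) ≤ ∑ i, ∫ y, v y i * ((z y).1 i - v y i) :=
      Finset.sum_le_sum fun i _ => (abs_le.1 (h i)).1
    simpa using this
  rw [e]
  linarith

theorem exists_approx_sequence {n : ℕ} {Ω : Set (SpaceTime n)} (hΩ : IsOpen Ω)
    (hΩb : Bornology.IsBounded Ω) {z : SpaceTime n → State n} (hz : z ∈ X Ω)
    (hv : IsUnitField Ω fun y => (z y).1) {g : SpaceTime n → ℝ} (hg : Integrable g) :
    ∃ w : ℕ → SpaceTime n → State n, (∀ k, w k ∈ X0 Ω) ∧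
      Tendsto (fun k => distSq (fun y => (w k y).1) fun y => (z y).1) atTop (𝓝 0) ∧
      ∀ c, Tendsto (fun k => ∫ y, g y * (comp c (w k y) - comp c (z y))) atTop (𝓝 0) := by
  have hint : ∀ l : Option (Fin n), Integrable
      ((fun l : Option (Fin n) => l.elim g fun i => fun y => (z y).1 i) l) := by
    rintro (_ | i)
    · exact hg
    · exact memLp_one_iff_integrable.1 (hv.memLp_apply hΩ hΩb i 1)
  have hpos : ∀ k : ℕ, (0 : ℝ) < 1 / ((k : ℝ) + 1) := fun k => by positivity
  choose w hw hnear using fun k : ℕ => exists_mem_X0_near hz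
    (fun l : Option (Fin n) => l.elim g fun i => fun y => (z y).1 i) hint (hpos k)
  have ht : Tendsto (fun k : ℕ => 1 / ((k : ℝ) + 1)) atTop (𝓝 0) :=
    tendsto_one_div_add_atTop_nhds_zero_nat
  refine ⟨w, hw, ?_, fun c => ?_⟩
  · refine squeeze_zero (fun k => integral_nonneg fun y => sq_nonneg _)
      (fun k => distSq_le hΩ hΩb hv (hw k) fun i => (hnear k (some i) (.inl i)).le) ?_
    simpa using ht.const_mul (2 * (n : ℝ))
  · exact squeeze_zero_norm (fun k => (hnear k none c).le) ht

theorem exists_ae_bound_of_memLp_top {α F : Type*} [MeasurableSpace α] {μ : Measure α}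
    [NormedAddCommGroup F] {f : α → F} (hf : MemLp f ∞ μ) : ∃ C : ℝ, ∀ᵐ x ∂μ, ‖f x‖ ≤ C := by
  have h := hf.2
  rw [eLpNorm_exponent_top] at h
  refine ⟨(eLpNormEssSup f μ).toReal, ?_⟩
  filter_upwards [ae_le_eLpNormEssSup (f := f) (μ := μ)] with x hx
  rw [← toReal_enorm]
  exact ENNReal.toReal_mono h.ne hx

theorem memLp_of_mem_X {n : ℕ} {Ω : Set (SpaceTime n)} (hΩ : IsOpen Ω)
    (hΩb : Bornology.IsBounded Ω) {z : SpaceTime n → State n} (hz : z ∈ X Ω) (c : Idx n)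
    (p : ℝ≥0∞) : MemLp (fun y => comp c (z y)) p := by
  have h := memLp_comp_of_mem_X hz c
  obtain ⟨C, hC⟩ := exists_ae_bound_of_memLp_top h
  exact memLp_of_bounded_of_support hΩ hΩb h.1 hC (comp_eq_zero_of_mem_X hΩ hz c) p

theorem tendsto_integral_stress_sub_sq {n : ℕ} (hn : 0 < n) {Ω : Set (SpaceTime n)}
    (hΩ : IsOpen Ω) (hΩb : Bornology.IsBounded Ω) {v : SpaceTime n → Vec n}
    (hv : IsUnitField Ω v) {w : ℕ → SpaceTime n → State n} (hw : ∀ k, w k ∈ X0 Ω)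
    (h : Tendsto (fun k => distSq (fun y => (w k y).1) v) atTop (𝓝 0)) (i j : Fin n) :
    Tendsto (fun k => ∫ y, ((w k y).2.1.1 i j - (symDev (outer (v y) (v y))).1 i j) ^ 2)
      atTop (𝓝 0) := by
  refine squeeze_zero (fun k => integral_nonneg fun y => sq_nonneg _)
    (fun k => integral_stress_sub_sq_le hn hΩ hΩb hv (hw k) i j) ?_
  simpa using h.const_mul 64

theorem stress_eq_of_mem_X {n : ℕ} (hn : 0 < n) {Ω : Set (SpaceTime n)} (hΩ : IsOpen Ω)
    (hΩb : Bornology.IsBounded Ω) {z : SpaceTime n → State n} (hz : z ∈ X Ω)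
    (hv : IsUnitField Ω fun y => (z y).1) :
    ∀ᵐ y, ∀ i j, (z y).2.1.1 i j = (symDev (outer (z y).1 (z y).1)).1 i j := by
  refine ae_all_iff.2 fun i => ae_all_iff.2 fun j => ?_
  have hu : ∀ p, MemLp (fun y => (z y).2.1.1 i j) p :=
    memLp_of_mem_X hΩ hΩb hz (.inr (.inl (i, j)))
  have hs := hv.memLp_symDev hn hΩ hΩb i j
  obtain ⟨w, hw, hlim, htest⟩ := exists_approx_sequence hΩ hΩb hz hv
    (memLp_one_iff_integrable.1 ((hu 1).sub (hs 1)))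
  exact ae_eq_of_L2_limit_of_test
    (fun k => (isCompactSol_of_mem_X0 hΩb (hw k)).memLp_comp (.inr (.inl (i, j))) 2)
    (hs 2) (hu 2) (tendsto_integral_stress_sub_sq hn hΩ hΩb hv hw hlim i j)
    (htest (.inr (.inl (i, j))))

/-- An element of `X` with unit velocity in `Ω` is a strong limit of elements of `X₀`. -/
theorem exists_strong_approx {n : ℕ} (hn : 0 < n) {Ω : Set (SpaceTime n)} (hΩ : IsOpen Ω)
    (hΩb : Bornology.IsBounded Ω) {z : SpaceTime n → State n} (hz : z ∈ X Ω)
    (hv : IsUnitField Ω fun y => (z y).1) :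
    (∀ᵐ y, |(z y).2.2| ≤ 1) ∧ ∃ w : ℕ → SpaceTime n → State n, (∀ k, w k ∈ X0 Ω) ∧
      Tendsto (fun k => distSq (fun y => (w k y).1) fun y => (z y).1) atTop (𝓝 0) ∧
      Tendsto (fun k => ∫ y, ((w k y).2.2 - (z y).2.2) ^ 2) atTop (𝓝 0) := by
  obtain ⟨w, hw, hlim, -⟩ := exists_approx_sequence hΩ hΩb hz hv (integrable_zero _ ℝ _)
  obtain ⟨q, hq, hq1, hq0, hqlim⟩ := exists_pressure_limit hn hΩ hΩb hv hw hlim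
  have hzq : ∀ p, MemLp (fun y => (z y).2.2) p := memLp_of_mem_X hΩ hΩb hz (.inr (.inr ()))
  have hqp : MemLp q 1 := memLp_of_bounded_of_support hΩ hΩb hq.1 hq1 hq0 1
  have hmem : ∀ {z : SpaceTime n → State n}, z ∈ X0 Ω → MemLp (fun y => (z y).2.2) 2 :=
    fun h => (isCompactSol_of_mem_X0 hΩb h).memLp_comp (.inr (.inr ())) 2
  obtain ⟨w', hw', hlim', htest⟩ := exists_approx_sequence hΩ hΩb hz hv
    (memLp_one_iff_integrable.1 ((hzq 1).sub hqp))
  have hlim2 : Tendsto (fun k => ∫ y, ((w' k y).2.2 - q y) ^ 2) atTop (𝓝 0) := by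
    have hb : ∀ k, ∫ y, ((w' k y).2.2 - q y) ^ 2
        ≤ 2 * (128 * (n : ℝ) ^ 4 * (distSq (fun y => (w' k y).1) (fun y => (z y).1)
          + distSq (fun y => (w k y).1) fun y => (z y).1))
          + 2 * ∫ y, ((w k y).2.2 - q y) ^ 2 := by
      intro k
      have i1 : Integrable fun y => ((w' k y).2.2 - (w k y).2.2) ^ 2 :=
        ((hmem (hw' k)).sub (hmem (hw k))).integrable_sq
      have i2 : Integrable fun y => ((w k y).2.2 - q y) ^ 2 :=
        ((hmem (hw k)).sub hq).integrable_sq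
      have i3 : Integrable fun y => ((w' k y).2.2 - q y) ^ 2 :=
        ((hmem (hw' k)).sub hq).integrable_sq
      have h1 := integral_pressure_sub_sq_le hn hΩ hΩb hv (hw' k) (hw k)
      have h2 : ∫ y, ((w' k y).2.2 - q y) ^ 2 ≤ ∫ y, (2 * ((w' k y).2.2 - (w k y).2.2) ^ 2
          + 2 * ((w k y).2.2 - q y) ^ 2) := by
        refine integral_mono i3 ((i1.const_mul 2).add (i2.const_mul 2)) fun y => ?_
        simp only
        nlinarith [sq_nonneg (((w' k y).2.2 - (w k y).2.2) - ((w k y).2.2 - q y))]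
      rw [integral_add (i1.const_mul 2) (i2.const_mul 2), integral_const_mul,
        integral_const_mul] at h2
      linarith
    refine squeeze_zero (fun k => integral_nonneg fun y => sq_nonneg _) hb ?_
    simpa using (((hlim'.add hlim).const_mul (128 * (n : ℝ) ^ 4)).const_mul 2).add
      (hqlim.const_mul 2)
  have heq : (fun y => (z y).2.2) =ᵐ[volume] q :=
    ae_eq_of_L2_limit_of_test (fun k => hmem (hw' k)) hq (hzq 2) hlim2
      (htest (.inr (.inr ())))
  refine ⟨?_, w, hw, hlim, hqlim.congr fun k => integral_congr_ae ?_⟩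
  · filter_upwards [heq, hq1] with y h1 h2
    rw [h1]; exact h2
  · filter_upwards [heq] with y h1
    rw [h1]

theorem integral_pd_mul_eq_neg {n : ℕ} (a : SpaceTime n) {f g : SpaceTime n → ℝ}
    (hf : ContDiff ℝ ∞ f) (hfs : HasCompactSupport f) (hg : ContDiff ℝ ∞ g) :
    ∫ y, pd a f y * g y = -∫ y, f y * pd a g y := by
  have h := integral_mul_fderiv_eq_neg_fderiv_mul_of_integrable (𝕜 := ℝ)
    (μ := (volume : Measure (SpaceTime n))) (f := f) (g := g) (v := a)
    (((contDiff_pd a hf).continuous.mul hg.continuous).integrable_of_hasCompactSupport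
      (hasCompactSupport_pd hfs a).mul_right)
    ((hf.continuous.mul (contDiff_pd a hg).continuous).integrable_of_hasCompactSupport
      hfs.mul_right)
    ((hf.continuous.mul hg.continuous).integrable_of_hasCompactSupport hfs.mul_right)
    (fun x _ => (hf.differentiable (by simp)).differentiableAt)
    (fun x _ => (hg.differentiable (by simp)).differentiableAt)
  simp only [pd]
  rw [h, neg_neg]

theorem tendsto_eLpNorm_of_L2 {n : ℕ} {F : Type*} [NormedAddCommGroup F] {Ω : Set (SpaceTime n)}
    (hΩ : IsOpen Ω) (hΩb : Bornology.IsBounded Ω) {f : ℕ → SpaceTime n → F}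
    (hf : ∀ k, AEStronglyMeasurable (f k)) {C : ℝ} (hC : ∀ k, ∀ᵐ y, ‖f k y‖ ≤ C)
    (h0 : ∀ k, ∀ᵐ y, y ∉ Ω → f k y = 0)
    (h : Tendsto (fun k => ∫ y, ‖f k y‖ ^ 2) atTop (𝓝 0)) {r : ℝ≥0∞} (hr : 1 ≤ r) (hr' : r < ⊤) :
    Tendsto (fun k => eLpNorm (f k) r volume) atTop (𝓝 0) := by
  have hm : ∀ k p, MemLp (f k) p := fun k p =>
    memLp_of_bounded_of_support hΩ hΩb (hf k) (hC k) (h0 k) p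
  have hr0 : r ≠ 0 := (one_pos.trans_le hr).ne'
  have hrr : 1 ≤ r.toReal := by
    have := ENNReal.toReal_mono hr'.ne hr
    simpa using this
  have hind : MemLp (Ω.indicator (1 : SpaceTime n → ℝ)) 2 := by
    rw [memLp_indicator_iff_restrict hΩ.measurableSet]
    have : IsFiniteMeasure (volume.restrict Ω) := ⟨by
      rw [Measure.restrict_apply_univ]; exact hΩb.measure_lt_top⟩
    exact memLp_const 1
  have hle : ∀ k, ∫ y, ‖f k y‖ ^ r.toReal ≤ C ^ (r.toReal - 1) * (Real.sqrt (∫ y, ‖f k y‖ ^ 2)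
      * Real.sqrt (∫ y, Ω.indicator (1 : SpaceTime n → ℝ) y ^ 2)) := by
    intro k
    have i1 : Integrable fun y => ‖f k y‖ * Ω.indicator (1 : SpaceTime n → ℝ) y :=
      integrable_mul_of_memLp_two (hm k 2).norm hind
    have h1 : ∫ y, ‖f k y‖ ^ r.toReal
        ≤ ∫ y, C ^ (r.toReal - 1) * (‖f k y‖ * Ω.indicator (1 : SpaceTime n → ℝ) y) := by
      refine integral_mono_of_nonneg (ae_of_all _ fun y => by positivity) (i1.const_mul _) ?_
      filter_upwards [hC k, h0 k] with y h1 h2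
      by_cases hy : y ∈ Ω
      · simp only [Set.indicator_of_mem hy, Pi.one_apply, mul_one]
        rcases (norm_nonneg (f k y)).eq_or_lt with he | he
        · rw [← he, Real.zero_rpow (by linarith), mul_zero]
        · have e : ‖f k y‖ ^ r.toReal = ‖f k y‖ ^ (r.toReal - 1) * ‖f k y‖ := by
            rw [← Real.rpow_add_one he.ne']; congr 1; ring
          rw [e]
          gcongr
      · simp only [h2 hy, norm_zero, zero_mul, mul_zero]
        rw [Real.zero_rpow (by linarith)]
    rw [integral_const_mul] at h1
    have hC0 : 0 ≤ C := by
      obtain ⟨y, hy⟩ := (hC k).exists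
      exact (norm_nonneg _).trans hy
    refine h1.trans (mul_le_mul_of_nonneg_left ?_ (Real.rpow_nonneg hC0 _))
    exact (le_abs_self _).trans (abs_integral_mul_le (hm k 2).norm hind)
  have ht : Tendsto (fun k => ∫ y, ‖f k y‖ ^ r.toReal) atTop (𝓝 0) := by
    refine squeeze_zero (fun k => integral_nonneg fun y => by positivity) hle ?_
    have h1 := (Real.continuous_sqrt.tendsto 0).comp h
    simpa [Function.comp_def] using (h1.mul_const
      (Real.sqrt (∫ y, Ω.indicator (1 : SpaceTime n → ℝ) y ^ 2))).const_mul (C ^ (r.toReal - 1))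
  simp only [fun k => (hm k r).eLpNorm_eq_integral_rpow_norm hr0 hr'.ne]
  have h1 := ht.rpow_const (p := r.toReal⁻¹) (Or.inr (by positivity))
  rw [Real.zero_rpow (inv_ne_zero (by linarith))] at h1
  simpa [Function.comp_def] using (ENNReal.continuous_ofReal.tendsto 0).comp h1

theorem IsTest.apply {n : ℕ} {φ : SpaceTime n → Vec n} (h : IsTest φ) (i : Fin n) :
    ContDiff ℝ ∞ (fun w => φ w i) ∧ HasCompactSupport fun w => φ w i :=
  ⟨(contDiff_euclidean.1 h.1) i, h.2.comp_left (g := fun v : Vec n => v i) rfl⟩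

/-- The momentum equation of a compactly supported solution, tested with `φ`. -/
theorem IsCompactSol.weak_momentum {n : ℕ} {z : SpaceTime n → State n} (hz : IsCompactSol z)
    {φ : SpaceTime n → Vec n} (hφ : IsTest φ) :
    (∑ i, ∫ y, (z y).1 i * dt (fun w => φ w i) y)
      + (∑ i, ∑ j, ∫ y, (z y).2.1.1 i j * dx j (fun w => φ w i) y)
      + ∑ i, ∫ y, (z y).2.2 * dx i (fun w => φ w i) y = 0 := by
  have hk : ∀ (c : Idx n) (a : SpaceTime n) (i : Fin n),
      ∫ y, comp c (z y) * pd a (fun w => φ w i) y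
        = -∫ y, pd a (fun w => comp c (z w)) y * φ y i := fun c a i => by
    rw [integral_pd_mul_eq_neg a (hz.smooth_comp c) (hz.hasCompactSupport_comp c) (hφ.apply i).1,
      neg_neg]
  have hi : ∀ (c : Idx n) (a : SpaceTime n) (i : Fin n),
      Integrable fun y => pd a (fun w => comp c (z w)) y * φ y i := fun c a i =>
    ((contDiff_pd a (hz.smooth_comp c)).continuous.mul
      (hφ.apply i).1.continuous).integrable_of_hasCompactSupport
        (hasCompactSupport_pd (hz.hasCompactSupport_comp c) a).mul_right
  rw [← Finset.sum_add_distrib, ← Finset.sum_add_distrib]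
  refine Finset.sum_eq_zero fun i _ => ?_
  have e1 := hk (.inl i) (0, 1) i
  have e2 := fun j => hk (.inr (.inl (i, j))) (EuclideanSpace.single j 1, 0) i
  have e3 := hk (.inr (.inr ())) (EuclideanSpace.single i 1, 0) i
  have j1 := hi (.inl i) (0, 1) i
  have j2 := fun j => hi (.inr (.inl (i, j))) (EuclideanSpace.single j 1, 0) i
  have j3 := hi (.inr (.inr ())) (EuclideanSpace.single i 1, 0) i
  simp only [comp] at e1 e2 e3 j1 j2 j3
  simp only [dt_eq_pd, dx_eq_pd]
  rw [e1, e3]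
  simp only [e2]
  rw [Finset.sum_neg_distrib, ← integral_finsetSum _ fun j _ => j2 j, ← neg_add, ← neg_add,
    ← integral_add j1 (integrable_finsetSum _ fun j _ => j2 j)]
  have j4 : Integrable fun y => pd (0, 1) (fun w => (z w).1 i) y * φ y i
      + ∑ j, pd (EuclideanSpace.single j 1, 0) (fun w => (z w).2.1.1 i j) y * φ y i :=
    j1.add (integrable_finsetSum _ fun j _ => j2 j)
  rw [← integral_add j4 j3, neg_eq_zero]
  have : ∀ y, pd (0, 1) (fun w => (z w).1 i) y * φ y i
      + ∑ j, pd (EuclideanSpace.single j 1, 0) (fun w => (z w).2.1.1 i j) y * φ y i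
      + pd (EuclideanSpace.single i 1, 0) (fun w => (z w).2.2) y * φ y i = 0 := fun y => by
    rw [← Finset.sum_mul, ← add_mul, ← add_mul]
    have := hz.momentum y i
    simp only [dt_eq_pd, dx_eq_pd] at this
    rw [this, zero_mul]
  simp only [this, integral_zero]

theorem IsCompactSol.weak_div {n : ℕ} {z : SpaceTime n → State n} (hz : IsCompactSol z)
    {ψ : SpaceTime n → ℝ} (hψ : IsTest ψ) : ∑ i, ∫ y, (z y).1 i * dx i ψ y = 0 := by
  have hk : ∀ i : Fin n, ∫ y, (z y).1 i * pd (EuclideanSpace.single i 1, 0) ψ y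
      = -∫ y, pd (EuclideanSpace.single i 1, 0) (fun w => (z w).1 i) y * ψ y := fun i => by
    rw [integral_pd_mul_eq_neg _ (hz.smooth_v_apply i) (hz.hasCompactSupport_comp (.inl i)) hψ.1,
      neg_neg]
  have hi : ∀ i ∈ Finset.univ, Integrable fun y =>
      pd (EuclideanSpace.single i 1, 0) (fun w => (z w).1 i) y * ψ y := fun i _ =>
    ((contDiff_pd _ (hz.smooth_v_apply i)).continuous.mul
      hψ.1.continuous).integrable_of_hasCompactSupport hψ.2.mul_left
  simp only [dx_eq_pd, hk]
  rw [Finset.sum_neg_distrib, ← integral_finsetSum _ hi, neg_eq_zero]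
  simp only [← Finset.sum_mul]
  have : ∀ y, ∑ i, pd (EuclideanSpace.single i 1, 0) (fun w => (z w).1 i) y = 0 := hz.div_free
  simp only [this, zero_mul, integral_zero]

theorem memLp_pd {n : ℕ} {φ : SpaceTime n → ℝ} (h : ContDiff ℝ ∞ φ) (hs : HasCompactSupport φ)
    (a : SpaceTime n) : MemLp (pd a φ) 2 :=
  (contDiff_pd a h).continuous.memLp_of_hasCompactSupport (hasCompactSupport_pd hs a)

theorem tendsto_integral_apply_sub_sq {n : ℕ} {Ω : Set (SpaceTime n)} (hΩ : IsOpen Ω)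
    (hΩb : Bornology.IsBounded Ω) {v : SpaceTime n → Vec n} (hv : IsUnitField Ω v)
    {w : ℕ → SpaceTime n → State n} (hw : ∀ k, w k ∈ X0 Ω)
    (h : Tendsto (fun k => distSq (fun y => (w k y).1) v) atTop (𝓝 0)) (i : Fin n) :
    Tendsto (fun k => ∫ y, ((w k y).1 i - v y i) ^ 2) atTop (𝓝 0) := by
  refine squeeze_zero (fun k => integral_nonneg fun y => sq_nonneg _) (fun k => ?_) h
  refine integral_mono_of_nonneg (ae_of_all _ fun y => sq_nonneg _)
    (integrable_norm_sub_sq hΩ hΩb hv (hw k)) (ae_of_all _ fun y => ?_)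
  have := PiLp.norm_apply_le ((w k y).1 - v y) i
  rw [Real.norm_eq_abs] at this
  simp only
  rw [← sq_abs]
  gcongr
  exact this

theorem isBoundedWeakEulerSolution_of_mem_X {n : ℕ} (hn : 0 < n) {Ω : Set (SpaceTime n)}
    (hΩ : IsOpen Ω) (hΩb : Bornology.IsBounded Ω) {z : SpaceTime n → State n} (hz : z ∈ X Ω)
    (hv : IsUnitField Ω fun y => (z y).1) {p : SpaceTime n → ℝ}
    (hp : p =ᵐ[volume] fun y => (z y).2.2 - ‖(z y).1‖ ^ 2 / (n : ℝ)) :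
    IsBoundedWeakEulerSolution (fun y => (z y).1) p := by
  have hn1 : (1 : ℝ) ≤ n := by exact_mod_cast hn
  have hn0 : (n : ℝ) ≠ 0 := by positivity
  obtain ⟨hq1, w, hw, hlim, hqlim⟩ := exists_strong_approx hn hΩ hΩb hz hv
  have hS := fun k => isCompactSol_of_mem_X0 hΩb (hw k)
  have hstress := stress_eq_of_mem_X hn hΩ hΩb hz hv
  have hmem : ∀ c, MemLp (fun y => comp c (z y)) 2 := fun c => memLp_of_mem_X hΩ hΩb hz c 2
  have hulim : ∀ i j, Tendsto (fun k => ∫ y, ((w k y).2.1.1 i j - (z y).2.1.1 i j) ^ 2)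
      atTop (𝓝 0) := fun i j => by
    refine (tendsto_integral_stress_sub_sq hn hΩ hΩb hv hw hlim i j).congr fun k =>
      integral_congr_ae ?_
    filter_upwards [hstress] with y hy
    rw [hy i j]
  have hvlim := tendsto_integral_apply_sub_sq hΩ hΩb hv hw hlim
  refine ⟨hz.1, ?_, fun φ hφ => ?_, fun ψ hψ => ?_⟩
  · rw [memLp_congr_ae hp]
    refine hz.2.2.1.sub (memLp_top_of_bound (C := 1) ?_ ?_)
    · exact (hv.meas.norm.pow 2).div₀ aestronglyMeasurable_const
    · filter_upwards [hv.norm_le] with y hy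
      rw [Real.norm_of_nonneg (by positivity)]
      refine (div_le_self (by positivity) hn1).trans ?_
      nlinarith [norm_nonneg (z y).1]
  · have hd : ∀ i a, MemLp (pd a fun w => φ w i) 2 := fun i a =>
      memLp_pd (hφ.apply i).1 (hφ.apply i).2 a
    have t1 := tendsto_finsetSum Finset.univ fun i (_ : i ∈ Finset.univ) =>
      tendsto_integral_mul_of_L2 (fun k => (hS k).memLp_comp (.inl i) 2) (hmem (.inl i))
        (hd i (0, 1)) (hvlim i)
    have t2 := tendsto_finsetSum Finset.univ fun i (_ : i ∈ Finset.univ) =>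
      tendsto_finsetSum Finset.univ fun j (_ : j ∈ Finset.univ) =>
      tendsto_integral_mul_of_L2 (fun k => (hS k).memLp_comp (.inr (.inl (i, j))) 2)
        (hmem (.inr (.inl (i, j)))) (hd i (EuclideanSpace.single j 1, 0)) (hulim i j)
    have t3 := tendsto_finsetSum Finset.univ fun i (_ : i ∈ Finset.univ) =>
      tendsto_integral_mul_of_L2 (fun k => (hS k).memLp_comp (.inr (.inr ())) 2)
        (hmem (.inr (.inr ()))) (hd i (EuclideanSpace.single i 1, 0)) hqlim
    have t := (t1.add t2).add t3
    have hz0 := tendsto_nhds_unique (tendsto_const_nhds.congr fun k =>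
      ((hS k).weak_momentum hφ).symm) t
    have i1 : ∀ i ∈ Finset.univ, Integrable fun y => (z y).1 i * dt (fun w => φ w i) y :=
      fun i _ => integrable_mul_of_memLp_two (hmem (.inl i)) (hd i (0, 1))
    have i2 : ∀ i, ∀ j ∈ Finset.univ, Integrable fun y =>
        (z y).2.1.1 i j * dx j (fun w => φ w i) y := fun i j _ =>
      integrable_mul_of_memLp_two (hmem (.inr (.inl (i, j))))
        (hd i (EuclideanSpace.single j 1, 0))
    have i3 : ∀ i ∈ Finset.univ, Integrable fun y => (z y).2.2 * dx i (fun w => φ w i) y :=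
      fun i _ => integrable_mul_of_memLp_two (hmem (.inr (.inr ())))
        (hd i (EuclideanSpace.single i 1, 0))
    have k1 := integrable_finsetSum _ i1
    have k2 := integrable_finsetSum Finset.univ fun i (_ : i ∈ Finset.univ) =>
      integrable_finsetSum _ (i2 i)
    have k3 := integrable_finsetSum _ i3
    have k12 : Integrable fun y => (∑ i, (z y).1 i * dt (fun w => φ w i) y)
        + ∑ i, ∑ j, (z y).2.1.1 i j * dx j (fun w => φ w i) y := k1.add k2
    calc _ = ∫ y, ((∑ i, (z y).1 i * dt (fun w => φ w i) y)
          + (∑ i, ∑ j, (z y).2.1.1 i j * dx j (fun w => φ w i) y)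
          + ∑ i, (z y).2.2 * dx i (fun w => φ w i) y) := by
          refine integral_congr_ae ?_
          filter_upwards [hstress, hp] with y h1 h2
          rw [h2]
          simp only [h1, symDev_outer_self, sub_mul, Finset.sum_sub_distrib, Matrix.one_apply,
            mul_ite, mul_one, mul_zero, ite_mul, zero_mul, Finset.sum_ite_eq, Finset.mem_univ,
            if_true, Finset.mul_sum]
          ring
      _ = (∑ i, ∫ y, (z y).1 i * dt (fun w => φ w i) y)
          + (∑ i, ∑ j, ∫ y, (z y).2.1.1 i j * dx j (fun w => φ w i) y)
          + ∑ i, ∫ y, (z y).2.2 * dx i (fun w => φ w i) y := by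
          rw [integral_add k12 k3, integral_add k1 k2, integral_finsetSum _ i1,
            integral_finsetSum _ i3, integral_finsetSum _ fun i _ =>
              integrable_finsetSum _ (i2 i)]
          simp only [fun i => integral_finsetSum _ (i2 i)]
      _ = 0 := hz0.symm
  · have hd : ∀ a, MemLp (pd a ψ) 2 := memLp_pd hψ.1 hψ.2
    have t1 := tendsto_finsetSum Finset.univ fun i (_ : i ∈ Finset.univ) =>
      tendsto_integral_mul_of_L2 (fun k => (hS k).memLp_comp (.inl i) 2) (hmem (.inl i))
        (hd (EuclideanSpace.single i 1, 0)) (hvlim i)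
    have hz0 := tendsto_nhds_unique (tendsto_const_nhds.congr fun k =>
      ((hS k).weak_div hψ).symm) t1
    have hi : ∀ i ∈ Finset.univ, Integrable fun y => (z y).1 i * dx i ψ y := fun i _ =>
      integrable_mul_of_memLp_two (hmem (.inl i)) (hd (EuclideanSpace.single i 1, 0))
    rw [integral_finsetSum _ hi]
    exact hz0.symm

/-- The defect `v ⊗ v - (1/n) |v|² Iₙ - u` of a state `(v, u, q)`. -/
def defect {n : ℕ} (a : State n) (i j : Fin n) : ℝ :=
  (symDev (outer a.1 a.1)).1 i j - a.2.1.1 i j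

/-- The pressure `q - (1/n) |v|²` of a state `(v, u, q)`. -/
def eulerPressure {n : ℕ} (a : State n) : ℝ := a.2.2 - ‖a.1‖ ^ 2 / (n : ℝ)

/-- The divergence of the defect of `z`. -/
def force {n : ℕ} (z : SpaceTime n → State n) (y : SpaceTime n) : Vec n :=
  WithLp.toLp 2 fun i => ∑ j, dx j (fun w => defect (z w) i j) y

theorem defect_zero {n : ℕ} (i j : Fin n) : defect (0 : State n) i j = 0 := by
  simp [defect, symDev_outer_self]

theorem eulerPressure_zero {n : ℕ} : eulerPressure (0 : State n) = 0 := by simp [eulerPressure]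

theorem IsLinearSol.smooth_norm_sq {n : ℕ} {z : SpaceTime n → State n} (hz : IsLinearSol z) :
    ContDiff ℝ ∞ fun y => ‖(z y).1‖ ^ 2 := hz.smooth_v.norm_sq ℝ

theorem IsLinearSol.smooth_defect {n : ℕ} {z : SpaceTime n → State n} (hz : IsLinearSol z)
    (i j : Fin n) : ContDiff ℝ ∞ fun y => defect (z y) i j := by
  simp only [defect, symDev_outer_self]
  exact (((hz.smooth_v_apply i).mul (hz.smooth_v_apply j)).sub
    ((hz.smooth_norm_sq.div_const _).mul contDiff_const)).sub (hz.smooth_u i j)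

theorem IsLinearSol.smooth_eulerPressure {n : ℕ} {z : SpaceTime n → State n}
    (hz : IsLinearSol z) : ContDiff ℝ ∞ fun y => eulerPressure (z y) :=
  hz.smooth_q.sub (hz.smooth_norm_sq.div_const _)

theorem IsLinearSol.smooth_force {n : ℕ} {z : SpaceTime n → State n} (hz : IsLinearSol z) :
    ContDiff ℝ ∞ (force z) :=
  contDiff_euclidean.2 fun i => ContDiff.sum (s := Finset.univ) fun j _ =>
    contDiff_pd (EuclideanSpace.single j 1, 0) (hz.smooth_defect i j)

theorem tsupport_defect_subset {n : ℕ} (z : SpaceTime n → State n) (i j : Fin n) :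
    tsupport (fun y => defect (z y) i j) ⊆ tsupport z :=
  tsupport_comp_subset (g := fun a : State n => defect a i j) (defect_zero i j) z

theorem tsupport_force_subset {n : ℕ} (z : SpaceTime n → State n) :
    tsupport (force z) ⊆ tsupport z := by
  refine closure_minimal (fun y hy => ?_) (isClosed_tsupport z)
  by_contra h
  refine hy ?_
  ext i
  exact Finset.sum_eq_zero (s := Finset.univ) fun j _ => image_eq_zero_of_notMem_tsupport
    (f := pd (EuclideanSpace.single j 1, 0) fun w => defect (z w) i j) fun h' =>
      h (tsupport_defect_subset z i j (tsupport_pd_subset _ _ h'))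

theorem IsLinearSol.solvesForcedEuler {n : ℕ} {z : SpaceTime n → State n} (hz : IsLinearSol z) :
    SolvesForcedEuler (fun y => (z y).1) (fun y => eulerPressure (z y)) (force z) := by
  refine ⟨fun y i => ?_, hz.div_free⟩
  have hm := hz.momentum y i
  have h1 : ∀ j, dx j (fun w => defect (z w) i j) y = dx j (fun w => (z w).1 i * (z w).1 j) y
      + dx j (fun w => ‖(z w).1‖ ^ 2) y * (-(1 : Matrix (Fin n) (Fin n) ℝ) i j / n)
      + dx j (fun w => (z w).2.1.1 i j) y * (-1) := fun j => by
    have s1 := (hz.smooth_v_apply i).mul (hz.smooth_v_apply j)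
    have s2 : ContDiff ℝ ∞ fun w => ‖(z w).1‖ ^ 2 * (-(1 : Matrix (Fin n) (Fin n) ℝ) i j / n) :=
      hz.smooth_norm_sq.mul contDiff_const
    have s3 : ContDiff ℝ ∞ fun w => (z w).2.1.1 i j * (-1) := (hz.smooth_u i j).mul contDiff_const
    have e : (fun w => defect (z w) i j) = fun w => ((z w).1 i * (z w).1 j
        + ‖(z w).1‖ ^ 2 * (-(1 : Matrix (Fin n) (Fin n) ℝ) i j / n))
        + (z w).2.1.1 i j * (-1) := by
      funext w; simp only [defect, symDev_outer_self]; ring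
    rw [e, dx_add j (s1.add s2) s3, dx_add j s1 s2]
    simp only [dx_eq_pd, pd_mul_const _ hz.smooth_norm_sq, pd_mul_const _ (hz.smooth_u i j)]
  have h2 : dx i (fun w => eulerPressure (z w)) y
      = dx i (fun w => (z w).2.2) y + dx i (fun w => ‖(z w).1‖ ^ 2) y * (-1 / n) := by
    have e : (fun w => eulerPressure (z w))
        = fun w => (z w).2.2 + ‖(z w).1‖ ^ 2 * (-1 / n) := by
      funext w; simp only [eulerPressure]; ring
    rw [e, dx_add i hz.smooth_q (hz.smooth_norm_sq.mul contDiff_const)]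
    simp only [dx_eq_pd, pd_mul_const _ hz.smooth_norm_sq]
  have h3 : force z y i = ∑ j, dx j (fun w => defect (z w) i j) y := rfl
  have h4 : ∑ j, dx j (fun w => ‖(z w).1‖ ^ 2) y * (-(1 : Matrix (Fin n) (Fin n) ℝ) i j / n)
      = dx i (fun w => ‖(z w).1‖ ^ 2) y * (-1 / n) := by
    rw [Finset.sum_eq_single i (fun j _ hj => by simp [Matrix.one_apply_ne' hj]) (by simp)]
    simp
  rw [h3, h2]
  simp only [h1, Finset.sum_add_distrib, h4, ← Finset.sum_mul]
  linarith

theorem integral_dx_sq_le_h1NormSq {n : ℕ} {φ : SpaceTime n → Vec n} (hφ : IsTest φ)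
    (i j : Fin n) : ∫ y, dx j (fun w => φ w i) y ^ 2 ≤ h1NormSq φ := by
  have hsq : ∀ {f : SpaceTime n → ℝ}, Continuous f → HasCompactSupport f →
      Integrable fun y => f y ^ 2 := fun h hs =>
    Continuous.integrable_of_hasCompactSupport (h.pow 2)
      (hs.comp_left (g := fun x : ℝ => x ^ 2) (by simp))
  have hd : ∀ i a, Integrable fun y => pd a (fun w => φ w i) y ^ 2 := fun i a =>
    hsq (contDiff_pd a (hφ.apply i).1).continuous (hasCompactSupport_pd (hφ.apply i).2 a)
  refine integral_mono_of_nonneg (ae_of_all _ fun y => sq_nonneg _) ?_ (ae_of_all _ fun y => ?_)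
  · refine integrable_finsetSum _ fun i _ => Integrable.add (Integrable.add
      (hsq (hφ.apply i).1.continuous (hφ.apply i).2) (integrable_finsetSum _ fun j _ => ?_)) ?_
    exacts [hd i (EuclideanSpace.single j 1, 0), hd i (0, 1)]
  · refine le_trans ?_ (Finset.single_le_sum (f := fun i => (φ y i) ^ 2
      + (∑ j, (dx j (fun w => φ w i) y) ^ 2) + (dt (fun w => φ w i) y) ^ 2)
      (fun i _ => by positivity) (Finset.mem_univ i))
    have := Finset.single_le_sum (f := fun j => (dx j (fun w => φ w i) y) ^ 2)
      (fun j _ => by positivity) (Finset.mem_univ j)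
    have h1 := sq_nonneg (φ y i)
    have h2 := sq_nonneg (dt (fun w => φ w i) y)
    simp only at this ⊢
    linarith

theorem hNegOneNorm_force_le {n : ℕ} {z : SpaceTime n → State n} (hz : IsCompactSol z) :
    hNegOneNorm (force z)
      ≤ ENNReal.ofReal (∑ i, ∑ j, Real.sqrt (∫ y, defect (z y) i j ^ 2)) := by
  refine iSup₂_le fun φ ⟨hφ, h1⟩ => ENNReal.ofReal_le_ofReal ?_
  have hs : ∀ i j, HasCompactSupport fun y => defect (z y) i j := fun i j =>
    hz.compact.comp_left (g := fun a : State n => defect a i j) (defect_zero i j)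
  have hi : ∀ i, ∀ j ∈ Finset.univ, Integrable fun y =>
      dx j (fun w => defect (z w) i j) y * φ y i := fun i j _ =>
    ((contDiff_pd _ (hz.smooth_defect i j)).continuous.mul
      (hφ.apply i).1.continuous).integrable_of_hasCompactSupport (hφ.apply i).2.mul_left
  have e : ∀ y, ∑ i, force z y i * φ y i
      = ∑ i, ∑ j, dx j (fun w => defect (z w) i j) y * φ y i := fun y =>
    Finset.sum_congr rfl fun i _ => by rw [← Finset.sum_mul]; rfl
  simp only [e]
  rw [integral_finsetSum _ fun i _ => integrable_finsetSum _ (hi i)]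
  refine (Finset.abs_sum_le_sum_abs _ _).trans (Finset.sum_le_sum fun i _ => ?_)
  rw [integral_finsetSum _ (hi i)]
  refine (Finset.abs_sum_le_sum_abs _ _).trans (Finset.sum_le_sum fun j _ => ?_)
  simp only [dx_eq_pd]
  rw [integral_pd_mul_eq_neg _ (hz.smooth_defect i j) (hs i j) (hφ.apply i).1, abs_neg]
  refine (abs_integral_mul_le ((hz.smooth_defect i j).continuous.memLp_of_hasCompactSupport
    (hs i j)) (memLp_pd (hφ.apply i).1 (hφ.apply i).2 _)).trans ?_
  refine mul_le_of_le_one_right (Real.sqrt_nonneg _) ?_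
  exact Real.sqrt_le_one.2 ((integral_dx_sq_le_h1NormSq hφ i j).trans h1)

theorem integral_defect_sq_le {n : ℕ} (hn : 0 < n) {Ω : Set (SpaceTime n)} (hΩ : IsOpen Ω)
    (hΩb : Bornology.IsBounded Ω) {v : SpaceTime n → Vec n} (hv : IsUnitField Ω v)
    {z : SpaceTime n → State n} (hz : z ∈ X0 Ω) (i j : Fin n) :
    ∫ y, defect (z y) i j ^ 2 ≤ 16 * distSq (fun y => (z y).1) v := by
  rw [distSq, ← integral_const_mul]
  refine integral_mono_of_nonneg (ae_of_all _ fun y => sq_nonneg _)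
    ((integrable_norm_sub_sq hΩ hΩb hv hz).const_mul 16) ?_
  filter_upwards [abs_stress_sub_symDev_le hn hv hz] with y hy
  have h := hy i j
  rw [abs_sub_comm] at h
  calc defect (z y) i j ^ 2 = |defect (z y) i j| ^ 2 := (sq_abs _).symm
    _ ≤ (4 * ‖(z y).1 - v y‖) ^ 2 := by gcongr; exact h
    _ = 16 * ‖(z y).1 - v y‖ ^ 2 := by ring

theorem tendsto_hNegOneNorm_force {n : ℕ} (hn : 0 < n) {Ω : Set (SpaceTime n)} (hΩ : IsOpen Ω)
    (hΩb : Bornology.IsBounded Ω) {v : SpaceTime n → Vec n} (hv : IsUnitField Ω v)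
    {w : ℕ → SpaceTime n → State n} (hw : ∀ k, w k ∈ X0 Ω)
    (h : Tendsto (fun k => distSq (fun y => (w k y).1) v) atTop (𝓝 0)) :
    Tendsto (fun k => hNegOneNorm (force (w k))) atTop (𝓝 0) := by
  refine tendsto_of_tendsto_of_tendsto_of_le_of_le tendsto_const_nhds ?_ (fun k => zero_le)
    fun k => hNegOneNorm_force_le (isCompactSol_of_mem_X0 hΩb (hw k))
  rw [← ENNReal.ofReal_zero]
  refine ENNReal.tendsto_ofReal ?_
  rw [show (0 : ℝ) = ∑ i : Fin n, ∑ j : Fin n, 0 by simp]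
  refine tendsto_finsetSum _ fun i _ => tendsto_finsetSum _ fun j _ => ?_
  have h1 : Tendsto (fun k => ∫ y, defect (w k y) i j ^ 2) atTop (𝓝 0) :=
    squeeze_zero (fun k => integral_nonneg fun y => sq_nonneg _)
      (fun k => integral_defect_sq_le hn hΩ hΩb hv (hw k) i j) (by simpa using h.const_mul 16)
  simpa [Function.comp_def] using (Real.continuous_sqrt.tendsto 0).comp h1

theorem abs_eulerPressure_le {n : ℕ} (hn : 0 < n) {a : State n} (hv : ‖a.1‖ ≤ 1)
    (hq : |a.2.2| ≤ 1) : |eulerPressure a| ≤ 2 := by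
  have hn1 : (1 : ℝ) ≤ n := by exact_mod_cast hn
  have h1 : ‖a.1‖ ^ 2 / (n : ℝ) ≤ 1 :=
    (div_le_self (by positivity) hn1).trans (pow_le_one₀ (norm_nonneg _) hv)
  have h2 : 0 ≤ ‖a.1‖ ^ 2 / (n : ℝ) := by positivity
  rw [abs_le] at hq ⊢
  simp only [eulerPressure]
  constructor <;> linarith

theorem sq_eulerPressure_sub_le {n : ℕ} (hn : 0 < n) {a b : State n} (ha : ‖a.1‖ ≤ 1)
    (hb : ‖b.1‖ ≤ 1) :
    (eulerPressure a - eulerPressure b) ^ 2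
      ≤ 2 * (a.2.2 - b.2.2) ^ 2 + 8 * ‖a.1 - b.1‖ ^ 2 := by
  have hn1 : (1 : ℝ) ≤ n := by exact_mod_cast hn
  have h1 : |(‖a.1‖ ^ 2 - ‖b.1‖ ^ 2) / n| ≤ 2 * ‖a.1 - b.1‖ := by
    rw [abs_div, Nat.abs_cast]
    exact (div_le_self (abs_nonneg _) hn1).trans (abs_norm_sq_sub_le ha hb)
  have h2 : ((‖a.1‖ ^ 2 - ‖b.1‖ ^ 2) / n) ^ 2 ≤ 4 * ‖a.1 - b.1‖ ^ 2 := by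
    rw [← sq_abs]
    calc _ ≤ (2 * ‖a.1 - b.1‖) ^ 2 := by gcongr
      _ = _ := by ring
  have e : eulerPressure a - eulerPressure b
      = (a.2.2 - b.2.2) - (‖a.1‖ ^ 2 - ‖b.1‖ ^ 2) / n := by
    simp only [eulerPressure]; ring
  rw [e]
  nlinarith [sq_nonneg ((a.2.2 - b.2.2) + (‖a.1‖ ^ 2 - ‖b.1‖ ^ 2) / n)]

theorem isLimitOfForcedSmooth_of_mem_X {n : ℕ} (hn : 0 < n) {Ω : Set (SpaceTime n)}
    (hΩ : IsOpen Ω) (hΩb : Bornology.IsBounded Ω) {z : SpaceTime n → State n} (hz : z ∈ X Ω)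
    (hv : IsUnitField Ω fun y => (z y).1) {p : SpaceTime n → ℝ}
    (hp : p =ᵐ[volume] fun y => (z y).2.2 - ‖(z y).1‖ ^ 2 / (n : ℝ)) :
    IsLimitOfForcedSmooth Ω (fun y => (z y).1) p := by
  obtain ⟨hq1, w, hw, hlim, hqlim⟩ := exists_strong_approx hn hΩ hΩb hz hv
  have hS := fun k => isCompactSol_of_mem_X0 hΩb (hw k)
  have hsub : ∀ k, tsupport (w k) ⊆ Ω := fun k => (mem_X0_iff.1 (hw k)).2.1
  have hp' : ∀ᵐ y, p y = eulerPressure (z y) := hp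
  have hq0 : ∀ᵐ y, y ∉ Ω → (z y).2.2 = 0 := comp_eq_zero_of_mem_X hΩ hz (.inr (.inr ()))
  refine ⟨fun k y => (w k y).1, fun k y => eulerPressure (w k y), fun k => force (w k),
    fun k => ⟨⟨(hS k).smooth_v, (hS k).hasCompactSupport_fst⟩,
      ⟨(hS k).smooth_eulerPressure, (hS k).compact.comp_left eulerPressure_zero⟩,
      ⟨(hS k).smooth_force, (hS k).compact.mono' (subset_tsupport _ |>.trans
        (tsupport_force_subset _))⟩⟩,
    fun k => ⟨(tsupport_comp_subset (g := Prod.fst) rfl (w k)).trans (hsub k),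
      (tsupport_comp_subset (g := eulerPressure) eulerPressure_zero (w k)).trans (hsub k),
      (tsupport_force_subset (w k)).trans (hsub k)⟩,
    fun k => (hS k).solvesForcedEuler, tendsto_hNegOneNorm_force hn hΩ hΩb hv hw hlim,
    ⟨2, fun k y => ⟨(norm_le_one_of_mem_X0 (hw k) y).trans one_le_two,
      abs_eulerPressure_le hn (norm_le_one_of_mem_X0 (hw k) y)
        (abs_pressure_le_of_mem_X0 (hw k) y)⟩⟩, fun r hr hr' => ⟨?_, ?_⟩⟩
  · refine tendsto_eLpNorm_of_L2 (f := fun k y => (w k y).1 - (z y).1) hΩ hΩb (C := 2)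
      (fun k => (hS k).smooth_v.continuous.aestronglyMeasurable.sub hv.meas) (fun k => ?_)
      (fun k => ?_) hlim hr hr'
    · filter_upwards [hv.norm_le] with y hy
      have := norm_sub_le (w k y).1 (z y).1
      have := norm_le_one_of_mem_X0 (hw k) y
      linarith
    · filter_upwards [hv.zero] with y hy h
      rw [hy h, eq_zero_of_mem_X0 (hw k) h]
      simp
  · have hpm : AEStronglyMeasurable p :=
      (hz.2.2.1.1.sub ((hv.meas.norm.pow 2).div₀ aestronglyMeasurable_const)).congr hp.symm
    refine tendsto_eLpNorm_of_L2 (f := fun k y => eulerPressure (w k y) - p y) hΩ hΩb (C := 4)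
      (fun k => (hS k).smooth_eulerPressure.continuous.aestronglyMeasurable.sub hpm) (fun k => ?_)
      (fun k => ?_) ?_ hr hr'
    · filter_upwards [hv.norm_le, hq1, hp'] with y h1 h2 h3
      have h4 := norm_sub_le (eulerPressure (w k y)) (eulerPressure (z y))
      have h5 := abs_eulerPressure_le hn (norm_le_one_of_mem_X0 (hw k) y)
        (abs_pressure_le_of_mem_X0 (hw k) y)
      have h6 := abs_eulerPressure_le hn h1 h2
      rw [h3]
      rw [Real.norm_eq_abs, Real.norm_eq_abs, Real.norm_eq_abs] at h4
      rw [Real.norm_eq_abs]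
      linarith
    · filter_upwards [hv.zero, hq0, hp'] with y h1 h2 h3 h
      rw [h3, eq_zero_of_mem_X0 (hw k) h, eulerPressure_zero, eulerPressure, h1 h, h2 h]
      simp
    · have i1 : ∀ k, Integrable fun y => ((w k y).2.2 - (z y).2.2) ^ 2 := fun k => by
        have := ((hS k).memLp_comp (.inr (.inr ())) 2).sub
          (memLp_of_mem_X hΩ hΩb hz (.inr (.inr ())) 2)
        exact this.integrable_sq
      have i2 := fun k => integrable_norm_sub_sq hΩ hΩb hv (hw k)
      refine squeeze_zero (fun k => integral_nonneg fun y => sq_nonneg _) (fun k => ?_)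
        (by simpa using (hqlim.const_mul 2).add (hlim.const_mul 8))
      rw [distSq, ← integral_const_mul, ← integral_const_mul,
        ← integral_add ((i1 k).const_mul 2) ((i2 k).const_mul 8)]
      refine integral_mono_of_nonneg (ae_of_all _ fun y => sq_nonneg _)
        (((i1 k).const_mul 2).add ((i2 k).const_mul 8)) ?_
      filter_upwards [hv.norm_le, hp'] with y h1 h2
      rw [h2, Real.norm_eq_abs, sq_abs]
      exact sq_eulerPressure_sub_le hn (norm_le_one_of_mem_X0 (hw k) y) h1

end EulerInclusion

end

theorem theorem3 (n : ℕ) (hn : 2 ≤ n) (Ω : Set (EulerInclusion.SpaceTime n))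
    (hΩ : IsOpen Ω) (hΩb : Bornology.IsBounded Ω) :
    (∃ (v : EulerInclusion.SpaceTime n → EulerInclusion.Vec n)
        (p : EulerInclusion.SpaceTime n → ℝ), EulerInclusion.IsConstructed Ω v p) ∧
    ∀ (v : EulerInclusion.SpaceTime n → EulerInclusion.Vec n)
      (p : EulerInclusion.SpaceTime n → ℝ), EulerInclusion.IsConstructed Ω v p →
      EulerInclusion.IsBoundedWeakEulerSolution v p ∧
      (∀ᵐ y ∂volume.restrict Ω, ‖v y‖ = 1) ∧
      (∀ᵐ y ∂volume.restrict Ωᶜ, v y = 0 ∧ p y = 0) ∧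
      EulerInclusion.IsLimitOfForcedSmooth Ω v p := by
  refine ⟨EulerInclusion.exists_isConstructed hn hΩ hΩb, ?_⟩
  rintro v p ⟨z, hz, hzv, hu, hp⟩
  obtain rfl : (fun y => (z y).1) = v := funext hzv
  have hn0 : 0 < n := by lia
  have hv := EulerInclusion.isUnitField_of_mem_X hΩ hz hu
  refine ⟨EulerInclusion.isBoundedWeakEulerSolution_of_mem_X hn0 hΩ hΩb hz hv hp, hu, ?_,
    EulerInclusion.isLimitOfForcedSmooth_of_mem_X hn0 hΩ hΩb hz hv hp⟩
  rw [ae_restrict_iff' hΩ.measurableSet.compl]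
  filter_upwards [hv.zero, hp,
    EulerInclusion.comp_eq_zero_of_mem_X hΩ hz (.inr (.inr ()))] with y h1 h2 h3 h
  have h4 : (z y).2.2 = 0 := h3 h
  have h5 : (z y).1 = 0 := h1 h
  exact ⟨h5, by rw [h2, h4, h5]; simp⟩
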